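/- \textbf{Conventions.} All spaces carry a base point $*$; maps, homotopies ($\simeq$) and homotopy equivalences are base point preserving. $\Sigma$ is the reduced suspension, $\Omega$ the based loop space, an $H$-space under concatenation ``$\cdot$'' of loops (with $\bar a$ the reverse of the loop $a$); products of $H$-spaces have the product structure. $X\wedge Y=(X\times Y)/(X\vee Y)$ with quotient map $q$, and $\mathrm{ad}:[\Sigma A,X]\to[A,\Omega X]$ is the adjunction bijection. A \emph{Samelson map} for $X$ is a map $S:\Omega X\wedge\Omega X\to\Omega X$ such that $S\circ q$ is homotopic to the commutator map $(a,b)\mapsto a\cdot b\cdot\bar a\cdot\bar b$. The \emph{generalized Whitehead product} of $\alpha:\Sigma A\to X$ and $\beta:\Sigma B\to X$ is $[\alpha,\beta]=\mathrm{ad}^{-1}\bigl(S\circ(\mathrm{ad}\,\alpha\wedge \mathrm{ad}\,\beta)\bigr)\in[\Sigma(A\wedge B),X]$. A \emph{fibration} $F'\xrightarrow{i}E\xrightarrow{p}B'$ is a Hurewicz fibration $p$ (it has the homotopy lifting property for all spaces) together with a map $i$ that sends $F'$ into the fibre $p^{-1}(*)$ and is a homotopy equivalence $F'\to p^{-1}(*)$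 (of unbased spaces), for instance the inclusion of the fibre. A \emph{homotopy section} of $p$ is a map $s:B'\to E$ with $p\circ s\simeq \mathrm{Id}_{B'}$. For $f:\Sigma X\to B'$ and $g:\Sigma Y\to F'$ the \emph{generalized brace product} $\{f,g\}_s\in[\Sigma(X\wedge Y),F']$ is the element determined by $i_*\{f,g\}_s=[s\circ f,i\circ g]$. Let $\varphi_s=\Omega s\cdot\Omega i:\Omega B'\times\Omega F'\to\Omega E$, $(\beta,\gamma)\mapsto (s\circ\beta)\cdot(i\circ\gamma)$; it is called an \emph{$H$-splitting} if it is a homotopy equivalence and a map of $H$-spaces, that is, if it also preserves the multiplications up to homotopy. \textbf{Proposition.} Let $B$, $F$, $E$ be CW-complexes with base points, and let $\Sigma F\xrightarrow{i}E\xrightarrow{p}\Sigma B$ be a fibration with a homotopy section $s:\Sigma B\to E$. If $\{\mathrm{Id}_{\Sigma B},\mathrm{Id}_{\Sigma F}\}_s=0$ in $[\Sigma(B\wedge F),\Sigma F]$, where $0$ is the class of the constant map, then $E\simeq\Sigma B\times\Sigma F$, and moreover $\varphi_s=\Omega s\cdot\Omega i:\Omega\Sigma B\times\Omega\Sigma F\to\Omega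 E$ is an $H$-splitting. -/

import Mathlib

open scoped unitInterval

universe u v w

noncomputable section

namespace PtdHtpy

/-! ### Based spaces, based maps, based homotopies -/

/-- A choice of base point. -/
class Based (X : Type u) where
  /-- The base point. -/
  pt : X

open Based

instance instBasedProd (X : Type u) (Y : Type v) [Based X] [Based Y] : Based (X × Y) :=
  ⟨(pt, pt)⟩

instance instBasedLoop {X : Type u} [TopologicalSpace X] (x : X) : Based (Path x x) :=
  ⟨Path.refl x⟩

/-- Base point preserving continuous maps. -/
structure PMap (X : Type u) (Y : Type v) [TopologicalSpace X] [TopologicalSpace Y]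
    [Based X] [Based Y] where
  /-- The underlying continuous map. -/
  toMap : C(X, Y)
  map_pt : toMap pt = pt

namespace PMap

variable {X : Type u} {Y : Type v} {Z : Type w}
  [TopologicalSpace X] [TopologicalSpace Y] [TopologicalSpace Z] [Based X] [Based Y] [Based Z]

variable (X) in
/-- The identity map. -/
def id : PMap X X := ⟨ContinuousMap.id X, rfl⟩

variable (X Y) in
/-- The constant map at the base point. -/
def const : PMap X Y := ⟨ContinuousMap.const X pt, rfl⟩

/-- The composite `g ∘ f`. -/
def comp (g : PMap Y Z) (f : PMap X Y) : PMap X Z :=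
  ⟨g.toMap.comp f.toMap, by simp [f.map_pt, g.map_pt]⟩

/-- Based homotopy: homotopy relative to the base point. -/
def Homotopic (f g : PMap X Y) : Prop := f.toMap.HomotopicRel g.toMap {pt}

/-- `f` is a homotopy equivalence of based spaces. -/
def IsHomotopyEquiv (f : PMap X Y) : Prop :=
  ∃ g : PMap Y X, (g.comp f).Homotopic (id X) ∧ (f.comp g).Homotopic (id Y)

end PMap

/-- Two based spaces are homotopy equivalent (through based maps and based homotopies). -/
def HomotopyEquivalent (X : Type u) (Y : Type v) [TopologicalSpace X] [TopologicalSpace Y]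
    [Based X] [Based Y] : Prop :=
  ∃ f : PMap X Y, f.IsHomotopyEquiv

/-! ### Smash product and reduced suspension -/

/-- The equivalence relation collapsing the subset `S` of `X` to one point. -/
def collapse {X : Type u} (S : Set X) : Setoid X where
  r x y := x = y ∨ (x ∈ S ∧ y ∈ S)
  iseqv :=
    { refl := fun _ => Or.inl rfl
      symm := by
        rintro x y (h | ⟨h, h'⟩)
        · exact Or.inl h.symm
        · exact Or.inr ⟨h', h⟩
      trans := by
        rintro x y z (rfl | ⟨h, h'⟩) (rfl | ⟨k, k'⟩)
        · exact Or.inl rfl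
        · exact Or.inr ⟨k, k'⟩
        · exact Or.inr ⟨h, h'⟩
        · exact Or.inr ⟨h, k'⟩ }

/-- The wedge `X ∨ Y`, as the subset `X × {pt} ∪ {pt} × Y` of `X × Y`. -/
def wedge (X : Type u) (Y : Type v) [Based X] [Based Y] : Set (X × Y) :=
  {z | z.1 = pt ∨ z.2 = pt}

/-- The smash product `X ∧ Y = (X × Y) / (X ∨ Y)`, with the quotient topology. -/
def Smash (X : Type u) (Y : Type v) [Based X] [Based Y] : Type (max u v) :=
  Quotient (collapse (wedge X Y))

/-- The subset `X × {0, 1} ∪ {pt} × I` of `X × I` that the reduced suspension collapses. -/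
def suspBase (X : Type u) [Based X] : Set (X × I) :=
  {z | z.1 = pt ∨ z.2 = 0 ∨ z.2 = 1}

/-- The reduced suspension `ΣX = (X × I) / (X × {0, 1} ∪ {pt} × I)`, with the quotient
topology. -/
def Susp (X : Type u) [Based X] : Type u :=
  Quotient (collapse (suspBase X))

section Instances

variable (X : Type u) (Y : Type v) [TopologicalSpace X] [TopologicalSpace Y] [Based X] [Based Y]

instance instTopSmash : TopologicalSpace (Smash X Y) :=
  inferInstanceAs (TopologicalSpace (Quotient (collapse (wedge X Y))))

instance instBasedSmash : Based (Smash X Y) := ⟨Quotient.mk _ (pt, pt)⟩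

instance instTopSusp : TopologicalSpace (Susp X) :=
  inferInstanceAs (TopologicalSpace (Quotient (collapse (suspBase X))))

instance instBasedSusp : Based (Susp X) := ⟨Quotient.mk _ (pt, 0)⟩

/-- The quotient map `q : X × Y → X ∧ Y`. -/
def smashMk : PMap (X × Y) (Smash X Y) :=
  ⟨⟨fun z => Quotient.mk (collapse (wedge X Y)) z, continuous_quotient_mk'⟩, rfl⟩

/-- The quotient map `X × I → ΣX`. -/
def suspMk : C(X × I, Susp X) :=
  ⟨fun z => Quotient.mk (collapse (suspBase X)) z, continuous_quotient_mk'⟩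

variable {X} in
theorem suspMk_eq_pt {z : X × I} (h : z ∈ suspBase X) : suspMk X z = pt :=
  Quotient.sound (s := collapse (suspBase X)) (Or.inr ⟨h, Or.inl rfl⟩)

end Instances

/-- The map `f ∧ g : A ∧ B → X ∧ Y` induced by `f × g`. -/
def smashMap {A : Type u} {B : Type v} {X : Type w} {Y : Type*}
    [TopologicalSpace A] [TopologicalSpace B] [TopologicalSpace X] [TopologicalSpace Y]
    [Based A] [Based B] [Based X] [Based Y] (f : PMap A X) (g : PMap B Y) :
    PMap (Smash A B) (Smash X Y) where
  toMap :=
    { toFun := Quotient.map (sa := collapse (wedge A B)) (sb := collapse (wedge X Y))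
        (Prod.map f.toMap g.toMap) (by
          have key : ∀ z ∈ wedge A B, Prod.map f.toMap g.toMap z ∈ wedge X Y := by
            rintro ⟨a, b⟩ (h | h)
            · left
              change a = pt at h
              simp [h, f.map_pt]
            · right
              change b = pt at h
              simp [h, g.map_pt]
          rintro x y (rfl | ⟨h, h'⟩)
          · exact Or.inl rfl
          · exact Or.inr ⟨key x h, key y h'⟩)
      continuous_toFun :=
        Continuous.quotient_map' (s := collapse (wedge A B)) (t := collapse (wedge X Y))
          (f.toMap.continuous.prodMap g.toMap.continuous) _ }
  map_pt := by
    change Quotient.mk (collapse (wedge X Y)) (Prod.map f.toMap g.toMap (pt, pt)) =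
      Quotient.mk (collapse (wedge X Y)) (pt, pt)
    simp [f.map_pt, g.map_pt]

/-! ### Loop spaces and the suspension-loop adjunction -/

/-- The based loop space `ΩX` (compact-open topology); its base point is the constant loop and
its `HSpace` structure is concatenation of loops. -/
abbrev LoopSp (X : Type u) [TopologicalSpace X] [Based X] : Type u := Path (pt : X) pt

/-- The map `Ωf : ΩX → ΩY`, `γ ↦ f ∘ γ`. -/
def loopMap {X : Type u} {Y : Type v} [TopologicalSpace X] [TopologicalSpace Y]
    [Based X] [Based Y] (f : PMap X Y) : PMap (LoopSp X) (LoopSp Y) where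
  toMap :=
    { toFun := fun γ => (γ.map f.toMap.continuous).cast f.map_pt.symm f.map_pt.symm
      continuous_toFun := by
        rw [← Path.continuous_uncurry_iff]
        change Continuous fun z : LoopSp X × I => f.toMap (z.1 z.2)
        fun_prop }
  map_pt := by
    ext t
    exact f.map_pt

section Adjunction

variable {A : Type u} {X : Type v} [TopologicalSpace A] [TopologicalSpace X] [Based A] [Based X]

/-- The adjoint `ad f : A → ΩX` of `f : ΣA → X`, `(ad f)(a)(t) = f [a, t]`. -/
def ad (f : PMap (Susp A) X) : PMap A (LoopSp X) where
  toMap :=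
    { toFun := fun a =>
        { toFun := fun t => f.toMap (suspMk A (a, t))
          continuous_toFun := by fun_prop
          source' := by rw [suspMk_eq_pt (Or.inr (Or.inl rfl)), f.map_pt]
          target' := by rw [suspMk_eq_pt (Or.inr (Or.inr rfl)), f.map_pt] }
      continuous_toFun := by
        rw [← Path.continuous_uncurry_iff]
        change Continuous fun z : A × I => f.toMap (suspMk A z)
        fun_prop }
  map_pt := by
    ext t
    change f.toMap (suspMk A (pt, t)) = pt
    rw [suspMk_eq_pt (Or.inl rfl), f.map_pt]

/-- The inverse adjoint `ad⁻¹ g : ΣA → X` of `g : A → ΩX`, `(ad⁻¹ g) [a, t] = g(a)(t)`. -/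
def adInv (g : PMap A (LoopSp X)) : PMap (Susp A) X where
  toMap :=
    { toFun := Quotient.lift (s := collapse (suspBase A)) (fun z : A × I => g.toMap z.1 z.2) (by
        have key : ∀ z ∈ suspBase A, g.toMap z.1 z.2 = pt := by
          rintro ⟨a, t⟩ (h | h | h)
          · change a = pt at h
            subst h
            change g.toMap pt t = pt
            rw [g.map_pt]
            rfl
          · change t = 0 at h
            subst h
            exact (g.toMap a).source
          · change t = 1 at h
            subst h
            exact (g.toMap a).target
        rintro x y (rfl | ⟨h, h'⟩)
        · rfl
        · exact (key x h).trans (key y h').symm)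
      continuous_toFun := by
        have h : Continuous fun z : A × I => g.toMap z.1 z.2 := by fun_prop
        exact h.quotient_lift (s := collapse (suspBase A)) _ }
  map_pt := by
    change g.toMap pt 0 = pt
    exact (g.toMap pt).source

theorem adInv_ad (f : PMap (Susp A) X) : adInv (ad f) = f := by
  obtain ⟨f, hf⟩ := f
  simp only [adInv, ad, PMap.mk.injEq]
  ext z
  induction z using Quotient.inductionOn
  rfl

theorem ad_adInv (g : PMap A (LoopSp X)) : ad (adInv g) = g := rfl

end Adjunction

/-! ### Samelson map, generalized Whitehead product, generalized brace product -/

/-- The commutator map `C : ΩX × ΩX → ΩX`, `(a, b) ↦ (a · b) · (ā · b̄)`. -/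
def commutatorMap (X : Type u) [TopologicalSpace X] [Based X] :
    PMap (LoopSp X × LoopSp X) (LoopSp X) where
  toMap :=
    { toFun := fun z => (z.1.trans z.2).trans (z.1.symm.trans z.2.symm)
      continuous_toFun :=
        Path.continuous_trans.comp (Path.continuous_trans.prodMk
          (Path.continuous_trans.comp
            (Path.continuous_symm.prodMap Path.continuous_symm))) }
  map_pt := by
    change ((Path.refl (pt : X)).trans (Path.refl pt)).trans
      ((Path.refl pt).symm.trans (Path.refl pt).symm) = Path.refl pt
    simp

/-- `S : ΩX ∧ ΩX → ΩX` is a Samelson map: `S ∘ q` is homotopic to the commutator map. -/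
def IsSamelsonMap {X : Type u} [TopologicalSpace X] [Based X]
    (S : PMap (Smash (LoopSp X) (LoopSp X)) (LoopSp X)) : Prop :=
  (S.comp (smashMk (LoopSp X) (LoopSp X))).Homotopic (commutatorMap X)

/-- `h : Σ(A ∧ B) → X` represents the generalized Whitehead product
`[α, β] = ad⁻¹ (S ∘ (ad α ∧ ad β))` of `α : ΣA → X` and `β : ΣB → X`, where `S` is a
Samelson map. -/
def IsWhiteheadProduct {A : Type u} {B : Type v} {X : Type w}
    [TopologicalSpace A] [TopologicalSpace B] [TopologicalSpace X] [Based A] [Based B] [Based X]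
    (α : PMap (Susp A) X) (β : PMap (Susp B) X) (h : PMap (Susp (Smash A B)) X) : Prop :=
  ∃ S : PMap (Smash (LoopSp X) (LoopSp X)) (LoopSp X),
    IsSamelsonMap S ∧ h.Homotopic (adInv (S.comp (smashMap (ad α) (ad β))))

section Fibration

variable {F E B : Type u} [TopologicalSpace F] [TopologicalSpace E] [TopologicalSpace B]
  [Based F] [Based E] [Based B]

/-- Hurewicz fibrations: the homotopy lifting property with respect to all spaces. -/
def IsFibration (p : C(E, B)) : Prop :=
  ∀ (Y : Type u) [TopologicalSpace Y] (f : C(Y, E)) (h : C(Y × I, B)),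
    (∀ y, h (y, 0) = p (f y)) →
      ∃ H : C(Y × I, E), (∀ y, H (y, 0) = f y) ∧ ∀ z, p (H z) = h z

/-- `F --i--> E --p--> B` is a fibration with (homotopy) fibre `F`: `p` is a fibration, and `i`
maps `F` by a homotopy equivalence to the fibre of `p` over the base point. The inclusion of the
actual fibre is the case of the identity equivalence. -/
structure IsFibrationSequence (i : PMap F E) (p : PMap E B) : Prop where
  isFibration : IsFibration p.toMap
  fibre : ∃ e : ContinuousMap.HomotopyEquiv F (p.toMap ⁻¹' {pt}), ∀ x, (e x : E) = i.toMap x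

/-- `s` is a homotopy section of `p`: `p ∘ s ≃ id`. -/
def IsHomotopySection (p : PMap E B) (s : PMap B E) : Prop :=
  (p.comp s).Homotopic (PMap.id B)

/-- For a fibration `F --i--> E → B` with homotopy section `s`, the map `d : Σ(X ∧ Y) → F`
represents the generalized brace product `{f, g}_s = i_*⁻¹ [s ∘ f, i ∘ g]` of `f : ΣX → B` and
`g : ΣY → F`. -/
def IsBraceProduct {X Y : Type u} [TopologicalSpace X] [TopologicalSpace Y] [Based X] [Based Y]
    (i : PMap F E) (s : PMap B E) (f : PMap (Susp X) B) (g : PMap (Susp Y) F)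
    (d : PMap (Susp (Smash X Y)) F) : Prop :=
  IsWhiteheadProduct (s.comp f) (i.comp g) (i.comp d)

/-- The map `φ_s = Ωs · Ωi : ΩB × ΩF → ΩE`. -/
def phi (s : PMap B E) (i : PMap F E) : PMap (LoopSp B × LoopSp F) (LoopSp E) where
  toMap :=
    { toFun := fun z => ((loopMap s).toMap z.1).trans ((loopMap i).toMap z.2)
      continuous_toFun := Path.continuous_trans.comp
        ((loopMap s).toMap.continuous.prodMap (loopMap i).toMap.continuous) }
  map_pt := by
    change ((loopMap s).toMap pt).trans ((loopMap i).toMap pt) = Path.refl pt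
    rw [(loopMap s).map_pt, (loopMap i).map_pt]
    exact Path.refl_trans_refl

end Fibration

/-- `f` is a map of `H`-spaces: it preserves the unit, and it preserves the multiplication up to
a homotopy relative to the unit. -/
def IsHMap {X : Type u} {Y : Type v} [TopologicalSpace X] [TopologicalSpace Y]
    [HSpace X] [HSpace Y] (f : C(X, Y)) : Prop :=
  f HSpace.e = HSpace.e ∧
    (f.comp HSpace.hmul).HomotopicRel (HSpace.hmul.comp (f.prodMap f)) {(HSpace.e, HSpace.e)}

/-- `φ_s` is an `H`-splitting: a homotopy equivalence that is a map of `H`-spaces, for the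
loop-concatenation structures on `ΩB × ΩF` and `ΩE`. -/
def IsHSplitting {F E B : Type u} [TopologicalSpace F] [TopologicalSpace E] [TopologicalSpace B]
    [Based F] [Based E] [Based B] (s : PMap B E) (i : PMap F E) : Prop :=
  (phi s i).IsHomotopyEquiv ∧ IsHMap (phi s i).toMap

end PtdHtpy

end

open PtdHtpy

noncomputable section

namespace PtdHtpy

open Based

/-! ### Clamping and gluing -/

/-! The brace product vanishes, so the Whitehead product of `s` and `i` is trivial. Hence the
commutator B × F → ΩE of their adjoints is null-homotopic
(`IsWhiteheadProduct.commutator_homotopic_const`). A null-homotopy of a commutator of loops amounts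
to a map on a square whose opposite sides agree, so s ∨ i extends, up to homotopy, to a map m : ΣB ×
ΣF → E (`exists_torus_extension`).

On the axes, p ∘ m is homotopic to the identity and to a constant, but it need not be homotopic to
the projection. This is repaired with a strict section s' in place of `s`: along the suspension
coordinate of ΣF, m is followed by the reverse of s' ∘ p ∘ m (`exists_fold`). The image under p of
the new map m' runs forth and back along the same track, so p ∘ m' contracts to the projection by a
homotopy that is constant over the base point, while m' is still homotopic to `s` and `i` on the
axes. Lifting that homotopy turns m' into a map over ΣB which is a homotopy equivalence on the fibre
over the base point. Since ΣB is the union of two closed sets contractible in ΣB, Dold's theorem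
(`exists_homotopy_inverse_of_fibre`) makes m' a free homotopy equivalence, and well-pointedness
makes it a based one (`Halo.isHomotopyEquiv`).

For the loop spaces, Ωm' on pairs of loops preserves concatenation strictly and is an equivalence.
Running the two loops simultaneously instead of one after the other identifies it with φ_s up to
homotopy (`homotopic_loopMul_axes`), so φ_s inherits both properties.

All products carry the product topology, so W × ΣA need not be a quotient of W × A × I.
Well-pointedness, in the form of `Halo`, replaces this: maps are first made stationary near the base
point. Halos come from the cell structures by induction over skeleta and pass to suspensions and
products. -/

/-- The retraction of the real line onto the unit interval. -/
def clampI (x : ℝ) : I := Set.projIcc 0 1 zero_le_one x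

@[fun_prop]
theorem continuous_clampI : Continuous clampI :=
  continuous_projIcc (h := zero_le_one)

theorem clampI_of_le {x : ℝ} (h : x ≤ 0) : clampI x = 0 := Set.projIcc_of_le_left _ h

theorem clampI_of_ge {x : ℝ} (h : 1 ≤ x) : clampI x = 1 := Set.projIcc_of_right_le _ h

@[simp] theorem clampI_coe (t : I) : clampI t = t := Set.projIcc_val _ t

theorem coe_clampI_of_mem {x : ℝ} (h0 : 0 ≤ x) (h1 : x ≤ 1) : (clampI x : ℝ) = x := by
  simp [clampI, Set.coe_projIcc, h0, h1]

@[simp] theorem clampI_zero : clampI 0 = 0 := clampI_of_le le_rfl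

@[simp] theorem clampI_one : clampI 1 = 1 := clampI_of_ge le_rfl

/-- A function which is continuous on the two closed sets `{f ≤ c}` and `{c ≤ f}` is continuous. -/
theorem continuous_of_le_of_ge {X Y : Type*} [TopologicalSpace X] [TopologicalSpace Y]
    {f : X → ℝ} (hf : Continuous f) (c : ℝ) {g g₁ g₂ : X → Y}
    (h₁ : ContinuousOn g₁ {x | f x ≤ c}) (h₂ : ContinuousOn g₂ {x | c ≤ f x})
    (e₁ : ∀ x, f x ≤ c → g x = g₁ x) (e₂ : ∀ x, c ≤ f x → g x = g₂ x) : Continuous g := by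
  rw [← continuousOn_univ]
  have : (Set.univ : Set X) = {x | f x ≤ c} ∪ {x | c ≤ f x} := by
    ext x; simpa using le_total (f x) c
  rw [this]
  exact (h₁.congr fun x hx => e₁ x hx).union_of_isClosed (h₂.congr fun x hx => e₂ x hx)
    (isClosed_le hf continuous_const) (isClosed_le continuous_const hf)

/-! ### Well-pointed spaces -/

/-- A numerable contraction of a neighbourhood of the base point, through based maps. -/
structure Halo (X : Type u) [TopologicalSpace X] [Based X] where
  /-- The deformation. -/
  H : C(X × I, X)
  /-- The numeration of the neighbourhood. -/
  v : C(X, ℝ)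
  H_zero : ∀ x, H (x, 0) = x
  H_pt : ∀ t, H (pt, t) = pt
  v_nonneg : ∀ x, 0 ≤ v x
  v_le_one : ∀ x, v x ≤ 1
  v_eq_one : ∀ x, v x = 1 ↔ x = pt
  H_one : ∀ x, 0 < v x → H (x, 1) = pt

/-! ### Cell complexes are well-pointed -/

section Cells

open Metric Set Topology

/-- Radial extension over the unit ball of a homotopy given on the unit sphere. -/
theorem exists_radial_extension {V : Type v} [NormedAddCommGroup V] [NormedSpace ℝ V]
    {X : Type u} [TopologicalSpace X]
    {φ : V → X} {ψ : V → ℝ → X} {ω : V → ℝ} {T T' : ℝ} (hT0 : 0 ≤ T) (hTT' : T < T') (hT1 : T' ≤ 1)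
    (hφ : ContinuousOn φ (closedBall 0 1))
    (hψ : ContinuousOn (fun z : V × ℝ => ψ z.1 z.2) (sphere 0 1 ×ˢ Icc 0 1))
    (hω : ContinuousOn ω (sphere 0 1))
    (hψ0 : ∀ θ ∈ sphere (0 : V) 1, ψ θ 0 = φ θ)
    (hfr : ∀ θ ∈ sphere (0 : V) 1, ∀ t ∈ Icc (0 : ℝ) 1, ψ θ t = ψ θ (min t T))
    (hω01 : ∀ θ ∈ sphere (0 : V) 1, ω θ ∈ Icc (0 : ℝ) 1) :
    ∃ (h : V → ℝ → X) (w : V → ℝ),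
      ContinuousOn (fun z : V × ℝ => h z.1 z.2) (closedBall 0 1 ×ˢ Icc 0 1) ∧
      ContinuousOn w (closedBall 0 1) ∧
      (∀ θ ∈ sphere (0 : V) 1, ∀ t ∈ Icc (0 : ℝ) 1, h θ t = ψ θ t) ∧
      (∀ θ ∈ sphere (0 : V) 1, w θ = ω θ) ∧
      (∀ c ∈ closedBall (0 : V) 1, h c 0 = φ c) ∧
      (∀ c ∈ closedBall (0 : V) 1, ∀ t ∈ Icc (0 : ℝ) 1, h c t = h c (min t T')) ∧
      (∀ c ∈ ball (0 : V) 1, 0 ≤ w c ∧ w c < 1) ∧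
      (∀ c ∈ ball (0 : V) 1, 0 < w c → ∃ θ ∈ sphere (0 : V) 1, 0 < ω θ ∧ h c 1 = ψ θ 1) := by
  have hT'0 : 0 < T' := hT0.trans_lt hTT'
  -- A point moves radially outwards until it meets the sphere, and then follows `ψ` for the
  -- remaining time; all motion stops at time `T'`.
  set h : V → ℝ → X := fun c t =>
    if ‖c‖ * (1 + min t T') ≤ 1 then φ ((1 + min t T') • c)
    else ψ (‖c‖⁻¹ • c) (‖c‖ * (1 + min t T') - 1) with hh
  -- A point of radius greater than `r` reaches a `ψ`-parameter greater than `T`, after which `ψ` is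
  -- stationary; it therefore ends where its boundary point ends. This is where `T < T'` is needed,
  -- and `w` is supported on these radii.
  set r : ℝ := (1 + T) / (1 + T') with hr
  have hr1 : r < 1 := by rw [hr, div_lt_one (by linarith)]; linarith
  have hr0 : 0 < r := by rw [hr]; positivity
  set w : V → ℝ := fun c => if ‖c‖ ≤ r then 0 else ω (‖c‖⁻¹ • c) * ((‖c‖ - r) / (1 - r)) with hw
  have hsph : ∀ c : V, 0 < ‖c‖ → ‖c‖⁻¹ • c ∈ sphere (0 : V) 1 := by
    intro c hc
    rw [mem_sphere_zero_iff_norm, norm_smul, norm_inv, norm_norm, inv_mul_cancel₀ hc.ne']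
  refine ⟨h, w, ?_, ?_, ?_, ?_, ?_, ?_, ?_, ?_⟩
  · have hset : closedBall (0 : V) 1 ×ˢ Icc (0 : ℝ) 1 ⊆
        {z : V × ℝ | z ∈ closedBall (0 : V) 1 ×ˢ univ ∧ z.2 ∈ Icc (0 : ℝ) 1 ∧
            ‖z.1‖ * (1 + min z.2 T') ≤ 1} ∪
          {z : V × ℝ | z ∈ closedBall (0 : V) 1 ×ˢ univ ∧ z.2 ∈ Icc (0 : ℝ) 1 ∧
            1 ≤ ‖z.1‖ * (1 + min z.2 T')} := by
      rintro ⟨c, t⟩ ⟨hc, ht⟩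
      rcases le_total (‖c‖ * (1 + min t T')) 1 with h | h
      · exact Or.inl ⟨⟨hc, trivial⟩, ht, h⟩
      · exact Or.inr ⟨⟨hc, trivial⟩, ht, h⟩
    have hcl : IsClosed (closedBall (0 : V) 1 ×ˢ (univ : Set ℝ)) :=
      isClosed_closedBall.prod isClosed_univ
    refine ContinuousOn.mono (ContinuousOn.union_of_isClosed ?_ ?_ ?_ ?_) hset
    · refine ContinuousOn.congr (f := fun z : V × ℝ => φ ((1 + min z.2 T') • z.1)) ?_ ?_
      · refine hφ.comp (by fun_prop) ?_
        rintro ⟨c, t⟩ ⟨-, ht, h1⟩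
        rw [mem_closedBall_zero_iff, norm_smul, mul_comm, Real.norm_of_nonneg]
        · exact h1
        · have : 0 ≤ min t T' := le_min ht.1 hT'0.le
          linarith
      · rintro ⟨c, t⟩ ⟨-, ht, h1⟩
        simp only [hh]
        rw [if_pos h1]
    · have hpos : ∀ z ∈ {z : V × ℝ | z ∈ closedBall (0 : V) 1 ×ˢ univ ∧ z.2 ∈ Icc (0 : ℝ) 1 ∧
            1 ≤ ‖z.1‖ * (1 + min z.2 T')}, 0 < ‖z.1‖ := by
        rintro ⟨c, t⟩ ⟨-, ht, h1⟩
        rcases (norm_nonneg c).eq_or_lt with h | h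
        · simp only [← h, zero_mul] at h1
          linarith
        · exact h
      refine ContinuousOn.congr (f := fun z : V × ℝ => ψ (‖z.1‖⁻¹ • z.1)
          (‖z.1‖ * (1 + min z.2 T') - 1)) ?_ ?_
      · refine hψ.comp (f := fun z : V × ℝ => (‖z.1‖⁻¹ • z.1, ‖z.1‖ * (1 + min z.2 T') - 1)) ?_ ?_
        · refine ContinuousOn.prodMk ?_ (by fun_prop)
          exact (ContinuousOn.inv₀ (by fun_prop) fun z hz => (hpos z hz).ne').smul (by fun_prop)
        · rintro ⟨c, t⟩ hz
          refine ⟨hsph c (hpos _ hz), ?_, ?_⟩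
          · exact sub_nonneg.2 hz.2.2
          · have h1 : ‖c‖ ≤ 1 := mem_closedBall_zero_iff.1 hz.1.1
            have h2 : min t T' ≤ 1 := (min_le_right _ _).trans hT1
            have h3 : 0 ≤ min t T' := le_min hz.2.1.1 hT'0.le
            change ‖c‖ * (1 + min t T') - 1 ≤ 1
            nlinarith [norm_nonneg c]
      · rintro ⟨c, t⟩ hz
        have hp := hpos _ hz
        simp only [hh]
        split_ifs with h1
        · have e1 : ‖c‖ * (1 + min t T') = 1 := le_antisymm h1 hz.2.2
          rw [e1, sub_self, hψ0 _ (hsph c hp)]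
          congr 2
          exact eq_inv_of_mul_eq_one_right e1
        · rfl
    · refine hcl.and ((isClosed_Icc.preimage continuous_snd).and
        (isClosed_le (by fun_prop) continuous_const))
    · refine hcl.and ((isClosed_Icc.preimage continuous_snd).and
        (isClosed_le continuous_const (by fun_prop)))
  · have hset : closedBall (0 : V) 1 ⊆ {c : V | ‖c‖ ≤ r} ∪ {c : V | r ≤ ‖c‖} := by
      intro c _
      exact le_total ‖c‖ r
    refine ContinuousOn.mono (ContinuousOn.union_of_isClosed ?_ ?_ (isClosed_le (by fun_prop)
      continuous_const) (isClosed_le continuous_const (by fun_prop))) hset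
    · refine continuousOn_const (c := (0 : ℝ)) |>.congr ?_
      intro c hc
      simp only [hw]
      exact if_pos hc
    · refine ContinuousOn.congr (f := fun c => ω (‖c‖⁻¹ • c) * ((‖c‖ - r) / (1 - r))) ?_ ?_
      · refine ContinuousOn.mul ?_ (by fun_prop)
        refine hω.comp ?_ ?_
        · exact (ContinuousOn.inv₀ (by fun_prop) fun z hz => (hr0.trans_le hz).ne').smul
            (by fun_prop)
        · intro c hc
          exact hsph c (hr0.trans_le hc)
      · intro c hc
        simp only [hw]
        split_ifs with h1
        · rw [le_antisymm h1 hc]; simp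
        · rfl
  · intro θ hθ t ht
    have hn : ‖θ‖ = 1 := mem_sphere_zero_iff_norm.1 hθ
    simp only [hh, hn, one_mul, inv_one, one_smul]
    split_ifs with h1
    · have : t = 0 := by
        rcases le_total t T' with h | h
        · rw [min_eq_left h] at h1; exact le_antisymm (by linarith) ht.1
        · rw [min_eq_right h] at h1; linarith
      subst this
      rw [min_eq_left hT'0.le, add_zero, one_smul, hψ0 θ hθ]
    · rw [add_sub_cancel_left, hfr θ hθ t ht, hfr θ hθ (min t T')
        ⟨le_min ht.1 hT'0.le, (min_le_left _ _).trans ht.2⟩, min_assoc, min_eq_right hTT'.le]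
  · intro θ hθ
    have hn : ‖θ‖ = 1 := mem_sphere_zero_iff_norm.1 hθ
    simp only [hw, hn, inv_one, one_smul]
    rw [if_neg (not_le.2 hr1), div_self (by linarith), mul_one]
  · intro c hc
    have : ‖c‖ ≤ 1 := mem_closedBall_zero_iff.1 hc
    simp only [hh]
    rw [min_eq_left hT'0.le, add_zero, mul_one, if_pos this, one_smul]
  · intro c _ t _
    simp only [hh]
    rw [min_assoc, min_self]
  · intro c hc
    have hc1 : ‖c‖ < 1 := mem_ball_zero_iff.1 hc
    simp only [hw]
    split_ifs with h1
    · exact ⟨le_rfl, one_pos⟩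
    · rw [not_le] at h1
      obtain ⟨h2, h3⟩ := hω01 _ (hsph c (hr0.trans h1))
      have h4 : (‖c‖ - r) / (1 - r) < 1 := by rw [div_lt_one (by linarith)]; linarith
      have h5 : 0 ≤ (‖c‖ - r) / (1 - r) := div_nonneg (by linarith) (by linarith)
      exact ⟨mul_nonneg h2 h5, (mul_le_of_le_one_left h5 h3).trans_lt h4⟩
  · intro c hc hwc
    have hc1 : ‖c‖ < 1 := mem_ball_zero_iff.1 hc
    simp only [hw] at hwc
    split_ifs at hwc with h1
    · exact absurd hwc (lt_irrefl _)
    rw [not_le] at h1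
    have hp := hr0.trans h1
    have hs := hsph c hp
    refine ⟨_, hs, ?_, ?_⟩
    · rcases (hω01 _ hs).1.eq_or_lt with h | h
      · rw [← h, zero_mul] at hwc; exact absurd hwc (lt_irrefl _)
      · exact h
    · have h2 : 1 + T < ‖c‖ * (1 + T') := by
        rw [hr, div_lt_iff₀ (by linarith)] at h1
        exact h1
      simp only [hh]
      rw [min_eq_right hT1, if_neg (by linarith), hfr _ hs 1 ⟨zero_le_one, le_rfl⟩,
        hfr _ hs (‖c‖ * (1 + T') - 1) ⟨by linarith, by nlinarith⟩, min_eq_right (by linarith),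
        min_eq_right (by linarith)]

/-- Contraction of a small ball around a point of the open unit ball, relative to the sphere. -/
theorem exists_ball_contraction {V : Type v} [NormedAddCommGroup V] [NormedSpace ℝ V] {y : V}
    (hy : y ∈ ball (0 : V) 1) {T : ℝ} (hT0 : 0 < T) (hT1 : T ≤ 1) :
    ∃ (h : V → ℝ → V) (w : V → ℝ), Continuous (fun z : V × ℝ => h z.1 z.2) ∧ Continuous w ∧
      (∀ c ∈ closedBall (0 : V) 1, ∀ t ∈ Icc (0 : ℝ) 1, h c t ∈ closedBall (0 : V) 1) ∧
      (∀ θ ∈ sphere (0 : V) 1, (∀ t, h θ t = θ) ∧ w θ = 0) ∧ (∀ c, h c 0 = c) ∧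
      (∀ c t, h c t = h c (min t T)) ∧ (∀ t, h y t = y) ∧ (∀ c, 0 ≤ w c ∧ w c ≤ 1) ∧
      (∀ c, w c = 1 ↔ c = y) ∧ (∀ c, 0 < w c → h c 1 = y) := by
  have hy1 : ‖y‖ < 1 := mem_ball_zero_iff.1 hy
  -- The ball of radius `2 * ε` about `y` stays inside the unit ball. The cutoff `g` is 1 on the
  -- `ε`-ball, where the contraction is complete, and 0 outside the `2 * ε`-ball.
  set ε : ℝ := (1 - ‖y‖) / 2 with hε
  have hε0 : 0 < ε := by rw [hε]; linarith
  set g : V → ℝ := fun c => max 0 (min 1 (2 - ‖c - y‖ / ε)) with hg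
  have hg0 : ∀ c, 0 ≤ g c := fun c => le_max_left _ _
  have hg1 : ∀ c, g c ≤ 1 := fun c => max_le zero_le_one (min_le_left _ _)
  have hgs : ∀ θ ∈ sphere (0 : V) 1, 2 ≤ ‖θ - y‖ / ε := by
    intro θ hθ
    have hn : ‖θ‖ = 1 := mem_sphere_zero_iff_norm.1 hθ
    rw [le_div_iff₀ hε0]
    have := norm_sub_norm_le θ y
    rw [hn] at this
    linarith
  refine ⟨fun c t => c + ((min t T / T) * g c) • (y - c), fun c => max 0 (1 - ‖c - y‖ / ε),
    ?_, ?_, ?_, ?_, ?_, ?_, ?_, ?_, ?_, ?_⟩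
  · fun_prop
  · fun_prop
  · intro c hc t ht
    have h0 : 0 ≤ min t T / T := div_nonneg (le_min ht.1 hT0.le) hT0.le
    have h1 : min t T / T ≤ 1 := (div_le_one hT0).2 (min_le_right _ _)
    have := (convex_closedBall (0 : V) 1).add_smul_sub_mem hc (ball_subset_closedBall hy)
      (t := min t T / T * g c) ⟨mul_nonneg h0 (hg0 c), mul_le_one₀ h1 (hg0 c) (hg1 c)⟩
    exact this
  · intro θ hθ
    have h2 := hgs θ hθ
    have h3 : g θ = 0 := max_eq_left ((min_le_right _ _).trans (by linarith))
    refine ⟨fun t => ?_, max_eq_left (by linarith)⟩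
    simp [h3]
  · intro c
    simp [min_eq_left hT0.le]
  · intro c t
    simp only [min_assoc, min_self]
  · intro t
    simp
  · intro c
    refine ⟨le_max_left _ _, max_le zero_le_one ?_⟩
    have : 0 ≤ ‖c - y‖ / ε := by positivity
    linarith
  · intro c
    constructor
    · intro h
      change max 0 (1 - ‖c - y‖ / ε) = 1 at h
      have h0 : 0 ≤ ‖c - y‖ / ε := by positivity
      have h1 : 1 - ‖c - y‖ / ε = 1 := by
        rcases max_choice 0 (1 - ‖c - y‖ / ε) with h' | h' <;> rw [h'] at h
        · norm_num at h
        · exact h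
      have h2 : ‖c - y‖ / ε = 0 := by linarith
      rw [div_eq_zero_iff] at h2
      rcases h2 with h2 | h2
      · exact sub_eq_zero.1 (norm_eq_zero.1 h2)
      · exact absurd h2 hε0.ne'
    · rintro rfl
      simp
  · intro c hc
    have h1 : 0 < 1 - ‖c - y‖ / ε := by
      rcases lt_max_iff.1 hc with h | h
      · exact absurd h (lt_irrefl _)
      · exact h
    have h3 : g c = 1 := by
      simp only [hg]
      rw [min_eq_left (by linarith)]
      exact max_eq_right zero_le_one
    simp only [h3, min_eq_right hT1, div_self hT0.ne', one_mul, one_smul]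
    abel

end Cells

/-! ### Induction over the skeleta of a CW complex -/

section CellInduction

open Metric Set Topology RelCWComplex

/-- A continuous map from a compact set to a Hausdorff space is closed, hence a quotient map onto
its image. This carries continuity from a closed ball to a closed cell. -/
theorem continuousOn_image_of_isCompact {X Y Z : Type*} [TopologicalSpace X] [TopologicalSpace Y]
    [TopologicalSpace Z] [T2Space Y] {K : Set X} (hK : IsCompact K) {Φ : X → Y} {F : Y → Z}
    (hΦ : ContinuousOn Φ K) (hF : ContinuousOn (fun x => F (Φ x)) K) :
    ContinuousOn F (Φ '' K) := by
  rw [continuousOn_iff_isClosed]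
  intro t ht
  obtain ⟨u, hu, hut⟩ := continuousOn_iff_isClosed.1 hF t ht
  refine ⟨Φ '' (u ∩ K), ((hK.inter_left hu).image_of_continuousOn
    (hΦ.mono inter_subset_right)).isClosed, ?_⟩
  ext y
  constructor
  · rintro ⟨h1, x, hx, rfl⟩
    have : x ∈ u ∩ K := hut ▸ ⟨h1, hx⟩
    exact ⟨⟨x, this, rfl⟩, x, hx, rfl⟩
  · rintro ⟨⟨x, hx, rfl⟩, h2⟩
    rw [← hut] at hx
    exact ⟨hx.1, h2⟩

theorem openCell_eq_of_mem {X : Type u} [TopologicalSpace X] [CWComplex (univ : Set X)] {n : ℕ}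
    {i j : cell (univ : Set X) n} {x : X} (hi : x ∈ openCell n i) (hj : x ∈ openCell n j) : i = j := by
  have := eq_of_not_disjoint_openCell (C := (univ : Set X)) (not_disjoint_iff.2 ⟨x, hi, hj⟩)
  simpa using this

variable {X : Type u} [TopologicalSpace X] [T2Space X] [CWComplex (univ : Set X)]

variable (X) in
/-- The union of the cells of dimension less than `n`. -/
def skel (n : ℕ) : Set X := (skeletonLT (univ : Set X) n : Set X)

theorem skel_zero : skel X 0 = ∅ := by
  have := CWComplex.skeletonLT_zero_eq_empty (C := (univ : Set X))
  simpa [skel] using this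

theorem skel_mono {m n : ℕ} (h : m ≤ n) : skel X m ⊆ skel X n :=
  skeletonLT_mono (by exact_mod_cast h)

theorem exists_mem_skel (x : X) : ∃ n, x ∈ skel X n := by
  have h : x ∈ ⋃ n : ℕ, (skeletonLT (univ : Set X) n : Set X) := by
    rw [iUnion_skeletonLT_eq_complex]; trivial
  simpa [skel] using h

theorem mem_skel_succ {n : ℕ} {x : X} (hx : x ∈ skel X (n + 1)) :
    x ∈ skel X n ∨ ∃ j : cell (univ : Set X) n, x ∈ openCell n j := by
  have hx' : x ∈ skeletonLT (univ : Set X) ((n + 1 : ℕ) : ℕ∞) := hx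
  rw [CWComplex.mem_skeletonLT_iff] at hx'
  obtain ⟨m, hm, j, hj⟩ := hx'
  have hm' : m < n + 1 := by exact_mod_cast hm
  rcases Nat.lt_succ_iff_lt_or_eq.1 hm' with h | rfl
  · left
    change x ∈ skeletonLT (univ : Set X) (n : ℕ∞)
    rw [CWComplex.mem_skeletonLT_iff]
    exact ⟨m, by exact_mod_cast h, j, hj⟩
  · exact Or.inr ⟨j, hj⟩

theorem notMem_skel_of_mem_openCell {n : ℕ} {j : cell (univ : Set X) n} {x : X}
    (hx : x ∈ openCell n j) : x ∉ skel X n := fun h =>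
  disjoint_left.1 (disjoint_skeletonLT_openCell (C := (univ : Set X)) (n := (n : ℕ∞)) le_rfl) h hx

theorem closedCell_subset_skel {m n : ℕ} (h : m < n) (j : cell (univ : Set X) m) :
    closedCell m j ⊆ skel X n :=
  (closedCell_subset_skeletonLT (C := (univ : Set X)) m j).trans
    (skeletonLT_mono (by exact_mod_cast h))

theorem map_mem_skel_of_mem_sphere {n : ℕ} (j : cell (univ : Set X) n) {c : Fin n → ℝ}
    (hc : c ∈ sphere (0 : Fin n → ℝ) 1) : map n j c ∈ skel X n :=
  cellFrontier_subset_skeletonLT (C := (univ : Set X)) n j ⟨c, hc, rfl⟩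

variable [Based X]

/-- A partial halo: a deformation of the union of the cells of dimension less than `n`, which is
stationary after the time `T`. -/
structure PartialHalo (n : ℕ) (T : ℝ) (H : X → ℝ → X) (v : X → ℝ) : Prop where
  continuousOn_H : ∀ m < n, ∀ j : cell (univ : Set X) m,
    ContinuousOn (fun z : X × ℝ => H z.1 z.2) (closedCell m j ×ˢ Icc 0 1)
  continuousOn_v : ∀ m < n, ∀ j : cell (univ : Set X) m, ContinuousOn v (closedCell m j)
  H_zero : ∀ x ∈ skel X n, H x 0 = x
  frozen : ∀ x ∈ skel X n, ∀ t ∈ Icc (0 : ℝ) 1, H x t = H x (min t T)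
  H_pt : (pt : X) ∈ skel X n → ∀ t ∈ Icc (0 : ℝ) 1, H pt t = pt
  v_mem : ∀ x ∈ skel X n, v x ∈ Icc (0 : ℝ) 1
  v_eq_one : ∀ x ∈ skel X n, (v x = 1 ↔ x = pt)
  H_one : ∀ x ∈ skel X n, 0 < v x → H x 1 = pt
  trivial : (pt : X) ∉ skel X n → ∀ x ∈ skel X n, (∀ t ∈ Icc (0 : ℝ) 1, H x t = x) ∧ v x = 0

/-- The frontier of a cell lies in finitely many closed cells of lower dimension, and continuity on
finitely many closed sets passes to their union. -/
theorem PartialHalo.continuousOn_sphere {n : ℕ} {T : ℝ} {H : X → ℝ → X} {v : X → ℝ}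
    (h : PartialHalo n T H v) (j : cell (univ : Set X) n) :
    ContinuousOn (fun z : (Fin n → ℝ) × ℝ => H (map n j z.1) z.2) (sphere 0 1 ×ˢ Icc 0 1) ∧
      ContinuousOn (fun c => v (map n j c)) (sphere 0 1) := by
  obtain ⟨J, hJ⟩ := CWComplex.cellFrontier_subset_finite_closedCell (C := (univ : Set X)) n j
  let ι := Σ m : Fin n, {i : cell (univ : Set X) m // i ∈ J m}
  let S : ι → Set X := fun i => closedCell (i.1 : ℕ) i.2.1
  have hS : cellFrontier n j ⊆ ⋃ i, S i := by
    intro x hx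
    obtain ⟨m, hm, i, hi, hxi⟩ : ∃ m, ∃ _ : m < n, ∃ i, ∃ _ : i ∈ J m, x ∈ closedCell m i := by
      simpa using hJ hx
    exact mem_iUnion.2 ⟨⟨⟨m, hm⟩, ⟨i, hi⟩⟩, hxi⟩
  have hmap : ContinuousOn (map n j) (sphere 0 1) :=
    (RelCWComplex.continuousOn n j).mono sphere_subset_closedBall
  constructor
  · have : ContinuousOn (fun z : X × ℝ => H z.1 z.2) (⋃ i, S i ×ˢ Icc 0 1) := by
      refine LocallyFinite.continuousOn_iUnion (locallyFinite_of_finite _) ?_ ?_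
      · intro i
        exact isClosed_closedCell.prod isClosed_Icc
      · intro i
        exact h.continuousOn_H _ i.1.2 _
    refine this.comp (f := fun z : (Fin n → ℝ) × ℝ => (map n j z.1, z.2)) ?_ ?_
    · exact (hmap.comp continuousOn_fst fun z hz => hz.1).prodMk continuousOn_snd
    · rintro ⟨c, t⟩ ⟨hc, ht⟩
      obtain ⟨i, hi⟩ := mem_iUnion.1 (hS ⟨c, hc, rfl⟩)
      exact mem_iUnion.2 ⟨i, hi, ht⟩
  · have : ContinuousOn v (⋃ i, S i) := by
      refine LocallyFinite.continuousOn_iUnion (locallyFinite_of_finite _) ?_ ?_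
      · intro i
        exact isClosed_closedCell
      · intro i
        exact h.continuousOn_v _ i.1.2 _
    exact this.comp hmap fun c hc => hS ⟨c, hc, rfl⟩

/-- Extension of a partial halo over one cell. -/
theorem PartialHalo.exists_cell {n : ℕ} {T T' : ℝ} {H : X → ℝ → X} {v : X → ℝ}
    (h : PartialHalo n T H v) (hT0 : 0 ≤ T) (hTT' : T < T') (hT1 : T' ≤ 1)
    (j : cell (univ : Set X) n) :
    ∃ (k : (Fin n → ℝ) → ℝ → X) (w : (Fin n → ℝ) → ℝ),
      ContinuousOn (fun z : (Fin n → ℝ) × ℝ => k z.1 z.2) (closedBall 0 1 ×ˢ Icc 0 1) ∧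
      ContinuousOn w (closedBall 0 1) ∧
      (∀ θ ∈ sphere (0 : Fin n → ℝ) 1, ∀ t ∈ Icc (0 : ℝ) 1, k θ t = H (map n j θ) t) ∧
      (∀ θ ∈ sphere (0 : Fin n → ℝ) 1, w θ = v (map n j θ)) ∧
      (∀ c ∈ ball (0 : Fin n → ℝ) 1, k c 0 = map n j c ∧
        (∀ t ∈ Icc (0 : ℝ) 1, k c t = k c (min t T')) ∧
        (map n j c = pt → ∀ t ∈ Icc (0 : ℝ) 1, k c t = pt) ∧
        w c ∈ Icc (0 : ℝ) 1 ∧ (w c = 1 ↔ map n j c = pt) ∧ (0 < w c → k c 1 = pt) ∧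
        ((pt : X) ∉ skel X (n + 1) → (∀ t ∈ Icc (0 : ℝ) 1, k c t = map n j c) ∧ w c = 0)) := by
  obtain ⟨hψ, hω⟩ := h.continuousOn_sphere j
  have hφ := RelCWComplex.continuousOn (C := (univ : Set X)) n j
  have hsk : ∀ θ ∈ sphere (0 : Fin n → ℝ) 1, map n j θ ∈ skel X n :=
    fun θ hθ => map_mem_skel_of_mem_sphere j hθ
  have hmo : ∀ c ∈ ball (0 : Fin n → ℝ) 1, map n j c ∈ openCell (C := (univ : Set X)) n j :=
    fun c hc => ⟨c, hc, rfl⟩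
  -- Three cases: the base point has already occurred and the deformation is extended radially; it
  -- lies in the present open cell, where a small ball about it is contracted; or it lies in
  -- neither, and everything stays trivial on this cell.
  by_cases hp : (pt : X) ∈ skel X n
  · obtain ⟨k, w, h1, h2, h3, h4, h5, h6, h7, h8⟩ := exists_radial_extension hT0 hTT' hT1 hφ hψ hω
      (fun θ hθ => h.H_zero _ (hsk θ hθ)) (fun θ hθ => h.frozen _ (hsk θ hθ))
      (fun θ hθ => h.v_mem _ (hsk θ hθ))
    refine ⟨k, w, h1, h2, h3, h4, fun c hc => ?_⟩
    have hcb := ball_subset_closedBall hc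
    have hne : map n j c ≠ pt := fun e => notMem_skel_of_mem_openCell (hmo c hc) (e ▸ hp)
    refine ⟨h5 c hcb, h6 c hcb, fun e => absurd e hne, ⟨(h7 c hc).1, (h7 c hc).2.le⟩,
      iff_of_false (h7 c hc).2.ne hne, ?_, fun hp' => absurd (skel_mono n.le_succ hp) hp'⟩
    intro hw
    obtain ⟨θ, hθ, hθ0, e⟩ := h8 c hc hw
    rw [e]
    exact h.H_one _ (hsk θ hθ) hθ0
  by_cases hpj : (pt : X) ∈ openCell (C := (univ : Set X)) n j
  · obtain ⟨y, hy, hyp⟩ := hpj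
    obtain ⟨k, w, h1, h2, h3, h4, h5, h6, h7, h8, h9, h10⟩ :=
      exists_ball_contraction hy (hT0.trans_lt hTT') hT1
    have hinj : ∀ c ∈ ball (0 : Fin n → ℝ) 1, map n j c = pt → c = y := by
      intro c hc e
      refine (map n j).injOn ?_ ?_ (e.trans hyp.symm)
      · rw [source_eq]; exact hc
      · rw [source_eq]; exact hy
    refine ⟨fun c t => map n j (k c t), w, ?_, h2.continuousOn, ?_, ?_, ?_⟩
    · exact hφ.comp h1.continuousOn fun z hz => h3 z.1 hz.1 z.2 hz.2
    · intro θ hθ t ht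
      dsimp only
      rw [(h4 θ hθ).1 t, (h.trivial hp _ (hsk θ hθ)).1 t ht]
    · intro θ hθ
      rw [(h4 θ hθ).2, (h.trivial hp _ (hsk θ hθ)).2]
    · intro c hc
      refine ⟨by dsimp only; rw [h5], fun t _ => by dsimp only; rw [h6], ?_, h8 c, ?_, ?_, ?_⟩
      · intro e t _
        dsimp only
        rw [hinj c hc e, h7, hyp]
      · rw [h9]
        exact ⟨fun e => by rw [e, hyp], hinj c hc⟩
      · intro hw
        dsimp only
        rw [h10 c hw, hyp]
      · intro hp'
        refine absurd ?_ hp'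
        exact closedCell_subset_skel n.lt_succ_self j
          (openCell_subset_closedCell (C := (univ : Set X)) n j ⟨y, hy, hyp⟩)
  · refine ⟨fun c _ => map n j c, fun _ => 0, ?_, continuousOn_const, ?_, ?_, ?_⟩
    · exact hφ.comp continuousOn_fst fun z hz => hz.1
    · intro θ hθ t ht
      rw [(h.trivial hp _ (hsk θ hθ)).1 t ht]
    · intro θ hθ
      rw [(h.trivial hp _ (hsk θ hθ)).2]
    · intro c hc
      have hne : map n j c ≠ pt := fun e => hpj (e ▸ hmo c hc)
      exact ⟨rfl, fun _ _ => rfl, fun e => absurd e hne, ⟨le_rfl, zero_le_one⟩,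
        iff_of_false (by norm_num) hne, fun e => absurd e (lt_irrefl _),
        fun _ => ⟨fun _ _ => rfl, rfl⟩⟩

/-- Extension of a partial halo over the cells of the next dimension. -/
theorem PartialHalo.exists_succ {n : ℕ} {T T' : ℝ} {H : X → ℝ → X} {v : X → ℝ}
    (h : PartialHalo n T H v) (hT0 : 0 ≤ T) (hTT' : T < T') (hT1 : T' ≤ 1) :
    ∃ (H' : X → ℝ → X) (v' : X → ℝ), PartialHalo (n + 1) T' H' v' ∧
      ∀ x ∈ skel X n, H' x = H x ∧ v' x = v x := by
  classical
  choose k w hk hw hks hws hb using fun j => h.exists_cell hT0 hTT' hT1 j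
  -- The values outside `skel X (n + 1)` are irrelevant, as a partial halo imposes no condition
  -- there.
  let H' : X → ℝ → X := fun x => if x ∈ skel X n then H x else
    if hx : ∃ j : cell (univ : Set X) n, x ∈ openCell n j then
      k hx.choose ((map n hx.choose).symm x) else H x
  let v' : X → ℝ := fun x => if x ∈ skel X n then v x else
    if hx : ∃ j : cell (univ : Set X) n, x ∈ openCell n j then
      w hx.choose ((map n hx.choose).symm x) else v x
  have hold : ∀ x ∈ skel X n, H' x = H x ∧ v' x = v x := fun x hx => ⟨if_pos hx, if_pos hx⟩
  have hnew : ∀ j, ∀ c ∈ ball (0 : Fin n → ℝ) 1,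
      H' (map n j c) = k j c ∧ v' (map n j c) = w j c := by
    intro j c hc
    have hm : map n j c ∈ openCell (C := (univ : Set X)) n j := ⟨c, hc, rfl⟩
    have hx : ∃ i : cell (univ : Set X) n, map n j c ∈ openCell n i := ⟨j, hm⟩
    have hj : hx.choose = j := openCell_eq_of_mem hx.choose_spec hm
    have hs := notMem_skel_of_mem_openCell hm
    have hsymm : (map n j).symm (map n j c) = c := (map n j).left_inv (by rwa [source_eq])
    simp only [H', v']
    rw [if_neg hs, if_neg hs, dif_pos hx, dif_pos hx, hj, hsymm]
    exact ⟨rfl, rfl⟩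
  have hsph : ∀ j, ∀ c ∈ closedBall (0 : Fin n → ℝ) 1,
      (∀ t ∈ Icc (0 : ℝ) 1, H' (map n j c) t = k j c t) ∧ v' (map n j c) = w j c := by
    intro j c hc
    rcases (mem_closedBall_zero_iff.1 hc).lt_or_eq with h1 | h1
    · obtain ⟨e1, e2⟩ := hnew j c (mem_ball_zero_iff.2 h1)
      exact ⟨fun t _ => by rw [e1], e2⟩
    · have hc' : c ∈ sphere (0 : Fin n → ℝ) 1 := mem_sphere_zero_iff_norm.2 h1
      obtain ⟨e1, e2⟩ := hold _ (map_mem_skel_of_mem_sphere j hc')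
      exact ⟨fun t ht => by rw [e1, hks j c hc' t ht], by rw [e2, hws j c hc']⟩
  have hcases : ∀ x ∈ skel X (n + 1), x ∈ skel X n ∨
      ∃ j : cell (univ : Set X) n, ∃ c ∈ ball (0 : Fin n → ℝ) 1, x = map n j c := by
    intro x hx
    rcases mem_skel_succ hx with h | ⟨j, c, hc, rfl⟩
    · exact Or.inl h
    · exact Or.inr ⟨j, c, hc, rfl⟩
  refine ⟨H', v', ?_, hold⟩
  constructor
  · intro m hm j
    rcases Nat.lt_succ_iff_lt_or_eq.1 hm with hm' | rfl
    · refine (h.continuousOn_H m hm' j).congr ?_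
      rintro ⟨x, t⟩ ⟨hx, -⟩
      simp only
      rw [(hold x (closedCell_subset_skel hm' j hx)).1]
    · have hK : IsCompact (closedBall (0 : Fin m → ℝ) 1 ×ˢ Icc (0 : ℝ) 1) :=
        (isCompact_closedBall _ _).prod isCompact_Icc
      have himg : closedCell m j ×ˢ Icc (0 : ℝ) 1 = (fun z : (Fin m → ℝ) × ℝ => (map m j z.1, z.2)) ''
          (closedBall (0 : Fin m → ℝ) 1 ×ˢ Icc (0 : ℝ) 1) := by
        ext ⟨x, t⟩
        constructor
        · rintro ⟨⟨c, hc, rfl⟩, ht⟩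
          exact ⟨(c, t), ⟨hc, ht⟩, rfl⟩
        · rintro ⟨⟨c, t⟩, ⟨hc, ht⟩, e⟩
          obtain ⟨rfl, rfl⟩ := Prod.mk.inj e
          exact ⟨⟨c, hc, rfl⟩, ht⟩
      rw [himg]
      refine continuousOn_image_of_isCompact hK ?_ ?_
      · exact ((RelCWComplex.continuousOn m j).comp continuousOn_fst fun z hz => hz.1).prodMk
          continuousOn_snd
      · exact (hk j).congr fun z hz => (hsph j z.1 hz.1).1 z.2 hz.2
  · intro m hm j
    rcases Nat.lt_succ_iff_lt_or_eq.1 hm with hm' | rfl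
    · exact (h.continuousOn_v m hm' j).congr fun x hx =>
        (hold x (closedCell_subset_skel hm' j hx)).2
    · exact continuousOn_image_of_isCompact (isCompact_closedBall _ _)
        (RelCWComplex.continuousOn m j) ((hw j).congr fun c hc => (hsph j c hc).2)
  · intro x hx
    rcases hcases x hx with hx | ⟨j, c, hc, rfl⟩
    · rw [(hold x hx).1, h.H_zero x hx]
    · rw [(hnew j c hc).1, (hb j c hc).1]
  · intro x hx t ht
    rcases hcases x hx with hx | ⟨j, c, hc, rfl⟩
    · rw [(hold x hx).1, h.frozen x hx t ht, h.frozen x hx (min t T')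
        ⟨le_min ht.1 (hT0.trans hTT'.le), (min_le_left _ _).trans ht.2⟩, min_assoc,
        min_eq_right hTT'.le]
    · rw [(hnew j c hc).1]
      exact (hb j c hc).2.1 t ht
  · intro hp t ht
    rcases hcases _ hp with hx | ⟨j, c, hc, e⟩
    · rw [(hold _ hx).1, h.H_pt hx t ht]
    · rw [show H' pt t = k j c t by rw [e, (hnew j c hc).1]]
      exact (hb j c hc).2.2.1 e.symm t ht
  · intro x hx
    rcases hcases x hx with hx | ⟨j, c, hc, rfl⟩
    · rw [(hold x hx).2]; exact h.v_mem x hx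
    · rw [(hnew j c hc).2]; exact (hb j c hc).2.2.2.1
  · intro x hx
    rcases hcases x hx with hx | ⟨j, c, hc, rfl⟩
    · rw [(hold x hx).2]; exact h.v_eq_one x hx
    · rw [(hnew j c hc).2]; exact (hb j c hc).2.2.2.2.1
  · intro x hx
    rcases hcases x hx with hx | ⟨j, c, hc, rfl⟩
    · rw [(hold x hx).1, (hold x hx).2]; exact h.H_one x hx
    · rw [(hnew j c hc).1, (hnew j c hc).2]; exact (hb j c hc).2.2.2.2.2.1
  · intro hp x hx
    rcases hcases x hx with hx | ⟨j, c, hc, rfl⟩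
    · rw [(hold x hx).1, (hold x hx).2]
      exact h.trivial (fun e => hp (skel_mono n.le_succ e)) x hx
    · rw [(hnew j c hc).1, (hnew j c hc).2]; exact (hb j c hc).2.2.2.2.2.2 hp

variable (X) in
/-- A CW complex is well-pointed, at each of its points. -/
theorem nonempty_halo_of_cwComplex : Nonempty (Halo X) := by
  classical
  -- Each dimension uses up some extra time; a strictly increasing sequence below 1 leaves room for
  -- all of them.
  let T : ℕ → ℝ := fun n => 1 - 1 / (n + 1)
  have hT0 : ∀ n, 0 ≤ T n := fun n => by
    have : (1 : ℝ) / (n + 1) ≤ 1 := by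
      rw [div_le_one (by positivity)]; linarith [(Nat.cast_nonneg n : (0 : ℝ) ≤ n)]
    simp only [T]; linarith
  have hT1 : ∀ n, T n ≤ 1 := fun n => by
    have : (0 : ℝ) ≤ 1 / (n + 1) := by positivity
    simp only [T]; linarith
  have hTT : ∀ n, T n < T (n + 1) := fun n => by
    simp only [T]
    have : (1 : ℝ) / ((n + 1 : ℕ) + 1) < 1 / (n + 1) := by
      apply one_div_lt_one_div_of_lt <;> push_cast <;> [positivity; linarith]
    linarith
  let D := fun n => {Hv : (X → ℝ → X) × (X → ℝ) // PartialHalo n (T n) Hv.1 Hv.2}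
  have h0 : D 0 := ⟨(fun x _ => x, fun _ => 0), by
    constructor <;> first | (intro m hm; exact absurd hm (Nat.not_lt_zero _)) | simp [skel_zero]⟩
  have hs : ∀ n (d : D n), ∃ d' : D (n + 1),
      ∀ x ∈ skel X n, d'.1.1 x = d.1.1 x ∧ d'.1.2 x = d.1.2 x := by
    intro n d
    obtain ⟨H', v', h1, h2⟩ := d.2.exists_succ (hT0 n) (hTT n) (hT1 _)
    exact ⟨⟨(H', v'), h1⟩, h2⟩
  choose step hstep using hs
  let d : ∀ n, D n := fun n => Nat.rec h0 step n
  have hd : ∀ n k, ∀ x ∈ skel X n, (d (n + k)).1.1 x = (d n).1.1 x ∧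
      (d (n + k)).1.2 x = (d n).1.2 x := by
    intro n k x hx
    induction k with
    | zero => exact ⟨rfl, rfl⟩
    | succ k ih =>
      have := hstep (n + k) (d (n + k)) x (skel_mono (Nat.le_add_right _ _) hx)
      exact ⟨this.1.trans ih.1, this.2.trans ih.2⟩
  let N : X → ℕ := fun x => Nat.find (exists_mem_skel x)
  have hN : ∀ x, x ∈ skel X (N x) := fun x => Nat.find_spec (exists_mem_skel x)
  let H : X → ℝ → X := fun x => (d (N x)).1.1 x
  let v : X → ℝ := fun x => (d (N x)).1.2 x
  have hHv : ∀ n, ∀ x ∈ skel X n, H x = (d n).1.1 x ∧ v x = (d n).1.2 x := by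
    intro n x hx
    have hle : N x ≤ n := Nat.find_min' _ hx
    obtain ⟨k, rfl⟩ := Nat.exists_eq_add_of_le hle
    obtain ⟨e1, e2⟩ := hd (N x) k x (hN x)
    exact ⟨e1.symm, e2.symm⟩
  have hcell : ∀ {Z : Type u} [TopologicalSpace Z] (f : X → Z),
      (∀ n (j : cell (univ : Set X) n), ContinuousOn f (closedCell n j)) → Continuous f := by
    intro Z _ f hf
    rw [continuous_iff_isClosed]
    intro s hs
    rw [CWComplex.closed (univ : Set X) _ (subset_univ _)]
    intro n j
    have := (hf n j).preimage_isClosed_of_isClosed isClosed_closedCell hs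
    rwa [inter_comm]
  have hHc : Continuous fun z : X × I => H z.1 z.2 := by
    -- The cells determine the topology of `X`, not directly that of `X × I`. The homotopy is
    -- therefore curried to a map into `C(I, X)`, checked on closed cells, and uncurried, `I` being
    -- locally compact.
    have : Continuous fun x : X => (⟨fun t : I => H x t, by
        have h1 := (d (N x + 1)).2.continuousOn_H
        obtain ⟨m, hm, j, hj⟩ : ∃ m, ∃ _ : m < N x, ∃ j : cell (univ : Set X) m,
            x ∈ openCell m j := by
          have := hN x
          rw [skel, SetLike.mem_coe, CWComplex.mem_skeletonLT_iff] at this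
          obtain ⟨m, hm, j, hj⟩ := this
          exact ⟨m, by exact_mod_cast hm, j, hj⟩
        have hx := openCell_subset_closedCell (C := (univ : Set X)) m j hj
        rw [(hHv (N x + 1) x (skel_mono (Nat.le_succ _) (hN x))).1]
        exact (h1 m (hm.trans (Nat.lt_succ_self _)) j).comp_continuous
          (f := fun t : I => (x, (t : ℝ))) (by fun_prop) fun t => ⟨hx, t.2⟩⟩ : C(I, X)) := by
      refine hcell _ fun n j => ?_
      rw [continuousOn_iff_continuous_domRestrict]
      refine ContinuousMap.continuous_of_continuous_uncurry _ ?_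
      have h1 := (d (n + 1)).2.continuousOn_H n n.lt_succ_self j
      have h2 : Continuous fun z : closedCell (C := (univ : Set X)) n j × I =>
          (d (n + 1)).1.1 z.1 z.2 :=
        h1.comp_continuous (f := fun z : closedCell (C := (univ : Set X)) n j × I =>
          ((z.1 : X), (z.2 : ℝ))) (by fun_prop) fun z => ⟨z.1.2, z.2.2⟩
      refine h2.congr fun z => ?_
      change _ = H z.1 z.2
      rw [(hHv (n + 1) z.1 (closedCell_subset_skel n.lt_succ_self j z.1.2)).1]
    exact ContinuousMap.continuous_uncurry_of_continuous ⟨_, this⟩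
  have hvc : Continuous v := by
    -- `hcell` only admits targets in `Type u`.
    have : Continuous fun x => (ULift.up (v x) : ULift.{u} ℝ) := by
      refine hcell _ fun n j => ?_
      refine continuous_uliftUp.comp_continuousOn
        (((d (n + 1)).2.continuousOn_v n n.lt_succ_self j).congr fun x hx => ?_)
      exact (hHv (n + 1) x (closedCell_subset_skel n.lt_succ_self j hx)).2
    exact continuous_uliftDown.comp this
  have hH : ∀ x, H x = (d (N x)).1.1 x := fun _ => rfl
  exact ⟨{
    H := ⟨fun z => H z.1 z.2, hHc⟩
    v := ⟨v, hvc⟩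
    H_zero := fun x => (d (N x)).2.H_zero x (hN x)
    H_pt := fun t => (d (N pt)).2.H_pt (hN pt) t t.2
    v_nonneg := fun x => ((d (N x)).2.v_mem x (hN x)).1
    v_le_one := fun x => ((d (N x)).2.v_mem x (hN x)).2
    v_eq_one := fun x => (d (N x)).2.v_eq_one x (hN x)
    H_one := fun x => (d (N x)).2.H_one x (hN x) }⟩

end CellInduction

/-! ### Based homotopies -/

namespace PMap

section

variable {X : Type u} {Y : Type v} {Z : Type w}
  [TopologicalSpace X] [TopologicalSpace Y] [TopologicalSpace Z] [Based X] [Based Y] [Based Z]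

theorem ext_toMap {f g : PMap X Y} (h : ∀ x, f.toMap x = g.toMap x) : f = g := by
  obtain ⟨f, hf⟩ := f
  obtain ⟨g, hg⟩ := g
  congr 1
  exact ContinuousMap.ext h

theorem homotopic_iff {f g : PMap X Y} : f.Homotopic g ↔
    ∃ F : C(X × I, Y), (∀ x, F (x, 0) = f.toMap x) ∧ (∀ x, F (x, 1) = g.toMap x) ∧
      ∀ t, F (pt, t) = pt := by
  constructor
  · rintro ⟨F⟩
    refine ⟨F.toContinuousMap.comp ⟨Prod.swap, continuous_swap⟩, F.apply_zero, F.apply_one, ?_⟩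
    intro t
    exact (F.prop' t pt rfl).trans f.map_pt
  · rintro ⟨F, h0, h1, h2⟩
    exact ⟨⟨⟨F.comp ⟨Prod.swap, continuous_swap⟩, h0, h1⟩, by
      rintro t x rfl
      exact (h2 t).trans f.map_pt.symm⟩⟩

theorem Homotopic.refl (f : PMap X Y) : f.Homotopic f := ContinuousMap.HomotopicRel.refl _

theorem Homotopic.symm {f g : PMap X Y} (h : f.Homotopic g) : g.Homotopic f :=
  ContinuousMap.HomotopicRel.symm h

theorem Homotopic.trans {f g k : PMap X Y} (h : f.Homotopic g) (h' : g.Homotopic k) :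
    f.Homotopic k :=
  ContinuousMap.HomotopicRel.trans h h'

theorem Homotopic.comp {g g' : PMap Y Z} {f f' : PMap X Y} (hg : g.Homotopic g')
    (hf : f.Homotopic f') : (g.comp f).Homotopic (g'.comp f') := by
  rw [homotopic_iff] at *
  obtain ⟨F, F0, F1, F2⟩ := hf
  obtain ⟨G, G0, G1, G2⟩ := hg
  refine ⟨⟨fun z => G (F z, z.2), by fun_prop⟩, fun x => ?_, fun x => ?_, fun t => ?_⟩
  · change G (F (x, 0), 0) = g.toMap (f.toMap x)
    rw [F0, G0]
  · change G (F (x, 1), 1) = g'.toMap (f'.toMap x)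
    rw [F1, G1]
  · change G (F (pt, t), t) = pt
    rw [F2, G2]

theorem Homotopic.comp_left {f f' : PMap X Y} (hf : f.Homotopic f') (g : PMap Y Z) :
    (g.comp f).Homotopic (g.comp f') := (Homotopic.refl g).comp hf

theorem Homotopic.comp_right {g g' : PMap Y Z} (hg : g.Homotopic g') (f : PMap X Y) :
    (g.comp f).Homotopic (g'.comp f) := hg.comp (Homotopic.refl f)

end

end PMap

theorem homotopic_iff_exists {X : Type u} {Y : Type v} [TopologicalSpace X] [TopologicalSpace Y]
    {f g : C(X, Y)} : f.Homotopic g ↔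
      ∃ F : C(X × I, Y), (∀ x, F (x, 0) = f x) ∧ ∀ x, F (x, 1) = g x := by
  constructor
  · rintro ⟨F⟩
    exact ⟨F.toContinuousMap.comp ⟨Prod.swap, continuous_swap⟩, F.apply_zero, F.apply_one⟩
  · rintro ⟨F, h0, h1⟩
    exact ⟨⟨F.comp ⟨Prod.swap, continuous_swap⟩, h0, h1⟩⟩

/-! ### Homotopy theory of well-pointed spaces -/

namespace Halo

variable {X : Type u} {Y : Type v} [TopologicalSpace X] [TopologicalSpace Y] [Based X] [Based Y]

/-- The product of two well-pointed spaces is well-pointed. -/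
def prod (h : Halo X) (k : Halo Y) : Halo (X × Y) where
  H := ⟨fun z => (h.H (z.1.1, z.2), k.H (z.1.2, z.2)), by fun_prop⟩
  v := ⟨fun z => min (h.v z.1) (k.v z.2), by fun_prop⟩
  H_zero x := Prod.ext (h.H_zero _) (k.H_zero _)
  H_pt t := Prod.ext (h.H_pt _) (k.H_pt _)
  v_nonneg x := le_min (h.v_nonneg _) (k.v_nonneg _)
  v_le_one x := (min_le_left _ _).trans (h.v_le_one _)
  v_eq_one x := by
    constructor
    · intro e
      have h1 : h.v x.1 = 1 := le_antisymm (h.v_le_one _) (e.symm.le.trans (min_le_left _ _))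
      have h2 : k.v x.2 = 1 := le_antisymm (k.v_le_one _) (e.symm.le.trans (min_le_right _ _))
      exact Prod.ext ((h.v_eq_one _).1 h1) ((k.v_eq_one _).1 h2)
    · rintro rfl
      change min (h.v pt) (k.v pt) = 1
      rw [(h.v_eq_one pt).2 rfl, (k.v_eq_one pt).2 rfl, min_self]
  H_one x hx := Prod.ext (h.H_one _ (hx.trans_le (min_le_left _ _)))
    (k.H_one _ (hx.trans_le (min_le_right _ _)))

theorem v_pt (h : Halo X) : h.v pt = 1 := (h.v_eq_one pt).2 rfl

/-- The weak homotopy extension property of the base point. -/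
theorem exists_extension (h : Halo X) {Z : Type w} [TopologicalSpace Z] (g : C(X, Z)) (ω : C(I, Z))
    (hω : ω 0 = g pt) : ∃ G : C(X × I, Z), (∀ x, G (x, 0) = g x) ∧
      ∀ t : I, G (pt, t) = ω (clampI (2 * t - 1)) := by
  -- During the first half of the time the region where `v` is positive collapses to the base point.
  -- In the second half the points with `v ≥ 1 / 2` follow `ω`, at a speed that tends to 0 at `v = 1
  -- / 2`. This explains the delayed track of the base point.
  let G : X × I → Z := fun z => if h.v z.1 ≤ 1 / 2 then g (h.H (z.1, clampI (2 * z.2))) else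
    if (z.2 : ℝ) ≤ 1 / 2 then g (h.H (z.1, clampI (2 * z.2)))
    else ω (clampI ((2 * z.2 - 1) * (2 * h.v z.1 - 1)))
  have hG : Continuous G := by
    have h1 : Continuous fun z : X × I => g (h.H (z.1, clampI (2 * z.2))) := by fun_prop
    have h2 : Continuous fun z : X × I => ω (clampI ((2 * z.2 - 1) * (2 * h.v z.1 - 1))) := by
      fun_prop
    refine continuous_of_le_of_ge (f := fun z : X × I => min (h.v z.1) z.2) (by fun_prop) (1 / 2)
      h1.continuousOn h2.continuousOn ?_ ?_
    · rintro ⟨x, t⟩ hz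
      simp only [G]
      split_ifs with h3 h4
      · rfl
      · rfl
      · exact absurd hz (not_le.2 (lt_min (not_le.1 h3) (not_le.1 h4)))
    · rintro ⟨x, t⟩ hz
      have h3 : 1 / 2 ≤ h.v x := hz.trans (min_le_left _ _)
      have h4 : (1 / 2 : ℝ) ≤ t := hz.trans (min_le_right _ _)
      have h5 : g (h.H (x, clampI (2 * t))) = ω 0 := by
        rw [clampI_of_ge (by linarith), h.H_one _ (by linarith), hω]
      simp only [G]
      split_ifs with h6 h7
      · rw [h5, le_antisymm h6 h3]; norm_num
      · rw [h5, le_antisymm h7 h4]; norm_num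
      · rfl
  refine ⟨⟨G, hG⟩, fun x => ?_, fun t => ?_⟩
  · change G (x, 0) = g x
    simp only [G]
    norm_num [h.H_zero]
  · change G (pt, t) = _
    simp only [G, h.v_pt]
    norm_num
    intro h1
    rw [h.H_pt, clampI_of_le (by linarith), hω]

/-- Two maps are based homotopic, if there are free homotopies to them from the same map, with
the same track of the base point. -/
theorem homotopic_of_track (h : Halo X) {f g : PMap X Y} (F G : C(X × I, Y))
    (h0 : ∀ x, F (x, 0) = G (x, 0)) (hpt : ∀ t, F (pt, t) = G (pt, t))
    (hF : ∀ x, F (x, 1) = f.toMap x) (hG : ∀ x, G (x, 1) = g.toMap x) : f.Homotopic g := by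
  -- Precomposition with `H (·, 1)` does not change the based homotopy class, so the maps may be
  -- taken constant where `v` is positive.
  have hr : ∀ k : PMap X Y, k.Homotopic (k.comp ⟨⟨fun x => h.H (x, 1), by fun_prop⟩, h.H_pt 1⟩) := by
    intro k
    rw [PMap.homotopic_iff]
    refine ⟨k.toMap.comp h.H, fun x => ?_, fun x => rfl, fun t => ?_⟩
    · simp [h.H_zero]
    · simp [h.H_pt, k.map_pt]
  refine (hr f).trans (PMap.Homotopic.trans ?_ (hr g).symm)
  rw [PMap.homotopic_iff]
  -- Back along `F`, then forth along `G`. The bound `2 * v - 1` holds the parameter at 1 over the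
  -- base point, so the homotopy is based. At the middle time, either `v` vanishes and both
  -- parameters are 0, or the point has collapsed to the base point, where the tracks agree.
  let K : X × I → Y := fun z => if (z.2 : ℝ) ≤ 1 / 2 then
    F (h.H (z.1, 1), clampI (max |2 * (z.2 : ℝ) - 1| (2 * h.v z.1 - 1))) else
    G (h.H (z.1, 1), clampI (max |2 * (z.2 : ℝ) - 1| (2 * h.v z.1 - 1)))
  have hK : Continuous K := by
    refine Continuous.if_le (by fun_prop) (by fun_prop) (by fun_prop) continuous_const ?_
    rintro ⟨x, t⟩ ht
    simp only at ht ⊢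
    rcases le_or_gt (h.v x) 0 with h1 | h1
    · have : max |2 * (t : ℝ) - 1| (2 * h.v x - 1) ≤ 0 := by
        rw [ht]; norm_num; linarith
      rw [clampI_of_le this, h0]
    · rw [h.H_one x h1, hpt]
  refine ⟨⟨K, hK⟩, fun x => ?_, fun x => ?_, fun t => ?_⟩
  · change K (x, 0) = f.toMap (h.H (x, 1))
    simp only [K]
    rw [if_pos (by norm_num), clampI_of_ge (by norm_num), hF]
  · change K (x, 1) = g.toMap (h.H (x, 1))
    simp only [K]
    rw [if_neg (by norm_num), clampI_of_ge (by norm_num), hG]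
  · change K (pt, t) = pt
    simp only [K, h.H_pt, h.v_pt]
    rw [clampI_of_ge (by norm_num), hF, hG, f.map_pt, g.map_pt, ite_self]

/-- A based map which is a free homotopy equivalence has a based left homotopy inverse, which is
again a free homotopy equivalence. -/
theorem exists_left_inverse (h : Halo X) (k : Halo Y) (m : PMap X Y) (n : C(Y, X))
    (hnm : (n.comp m.toMap).Homotopic (.id X)) (hmn : (m.toMap.comp n).Homotopic (.id Y)) :
    ∃ l : PMap Y X, (l.comp m).Homotopic (.id X) ∧ (l.toMap.comp m.toMap).Homotopic (.id X) ∧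
      (m.toMap.comp l.toMap).Homotopic (.id Y) := by
  obtain ⟨F, F0, F1⟩ := homotopic_iff_exists.1 hnm
  let ω : C(I, X) := ⟨fun t => F (pt, t), by fun_prop⟩
  -- Dragging `n pt` along the track of the base point under `F` makes `n` based; the homotopies `N
  -- ∘ m` and `F`, the latter delayed, then have the same track.
  obtain ⟨N, N0, Npt⟩ := k.exists_extension n ω (by
    change F (pt, 0) = _
    rw [F0]
    change n (m.toMap pt) = _
    rw [m.map_pt])
  let l : PMap Y X := ⟨⟨fun y => N (y, 1), by fun_prop⟩, by
    change N (pt, 1) = pt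
    rw [Npt, clampI_of_ge (by norm_num)]
    change F (pt, 1) = pt
    rw [F1]; rfl⟩
  have hl : n.Homotopic l.toMap := homotopic_iff_exists.2 ⟨N, N0, fun y => rfl⟩
  refine ⟨l, ?_, (hl.symm.comp (.refl _)).trans hnm, ((ContinuousMap.Homotopic.refl _).comp
    hl.symm).trans hmn⟩
  refine h.homotopic_of_track ⟨fun z => N (m.toMap z.1, z.2), by fun_prop⟩
    ⟨fun z => F (z.1, clampI (2 * z.2 - 1)), by fun_prop⟩ ?_ ?_ ?_ ?_
  · intro x
    change N (m.toMap x, 0) = F (x, clampI (2 * (0 : ℝ) - 1))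
    rw [N0, clampI_of_le (by norm_num), F0]; rfl
  · intro t
    change N (m.toMap pt, t) = F (pt, clampI (2 * (t : ℝ) - 1))
    rw [m.map_pt, Npt]; rfl
  · intro x; rfl
  · intro x
    change F (x, clampI (2 * (1 : ℝ) - 1)) = x
    rw [clampI_of_ge (by norm_num), F1]; rfl

/-- A based map between well-pointed spaces which is a free homotopy equivalence is a based
homotopy equivalence. -/
theorem isHomotopyEquiv (h : Halo X) (k : Halo Y) (m : PMap X Y) (n : C(Y, X))
    (hnm : (n.comp m.toMap).Homotopic (.id X)) (hmn : (m.toMap.comp n).Homotopic (.id Y)) :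
    m.IsHomotopyEquiv := by
  obtain ⟨l, h1, h2, h3⟩ := h.exists_left_inverse k m n hnm hmn
  -- The based left inverse `l` of `m` has a based left inverse `m'` of its own, and m ≃ m' l m ≃
  -- m', so `l` is two-sided.
  obtain ⟨m', h4, -, -⟩ := k.exists_left_inverse h l m.toMap h3 h2
  have e : m.Homotopic m' :=
    ((h4.comp_right m).symm : ((PMap.id Y).comp m).Homotopic ((m'.comp l).comp m)).trans
      (h1.comp_left m' : (m'.comp (l.comp m)).Homotopic (m'.comp (PMap.id X)))
  exact ⟨l, h1, (e.comp_right l).trans h4⟩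

end Halo

/-! ### Maps out of suspensions -/

section Suspension

open Topology

variable {A : Type u} [TopologicalSpace A] [Based A]

theorem isQuotientMap_suspMk : IsQuotientMap (suspMk A) := isQuotientMap_quot_mk

theorem suspMk_surjective : Function.Surjective (suspMk A) := isQuotientMap_suspMk.surjective

theorem suspMk_eq_iff {z z' : A × I} :
    suspMk A z = suspMk A z' ↔ z = z' ∨ (z ∈ suspBase A ∧ z' ∈ suspBase A) :=
  Quotient.eq (r := collapse (suspBase A))

theorem suspMk_zero (a : A) : suspMk A (a, 0) = pt := suspMk_eq_pt (Or.inr (Or.inl rfl))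

theorem suspMk_one (a : A) : suspMk A (a, 1) = pt := suspMk_eq_pt (Or.inr (Or.inr rfl))

theorem suspMk_pt (t : I) : suspMk A (pt, t) = pt := suspMk_eq_pt (Or.inl rfl)

/-- The product of a quotient map with a locally compact space is again a quotient map; this is
where local compactness of the parameter space `P` is used. -/
theorem exists_susp_lift_prod {P : Type v} {Z : Type w} [TopologicalSpace P]
    [LocallyCompactSpace P] [TopologicalSpace Z] (F : C((A × I) × P, Z)) (c : P → Z)
    (hF : ∀ z ∈ suspBase A, ∀ p, F (z, p) = c p) :
    ∃ G : C(Susp A × P, Z), ∀ z p, G (suspMk A z, p) = F (z, p) := by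
  let G : Susp A × P → Z := fun x =>
    Quotient.lift (s := collapse (suspBase A)) (fun z => F (z, x.2)) (by
      rintro z z' (rfl | ⟨h, h'⟩)
      · rfl
      · exact (hF z h _).trans (hF z' h' _).symm) x.1
  refine ⟨⟨G, ?_⟩, fun z p => rfl⟩
  refine isQuotientMap_suspMk.continuous_lift_prod_left ?_
  exact F.continuous

theorem exists_susp_lift {Z : Type w} [TopologicalSpace Z] (F : C(A × I, Z)) (c : Z)
    (hF : ∀ z ∈ suspBase A, F z = c) : ∃ G : C(Susp A, Z), ∀ z, G (suspMk A z) = F z := by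
  obtain ⟨G, hG⟩ := exists_susp_lift_prod (P := Unit) ⟨fun z => F z.1, by fun_prop⟩ (fun _ => c)
    (fun z hz _ => hF z hz)
  exact ⟨⟨fun x => G (x, ()), by fun_prop⟩, fun z => hG z ()⟩

theorem isClosed_suspBase [T1Space A] : IsClosed (suspBase A) :=
  (isClosed_singleton.preimage continuous_fst).union
    ((isClosed_singleton.preimage continuous_snd).union
      (isClosed_singleton.preimage continuous_snd))

/-- Under either alternative `O` is saturated for the quotient map. -/
theorem isOpen_image_suspMk {O : Set (A × I)} (hO : IsOpen O)
    (h : suspBase A ⊆ O ∨ Disjoint O (suspBase A)) : IsOpen (suspMk A '' O) := by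
  rw [← isQuotientMap_suspMk.isOpen_preimage]
  convert hO using 1
  ext z
  constructor
  · rintro ⟨z', hz', e⟩
    rcases suspMk_eq_iff.1 e with rfl | ⟨h1, h2⟩
    · exact hz'
    · rcases h with h | h
      · exact h h2
      · exact absurd h1 (Set.disjoint_left.1 h hz')
  · exact fun hz => ⟨z, hz, rfl⟩

/-- A map out of `W × ΣA` is continuous if it is so on `W × A × I` and is stationary near the
base point of `ΣA`. -/
theorem continuous_prod_susp [T1Space A] {W : Type v} {Z : Type w} [TopologicalSpace W]
    [TopologicalSpace Z] {g : W × A × I → Z} (hg : Continuous g) {k : W → Z} (hk : Continuous k)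
    {M : W × Susp A → Z} (hM : ∀ w z, M (w, suspMk A z) = g (w, z)) {O : Set (A × I)}
    (hO : IsOpen O) (hbase : suspBase A ⊆ O) (hgO : ∀ w, ∀ z ∈ O, g (w, z) = k w) :
    Continuous M := by
  rw [continuous_iff_continuousAt]
  rintro ⟨w, x⟩
  obtain ⟨z, rfl⟩ := suspMk_surjective x
  -- Near the base point `M` depends on `w` alone; elsewhere the quotient map carries open sets that
  -- avoid `suspBase A` to open sets, so continuity descends from `g`.
  by_cases hz : z ∈ suspBase A
  · have hn : (Set.univ ×ˢ (suspMk A '' O) : Set (W × Susp A)) ∈ nhds (w, suspMk A z) :=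
      (isOpen_univ.prod (isOpen_image_suspMk hO (Or.inl hbase))).mem_nhds
        ⟨trivial, z, hbase hz, rfl⟩
    refine ContinuousAt.congr (f := fun p : W × Susp A => k p.1) (by fun_prop) ?_
    filter_upwards [hn]
    rintro ⟨w', x'⟩ ⟨-, z', hz', rfl⟩
    rw [hM, hgO _ _ hz']
  · rw [ContinuousAt, hM]
    intro V hV
    have h1 : g ⁻¹' V ∈ nhds (w, z) := hg.continuousAt hV
    obtain ⟨W₁, hW₁, O₁, hO₁, hsub⟩ := mem_nhds_prod_iff.1 h1
    obtain ⟨O₂, hO₂, hO₂', hzO₂⟩ := mem_nhds_iff.1 (Filter.inter_mem hO₁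
      (isClosed_suspBase.isOpen_compl.mem_nhds hz))
    have hop : IsOpen (suspMk A '' O₂) :=
      isOpen_image_suspMk hO₂' (Or.inr (Set.disjoint_left.2 fun y hy => (hO₂ hy).2))
    rw [Filter.mem_map]
    refine Filter.mem_of_superset (prod_mem_nhds hW₁ (hop.mem_nhds ⟨z, hzO₂, rfl⟩)) ?_
    rintro ⟨w', x'⟩ ⟨hw', z', hz', rfl⟩
    change M _ ∈ V
    rw [hM]
    exact hsub ⟨hw', (hO₂ hz').1⟩

/-- The suspension of a well-pointed space is well-pointed. -/
theorem Halo.nonempty_susp (h : Halo A) : Nonempty (Halo (Susp A)) := by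
  -- The deformation uses `h.H` in the coordinate of `A` and simultaneously pushes the outer thirds
  -- of the interval to its ends; the numeration below is positive where one of the two reaches the
  -- base point.
  obtain ⟨H, hH⟩ := exists_susp_lift_prod (A := A) (P := I)
    ⟨fun z => suspMk A (h.H (z.1.1, z.2),
      clampI ((1 - z.2) * z.1.2 + z.2 * clampI (3 * z.1.2 - 1))), by fun_prop⟩ (fun _ => pt) (by
      rintro ⟨a, t⟩ (e | e | e) u
      · change a = pt at e
        simp only [ContinuousMap.coe_mk, e, h.H_pt, suspMk_pt]
      · change t = 0 at e
        subst e
        have : clampI (3 * ((0 : I) : ℝ) - 1) = 0 := clampI_of_le (by norm_num)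
        simp only [ContinuousMap.coe_mk, this]
        norm_num [suspMk_zero]
      · change t = 1 at e
        subst e
        have : clampI (3 * ((1 : I) : ℝ) - 1) = 1 := clampI_of_ge (by norm_num)
        simp only [ContinuousMap.coe_mk, this]
        norm_num [suspMk_one])
  obtain ⟨v, hv⟩ := exists_susp_lift (A := A) (Z := ℝ)
    ⟨fun z => max (h.v z.1) (max (1 - 3 * z.2) (3 * z.2 - 2)), by fun_prop⟩ 1 (by
      rintro ⟨a, t⟩ (e | e | e)
      · change a = pt at e
        subst e
        have h1 := t.2.1
        have h2 := t.2.2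
        exact (congrArg (max · _) h.v_pt).trans (max_eq_left (max_le (by linarith) (by linarith)))
      · change t = 0 at e
        subst e
        have := h.v_le_one a
        have h3 : max (1 - 3 * ((0 : I) : ℝ)) (3 * ((0 : I) : ℝ) - 2) = 1 := by norm_num
        exact (congrArg (max _) h3).trans (max_eq_right this)
      · change t = 1 at e
        subst e
        have := h.v_le_one a
        have h3 : max (1 - 3 * ((1 : I) : ℝ)) (3 * ((1 : I) : ℝ) - 2) = 1 := by norm_num
        exact (congrArg (max _) h3).trans (max_eq_right this))
  have hle : ∀ a (t : I), max (h.v a) (max (1 - 3 * (t : ℝ)) (3 * t - 2)) ≤ 1 := fun a t =>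
    max_le (h.v_le_one a) (max_le (by linarith [t.2.1]) (by linarith [t.2.2]))
  refine ⟨{ H := H, v := v, H_zero := ?_, H_pt := ?_, v_nonneg := ?_, v_le_one := ?_,
            v_eq_one := ?_, H_one := ?_ }⟩
  · intro x
    obtain ⟨⟨a, t⟩, rfl⟩ := suspMk_surjective x
    rw [hH]
    simp [h.H_zero]
  · intro t
    rw [← suspMk_zero pt, hH]
    simp only [ContinuousMap.coe_mk, h.H_pt, suspMk_pt]
  · intro x
    obtain ⟨⟨a, t⟩, rfl⟩ := suspMk_surjective x
    rw [hv]
    exact (h.v_nonneg a).trans (le_max_left _ _)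
  · intro x
    obtain ⟨⟨a, t⟩, rfl⟩ := suspMk_surjective x
    rw [hv]
    exact hle a t
  · intro x
    obtain ⟨⟨a, t⟩, rfl⟩ := suspMk_surjective x
    rw [hv]
    change max (h.v a) (max (1 - 3 * (t : ℝ)) (3 * t - 2)) = 1 ↔ _
    constructor
    · intro e
      rcases le_max_iff.1 e.symm.le with e | e
      · rw [(h.v_eq_one a).1 (le_antisymm (h.v_le_one a) e), suspMk_pt]
      · rcases le_max_iff.1 e with e | e
        · rw [show t = 0 from Subtype.ext (le_antisymm (show (t : ℝ) ≤ 0 by linarith) t.2.1), suspMk_zero]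
        · rw [show t = 1 from Subtype.ext (le_antisymm t.2.2 (show (1 : ℝ) ≤ t by linarith)), suspMk_one]
    · intro e
      rw [← suspMk_zero pt, suspMk_eq_iff] at e
      have hb : ((a, t) : A × I) ∈ suspBase A := by
        rcases e with e | e
        · rw [e]; exact Or.inl rfl
        · exact e.1
      refine le_antisymm (hle a t) ?_
      rcases hb with e | e | e
      · change a = pt at e
        rw [e, h.v_pt]; exact le_max_left _ _
      · change t = 0 at e
        rw [e]; norm_num
      · change t = 1 at e
        rw [e]; norm_num
  · intro x hx
    obtain ⟨⟨a, t⟩, rfl⟩ := suspMk_surjective x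
    rw [hv] at hx
    rw [hH]
    change suspMk A (h.H (a, 1), clampI ((1 - 1) * t + 1 * clampI (3 * t - 1))) = pt
    rw [sub_self, zero_mul, one_mul, zero_add, clampI_coe]
    rcases lt_max_iff.1 hx with e | e
    · rw [h.H_one a e, suspMk_pt]
    · rcases lt_max_iff.1 e with e | e
      · rw [clampI_of_le (by simp only at e; linarith), suspMk_zero]
      · rw [clampI_of_ge (by simp only at e; linarith), suspMk_one]

/-- A family of paths starting and ending at a point which does not depend on `a : A` can be
descended to the suspension of `A`, up to composition with the reverse of the path at the base
point. -/
theorem Halo.exists_susp_descent [T1Space A] (h : Halo A) {W : Type v} {Z : Type w}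
    [TopologicalSpace W] [TopologicalSpace Z] (N : C(W × A × I, Z)) (k : W → Z)
    (h0 : ∀ w a, N (w, a, 0) = k w) (h1 : ∀ w a, N (w, a, 1) = k w) :
    ∃ M : C(W × Susp A, Z), (∀ w, M (w, pt) = k w) ∧
      ∀ w, (∀ t, N (w, pt, t) = k w) → ∀ (a : A) (t : I),
        M (w, suspMk A (a, t)) = N (w, h.H (a, 1), clampI (4 * t - 1)) := by
  have hk : Continuous k := by
    have : k = fun w => N (w, pt, 0) := by ext w; rw [h0]
    rw [this]; fun_prop
  -- A cutoff: 1 where `h.v` vanishes and 0 once `h.v ≥ 2 / 3`.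
  let r : A → ℝ := fun a => max 0 (min 1 (2 - 3 * h.v a))
  -- The path at the contracted point is run up to time `r`, and the path at the base point is run
  -- back from there. At the turn either `r = 1`, where all paths end at `k w`, or the contracted
  -- point is the base point. The first and last quarters are stationary, as is everything with `h.v
  -- > 2 / 3`.
  let g : W × A × I → Z := fun p => if (p.2.2 : ℝ) ≤ 1 / 2 then
    N (p.1, h.H (p.2.1, 1), clampI (r p.2.1 * clampI (4 * p.2.2 - 1))) else
    N (p.1, pt, clampI (r p.2.1 * clampI (3 - 4 * p.2.2)))
  have hr1 : ∀ a, h.v a ≤ 0 → r a = 1 := by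
    intro a ha
    simp only [r]
    rw [min_eq_left (by linarith)]
    norm_num
  have hg : Continuous g := by
    refine Continuous.if_le (by fun_prop) (by fun_prop) (by fun_prop) continuous_const ?_
    rintro ⟨w, a, t⟩ ht
    simp only at ht ⊢
    rw [ht, clampI_of_ge (x := 4 * (1 / 2) - 1) (by norm_num),
      clampI_of_ge (x := 3 - 4 * (1 / 2)) (by norm_num)]
    rcases le_or_gt (h.v a) 0 with ha | ha
    · rw [hr1 a ha]
      simp [h1]
    · rw [h.H_one a ha]
  let O : Set (A × I) := {z | 2 / 3 < h.v z.1 ∨ (z.2 : ℝ) < 1 / 4 ∨ 3 / 4 < (z.2 : ℝ)}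
  have hO : IsOpen O := by
    have c : Continuous fun z : A × I => (z.2 : ℝ) := by fun_prop
    exact (isOpen_lt continuous_const (h.v.continuous.comp continuous_fst)).union
      ((isOpen_lt c continuous_const).union (isOpen_lt continuous_const c))
  have hbase : suspBase A ⊆ O := by
    rintro ⟨a, t⟩ (e | e | e)
    · change a = pt at e
      left
      change 2 / 3 < h.v a
      rw [e, h.v_pt]; norm_num
    · change t = 0 at e
      right; left
      change (t : ℝ) < 1 / 4
      rw [e]; norm_num
    · change t = 1 at e
      right; right
      change 3 / 4 < (t : ℝ)
      rw [e]; norm_num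
  have hgO : ∀ w, ∀ z ∈ O, g (w, z) = k w := by
    rintro w ⟨a, t⟩ (e | e | e)
    · change 2 / 3 < h.v a at e
      have : r a = 0 := max_eq_left ((min_le_right _ _).trans (by linarith))
      simp only [g, this, zero_mul, clampI_zero, h0, ite_self]
    · change (t : ℝ) < 1 / 4 at e
      simp only [g]
      rw [if_pos (by linarith), clampI_of_le (x := 4 * (t : ℝ) - 1) (by linarith)]
      simp [h0]
    · change 3 / 4 < (t : ℝ) at e
      simp only [g]
      rw [if_neg (by linarith), clampI_of_le (x := 3 - 4 * (t : ℝ)) (by linarith)]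
      simp [h0]
  let M : W × Susp A → Z := fun x =>
    Quotient.lift (s := collapse (suspBase A)) (fun z => g (x.1, z)) (by
      rintro z z' (rfl | ⟨e, e'⟩)
      · rfl
      · exact (hgO _ z (hbase e)).trans (hgO _ z' (hbase e')).symm) x.2
  have hM : ∀ w z, M (w, suspMk A z) = g (w, z) := fun _ _ => rfl
  refine ⟨⟨M, continuous_prod_susp hg hk hM hO hbase hgO⟩, ?_, ?_⟩
  · intro w
    change M (w, pt) = k w
    rw [← suspMk_zero pt, hM, hgO w _ (hbase (Or.inr (Or.inl rfl)))]
  · intro w hw a t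
    rw [ContinuousMap.coe_mk, hM]
    simp only [g]
    split_ifs with ht
    · rcases le_or_gt (h.v a) 0 with ha | ha
      · rw [hr1 a ha, one_mul, clampI_coe]
      · rw [h.H_one a ha, hw, hw]
    · rw [hw, clampI_of_ge (x := 4 * (t : ℝ) - 1) (by linarith), h1]

end Suspension

/-! ### Vertical homotopies -/

/-- Homotopy over the base `B`, for maps to a space `E` over `B`. -/
def FibHomotopic {W E B : Type*} [TopologicalSpace W] [TopologicalSpace E] [TopologicalSpace B]
    (p : C(E, B)) (a b : C(W, E)) : Prop :=
  ∃ H : C(W × I, E), (∀ w, H (w, 0) = a w) ∧ (∀ w, H (w, 1) = b w) ∧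
    ∀ w t, p (H (w, t)) = p (a w)

namespace FibHomotopic

variable {W W' E E' B : Type*} [TopologicalSpace W] [TopologicalSpace W'] [TopologicalSpace E]
  [TopologicalSpace E'] [TopologicalSpace B] {p : C(E, B)} {p' : C(E', B)} {a b c : C(W, E)}

theorem refl (p : C(E, B)) (a : C(W, E)) : FibHomotopic p a a :=
  ⟨⟨fun z => a z.1, by fun_prop⟩, fun _ => rfl, fun _ => rfl, fun _ _ => rfl⟩

theorem proj_eq (h : FibHomotopic p a b) (w : W) : p (b w) = p (a w) := by
  obtain ⟨H, -, h1, h2⟩ := h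
  rw [← h1, h2]

theorem symm (h : FibHomotopic p a b) : FibHomotopic p b a := by
  obtain ⟨H, h0, h1, h2⟩ := id h
  refine ⟨⟨fun z => H (z.1, unitInterval.symm z.2), by fun_prop⟩, fun w => ?_, fun w => ?_,
    fun w t => ?_⟩
  · simp [h1]
  · simp [h0]
  · exact (h2 w _).trans (h.proj_eq w).symm

theorem trans (h : FibHomotopic p a b) (h' : FibHomotopic p b c) : FibHomotopic p a c := by
  obtain ⟨H, h0, h1, h2⟩ := id h
  obtain ⟨H', h0', h1', h2'⟩ := h'
  refine ⟨⟨fun z => if (z.2 : ℝ) ≤ 1 / 2 then H (z.1, clampI (2 * z.2))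
    else H' (z.1, clampI (2 * z.2 - 1)), ?_⟩, fun w => ?_, fun w => ?_, fun w t => ?_⟩
  · refine Continuous.if_le (by fun_prop) (by fun_prop) (by fun_prop) continuous_const ?_
    rintro ⟨w, t⟩ ht
    simp only at ht ⊢
    rw [ht, clampI_of_ge (by norm_num), clampI_of_le (by norm_num), h1, h0']
  · norm_num [h0]
  · norm_num [h1']
  · simp only [ContinuousMap.coe_mk]
    split_ifs
    · rw [h2]
    · rw [h2', h.proj_eq]

theorem homotopic (h : FibHomotopic p a b) : a.Homotopic b := by
  obtain ⟨H, h0, h1, -⟩ := h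
  exact homotopic_iff_exists.2 ⟨H, h0, h1⟩

theorem comp_right (h : FibHomotopic p a b) (k : C(W', W)) :
    FibHomotopic p (a.comp k) (b.comp k) := by
  obtain ⟨H, h0, h1, h2⟩ := h
  exact ⟨⟨fun z => H (k z.1, z.2), by fun_prop⟩, fun w => h0 _, fun w => h1 _, fun w t => h2 _ _⟩

theorem comp_left (h : FibHomotopic p a b) (f : C(E, E')) (hf : ∀ e, p' (f e) = p e) :
    FibHomotopic p' (f.comp a) (f.comp b) := by
  obtain ⟨H, h0, h1, h2⟩ := h
  refine ⟨f.comp H, fun w => ?_, fun w => ?_, fun w t => ?_⟩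
  · simp [h0]
  · simp [h1]
  · simp [hf, h2]

/-- Composition of a vertical homotopy with a map which is defined over a part of the base. -/
theorem comp_local (h : FibHomotopic p a b) {A : Set B} (g : C({e : E // p e ∈ A}, E'))
    (hg : ∀ e, p' (g e) = p e.1) (ha : ∀ w, p (a w) ∈ A) (hb : ∀ w, p (b w) ∈ A) :
    FibHomotopic p' (⟨fun w => g ⟨a w, ha w⟩, by fun_prop⟩ : C(W, E'))
      ⟨fun w => g ⟨b w, hb w⟩, by fun_prop⟩ := by
  obtain ⟨H, h0, h1, h2⟩ := h
  refine ⟨⟨fun z => g ⟨H z, by rw [show z = (z.1, z.2) from rfl, h2]; exact ha _⟩, by fun_prop⟩,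
    fun w => ?_, fun w => ?_, fun w t => ?_⟩
  · simp [h0]
  · simp [h1]
  · simp [hg, h2]

end FibHomotopic

/-- Two lifts of the same homotopy, with the same start, have vertically homotopic ends. -/
theorem IsFibration.fibHomotopic_of_lifts {W E B : Type u} [TopologicalSpace W]
    [TopologicalSpace E] [TopologicalSpace B] {p : C(E, B)} (hp : IsFibration p)
    (H₀ H₁ : C(W × I, E)) (h0 : ∀ w, H₀ (w, 0) = H₁ (w, 0)) (h : ∀ z, p (H₀ z) = p (H₁ z)) :
    FibHomotopic p ⟨fun w => H₀ (w, 1), by fun_prop⟩ ⟨fun w => H₁ (w, 1), by fun_prop⟩ := by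
  -- Back along `H₀` to the common start, then forth along `H₁`; the projection of this path
  -- retraces itself.
  let Γ : (W × I) → E := fun z => if (z.2 : ℝ) ≤ 1 / 2 then H₀ (z.1, clampI |2 * (z.2 : ℝ) - 1|)
    else H₁ (z.1, clampI |2 * (z.2 : ℝ) - 1|)
  have hΓ : Continuous Γ := by
    refine Continuous.if_le (by fun_prop) (by fun_prop) (by fun_prop) continuous_const ?_
    rintro ⟨w, t⟩ ht
    simp only at ht ⊢
    rw [ht, clampI_of_le (by norm_num), h0]
  have hpΓ : ∀ z, p (Γ z) = p (H₀ (z.1, clampI |2 * (z.2 : ℝ) - 1|)) := by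
    intro z
    simp only [Γ]
    split_ifs
    · rfl
    · rw [h]
  -- The retraced path is contracted to its end in the base and this contraction is lifted. The
  -- three other sides of the lifted square lie over the constant path and together form the
  -- vertical homotopy.
  obtain ⟨K, K0, Kp⟩ := hp (W × I) ⟨Γ, hΓ⟩
    ⟨fun z => p (H₀ (z.1.1, clampI (max |2 * (z.1.2 : ℝ) - 1| z.2))), by fun_prop⟩ (by
      rintro z
      simp only [ContinuousMap.coe_mk]
      rw [hpΓ]
      norm_num)
  have h1 : ∀ (w : W) (t : I), p (K ((w, 0), t)) = p (H₀ (w, 1)) := by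
    intro w t
    rw [Kp]
    simp only [ContinuousMap.coe_mk]
    rw [clampI_of_ge (by norm_num)]
  have h2 : ∀ (w : W) (t : I), p (K ((w, 1), t)) = p (H₀ (w, 1)) := by
    intro w t
    rw [Kp]
    simp only [ContinuousMap.coe_mk]
    rw [clampI_of_ge (by norm_num)]
  have h3 : ∀ (w : W) (t : I), p (K ((w, t), 1)) = p (H₀ (w, 1)) := by
    intro w t
    rw [Kp]
    simp only [ContinuousMap.coe_mk]
    rw [clampI_of_ge (by norm_num)]
  refine FibHomotopic.trans (b := ⟨fun w => K ((w, 0), 1), by fun_prop⟩) ?_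
    (FibHomotopic.trans (b := ⟨fun w => K ((w, 1), 1), by fun_prop⟩) ?_ (FibHomotopic.symm ?_))
  · refine ⟨⟨fun z => K ((z.1, 0), z.2), by fun_prop⟩, fun w => ?_, fun w => rfl, h1⟩
    simp only [ContinuousMap.coe_mk]
    rw [K0]
    simp only [ContinuousMap.coe_mk, Γ]
    norm_num
  · exact ⟨⟨fun z => K ((z.1, z.2), 1), by fun_prop⟩, fun w => rfl, fun w => rfl,
      fun w t => (h3 w t).trans (h3 w 0).symm⟩
  · refine ⟨⟨fun z => K ((z.1, 1), z.2), by fun_prop⟩, fun w => ?_, fun w => rfl, fun w t => ?_⟩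
    · simp only [ContinuousMap.coe_mk]
      rw [K0]
      simp only [ContinuousMap.coe_mk, Γ]
      norm_num
    · exact (h2 w t).trans (by rw [h]; rfl)

/-! ### Gluing over a closed cover -/

theorem continuousOn_of_subtype {Z X : Type*} [TopologicalSpace Z] [TopologicalSpace X]
    {P : Z → Prop} (φ : C({z // P z}, X)) {g : Z → X} (h : ∀ z (hz : P z), g z = φ ⟨z, hz⟩) :
    ContinuousOn g {z | P z} := by
  rw [continuousOn_iff_continuous_domRestrict]
  exact φ.continuous.congr fun z => (h z.1 z.2).symm

/-- Gluing of three maps along the values of a real function. -/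
theorem exists_glue {Z X : Type*} [TopologicalSpace Z] [TopologicalSpace X] (φ : C(Z, ℝ))
    {a b : ℝ} (hab : a < b) (F₁ : C({z // φ z ≤ a}, X)) (F₂ : C({z // a ≤ φ z ∧ φ z ≤ b}, X))
    (F₃ : C({z // b ≤ φ z}, X))
    (h₁ : ∀ z (h : φ z = a), F₁ ⟨z, h.le⟩ = F₂ ⟨z, h.ge, h.le.trans hab.le⟩)
    (h₂ : ∀ z (h : φ z = b), F₂ ⟨z, hab.le.trans h.ge, h.le⟩ = F₃ ⟨z, h.ge⟩) :
    ∃ F : C(Z, X), (∀ z h, F z = F₁ ⟨z, h⟩) ∧ (∀ z h, F z = F₂ ⟨z, h⟩) ∧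
      ∀ z h, F z = F₃ ⟨z, h⟩ := by
  classical
  let F : Z → X := fun z => if h : φ z ≤ a then F₁ ⟨z, h⟩ else
    if h' : φ z ≤ b then F₂ ⟨z, (not_le.1 h).le, h'⟩ else F₃ ⟨z, (not_le.1 h').le⟩
  have e1 : ∀ z h, F z = F₁ ⟨z, h⟩ := fun z h => dif_pos h
  have e2 : ∀ z h, F z = F₂ ⟨z, h⟩ := by
    rintro z ⟨h, h'⟩
    by_cases h3 : φ z ≤ a
    · rw [e1 z h3]
      exact h₁ z (le_antisymm h3 h)
    · simp only [F]
      rw [dif_neg h3, dif_pos h']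
  have e3 : ∀ z h, F z = F₃ ⟨z, h⟩ := by
    rintro z h
    by_cases h3 : φ z ≤ b
    · rw [e2 z ⟨hab.le.trans h, h3⟩]
      exact h₂ z (le_antisymm h3 h)
    · simp only [F]
      rw [dif_neg (fun h4 => h3 (h4.trans hab.le)), dif_neg h3]
  refine ⟨⟨F, ?_⟩, e1, e2, e3⟩
  refine continuous_of_le_of_ge φ.continuous b (g₁ := F) (g₂ := F) ?_
    (continuousOn_of_subtype F₃ e3) (fun _ _ => rfl) (fun _ _ => rfl)
  refine ContinuousOn.mono (ContinuousOn.union_of_isClosed (continuousOn_of_subtype F₁ e1)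
    (continuousOn_of_subtype F₂ e2) (isClosed_le φ.continuous continuous_const)
    ((isClosed_le continuous_const φ.continuous).inter
      (isClosed_le φ.continuous continuous_const))) ?_
  intro z hz
  rcases le_total (φ z) a with h | h
  · exact Or.inl h
  · exact Or.inr ⟨h, hz⟩

/-! ### Fibrewise maps which are homotopy equivalences on one fibre -/

section Dold

variable {X Y S : Type u} [TopologicalSpace X] [TopologicalSpace Y] [TopologicalSpace S]

/-- The restriction of a fibrewise map to the fibres over `b`. -/
def fibreMap {pX : C(X, S)} {pY : C(Y, S)} (f : C(X, Y)) (hf : ∀ x, pY (f x) = pX x) (b : S) :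
    C({x // pX x = b}, {y // pY y = b}) :=
  ⟨fun x => ⟨f x.1, (hf _).trans x.2⟩, by fun_prop⟩

/-- Lifting the contraction `c` transports the fibres over `A` to the fibre over `b`, and lifting
its reverse transports them back. The local inverse goes out in `Y`, applies `k`, and returns in
`X`. It inverts `f` because `f` commutes with transport up to vertical homotopy, by
`IsFibration.fibHomotopic_of_lifts`. -/
theorem exists_local_inverse {pX : C(X, S)} {pY : C(Y, S)} (hX : IsFibration pX)
    (hY : IsFibration pY) (f : C(X, Y)) (hf : ∀ x, pY (f x) = pX x) {b : S}
    (k : C({y // pY y = b}, {x // pX x = b}))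
    (hkf : (k.comp (fibreMap f hf b)).Homotopic (.id _))
    (hfk : ((fibreMap f hf b).comp k).Homotopic (.id _))
    (c : C(S × I, S)) (hc0 : ∀ s, c (s, 0) = s) (A : Set S) (hcA : ∀ s ∈ A, c (s, 1) = b) :
    ∃ g : C({y // pY y ∈ A}, X), (∀ y, pX (g y) = pY y.1) ∧
      FibHomotopic pY (f.comp g) ⟨Subtype.val, continuous_subtype_val⟩ ∧
      FibHomotopic pX (⟨fun x => g ⟨f x.1, (hf x.1).symm ▸ x.2⟩, by fun_prop⟩ :
        C({x // pX x ∈ A}, X)) ⟨Subtype.val, continuous_subtype_val⟩ := by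
  obtain ⟨CX, CX0, CXp⟩ := hX X (.id X) ⟨fun z => c (pX z.1, z.2), by fun_prop⟩
    (fun x => hc0 _)
  obtain ⟨CY, CY0, CYp⟩ := hY Y (.id Y) ⟨fun z => c (pY z.1, z.2), by fun_prop⟩
    (fun x => hc0 _)
  -- Return transport is defined on pairs of a base point `s` and a point over `c (s, 1)`, since the
  -- point alone does not remember where it is to return.
  obtain ⟨BX, BX0, BXp⟩ := hX {z : S × X // pX z.2 = c (z.1, 1)} ⟨fun z => z.1.2, by fun_prop⟩
    ⟨fun z => c (z.1.1.1, unitInterval.symm z.2), by fun_prop⟩ (fun z => by simp [z.2])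
  obtain ⟨BY, BY0, BYp⟩ := hY {z : S × Y // pY z.2 = c (z.1, 1)} ⟨fun z => z.1.2, by fun_prop⟩
    ⟨fun z => c (z.1.1.1, unitInterval.symm z.2), by fun_prop⟩ (fun z => by simp [z.2])
  simp only [ContinuousMap.coe_mk, ContinuousMap.id_apply] at CX0 CXp CY0 CYp BX0 BXp BY0 BYp
  -- transport back from the pulled back spaces
  let βX : C({z : S × X // pX z.2 = c (z.1, 1)}, X) := ⟨fun z => BX (z, 1), by fun_prop⟩
  let βY : C({z : S × Y // pY z.2 = c (z.1, 1)}, Y) := ⟨fun z => BY (z, 1), by fun_prop⟩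
  have hβX : ∀ z, pX (βX z) = z.1.1 := fun z => by
    change pX (BX (z, 1)) = _
    rw [BXp]; simp [hc0]
  have hβY : ∀ z, pY (βY z) = z.1.1 := fun z => by
    change pY (BY (z, 1)) = _
    rw [BYp]; simp [hc0]
  let cf : C({z : S × X // pX z.2 = c (z.1, 1)}, {z : S × Y // pY z.2 = c (z.1, 1)}) :=
    ⟨fun z => ⟨(z.1.1, f z.1.2), (hf _).trans z.2⟩, by fun_prop⟩
  have hfβ : FibHomotopic pY (f.comp βX) (βY.comp cf) := by
    refine hY.fibHomotopic_of_lifts (f.comp BX) ⟨fun z => BY (cf z.1, z.2), by fun_prop⟩ ?_ ?_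
    · intro z
      simp only [ContinuousMap.comp_apply, ContinuousMap.coe_mk]
      rw [BX0, BY0]; rfl
    · intro z
      simp only [ContinuousMap.comp_apply, ContinuousMap.coe_mk]
      rw [hf, BXp, BYp]; rfl
  -- Going out and back is vertically homotopic to the identity: both the return lift and the
  -- reversed outward lift start at the same point over the same path.
  have hret : ∀ {V : Type u} [TopologicalSpace V] {q : C(V, S)} (hq : IsFibration q)
      (C : C(V × I, V)) (B : C({z : S × V // q z.2 = c (z.1, 1)} × I, V)),
      (∀ x, C (x, 0) = x) → (hC : ∀ z, q (C z) = c (q z.1, z.2)) → (∀ z, B (z, 0) = z.1.2) →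
      (∀ z, q (B z) = c (z.1.1.1, unitInterval.symm z.2)) →
      FibHomotopic q (⟨fun x => B (⟨(q x, C (x, 1)), hC (x, 1)⟩, 1), by fun_prop⟩ : C(V, V))
        (.id V) := by
    intro V _ q hq C B C0 Cp B0 Bp
    have := hq.fibHomotopic_of_lifts
      (⟨fun z => B (⟨(q z.1, C (z.1, 1)), Cp (z.1, 1)⟩, z.2), by fun_prop⟩ : C(V × I, V))
      ⟨fun z => C (z.1, unitInterval.symm z.2), by fun_prop⟩ (fun x => by simp [B0])
      (fun z => by
        simp only [ContinuousMap.coe_mk]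
        rw [Bp, Cp])
    simp only [ContinuousMap.coe_mk, unitInterval.symm_one, C0] at this
    exact this
  have hτY := hret hY CY BY CY0 CYp BY0 BYp
  have hτX := hret hX CX BX CX0 CXp BX0 BXp
  let τY : C({y // pY y ∈ A}, {y // pY y = b}) :=
    ⟨fun y => ⟨CY (y.1, 1), (CYp _).trans (hcA _ y.2)⟩, by fun_prop⟩
  let τX : C({x // pX x ∈ A}, {x // pX x = b}) :=
    ⟨fun x => ⟨CX (x.1, 1), (CXp _).trans (hcA _ x.2)⟩, by fun_prop⟩
  let jX : C({s // s ∈ A} × {x // pX x = b}, {z : S × X // pX z.2 = c (z.1, 1)}) :=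
    ⟨fun z => ⟨(z.1.1, z.2.1), z.2.2.trans (hcA _ z.1.2).symm⟩, by fun_prop⟩
  let jY : C({s // s ∈ A} × {y // pY y = b}, {z : S × Y // pY z.2 = c (z.1, 1)}) :=
    ⟨fun z => ⟨(z.1.1, z.2.1), z.2.2.trans (hcA _ z.1.2).symm⟩, by fun_prop⟩
  have hpush : ∀ {V : Type u} [TopologicalSpace V] (s : C(V, {s // s ∈ A}))
      {a a' : C(V, {x // pX x = b})}, a.Homotopic a' → FibHomotopic pX
        (βX.comp (jX.comp (s.prodMk a))) (βX.comp (jX.comp (s.prodMk a'))) := by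
    intro V _ s a a' h
    obtain ⟨F, F0, F1⟩ := homotopic_iff_exists.1 h
    refine ⟨⟨fun z => βX (jX (s z.1, F z)), by fun_prop⟩, fun w => ?_, fun w => ?_, fun w t => ?_⟩
    · simp [F0]
    · simp [F1]
    · simp only [ContinuousMap.coe_mk, ContinuousMap.comp_apply, hβX]; rfl
  have hpush' : ∀ {V : Type u} [TopologicalSpace V] (s : C(V, {s // s ∈ A}))
      {a a' : C(V, {x // pY x = b})}, a.Homotopic a' → FibHomotopic pY
        (βY.comp (jY.comp (s.prodMk a))) (βY.comp (jY.comp (s.prodMk a'))) := by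
    intro V _ s a a' h
    obtain ⟨F, F0, F1⟩ := homotopic_iff_exists.1 h
    refine ⟨⟨fun z => βY (jY (s z.1, F z)), by fun_prop⟩, fun w => ?_, fun w => ?_, fun w t => ?_⟩
    · simp [F0]
    · simp [F1]
    · simp only [ContinuousMap.coe_mk, ContinuousMap.comp_apply, hβY]; rfl
  let sY : C({y // pY y ∈ A}, {s // s ∈ A}) := ⟨fun y => ⟨pY y.1, y.2⟩, by fun_prop⟩
  let sX : C({x // pX x ∈ A}, {s // s ∈ A}) := ⟨fun x => ⟨pX x.1, x.2⟩, by fun_prop⟩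
  let g : C({y // pY y ∈ A}, X) := βX.comp (jX.comp (sY.prodMk (k.comp τY)))
  let fA : C({x // pX x ∈ A}, {y // pY y ∈ A}) :=
    ⟨fun x => ⟨f x.1, (hf x.1).symm ▸ x.2⟩, by fun_prop⟩
  refine ⟨g, fun y => hβX _, ?_, ?_⟩
  · have e1 : FibHomotopic pY (f.comp g)
        (βY.comp (jY.comp (sY.prodMk ((fibreMap f hf b).comp (k.comp τY))))) :=
      hfβ.comp_right (jX.comp (sY.prodMk (k.comp τY)))
    have e2 : FibHomotopic pY
        (βY.comp (jY.comp (sY.prodMk ((fibreMap f hf b).comp (k.comp τY)))))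
        (βY.comp (jY.comp (sY.prodMk τY))) :=
      hpush' sY (hfk.comp (.refl τY) : (((fibreMap f hf b).comp k).comp τY).Homotopic _)
    exact (e1.trans e2).trans (hτY.comp_right ⟨Subtype.val, continuous_subtype_val⟩)
  -- The two lifts compared here both end over `b`, so their vertical homotopy takes place inside
  -- that fibre.
  · have e0 : (τY.comp fA).Homotopic ((fibreMap f hf b).comp τX) := by
      have := (hY.fibHomotopic_of_lifts (⟨fun z => CY (f z.1, z.2), by fun_prop⟩ : C(X × I, Y))
        (f.comp CX) (fun x => by simp [CX0, CY0]) (fun z => by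
          simp only [ContinuousMap.coe_mk, ContinuousMap.comp_apply]
          rw [CYp, hf, hf, CXp])).comp_right
        (⟨Subtype.val, continuous_subtype_val⟩ : C({x // pX x ∈ A}, X))
      obtain ⟨K, K0, K1, Kp⟩ := this
      have hK : ∀ z, K z ∈ pY ⁻¹' {b} := by
        intro z
        refine (Kp z.1 z.2).trans ?_
        simp only [ContinuousMap.coe_mk, ContinuousMap.comp_apply]
        rw [CYp, hf]
        exact hcA _ z.1.2
      refine homotopic_iff_exists.2 ⟨⟨fun z => ⟨K z, hK z⟩, by fun_prop⟩, fun x => ?_, fun x => ?_⟩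
      · exact Subtype.ext (K0 x)
      · exact Subtype.ext (K1 x)
    have e1 : FibHomotopic pX (g.comp fA)
        (βX.comp (jX.comp (sX.prodMk (k.comp (τY.comp fA))))) := by
      have : g.comp fA = βX.comp (jX.comp (sX.prodMk (k.comp (τY.comp fA)))) := by
        ext x
        change βX _ = βX _
        congr 1
        apply Subtype.ext
        exact Prod.ext (hf x.1) rfl
      rw [this]
      exact .refl _ _
    have e2 : (k.comp (τY.comp fA)).Homotopic τX :=
      ((ContinuousMap.Homotopic.refl k).comp e0).trans
        (hkf.comp (.refl τX) : ((k.comp (fibreMap f hf b)).comp τX).Homotopic _)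
    exact (e1.trans (hpush sX e2)).trans
      (hτX.comp_right ⟨Subtype.val, continuous_subtype_val⟩)

end Dold

/-! ### Gluing local fibre homotopy inverses; Dold's theorem -/

section DoldGluing

variable {X Y S : Type u} [TopologicalSpace X] [TopologicalSpace Y] [TopologicalSpace S]

/-- Two fibrewise maps, defined over the two parts of a closed cover of the base and vertically
homotopic over the intersection, can be glued up to vertical homotopy. -/
theorem exists_glue_fibHomotopic {pX : C(X, S)} {pY : C(Y, S)} (v : C(S, ℝ))
    (g₀ : C({y // pY y ∈ {s | 1 / 3 ≤ v s}}, X)) (g₁ : C({y // pY y ∈ {s | v s ≤ 2 / 3}}, X))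
    (h₀ : ∀ y, pX (g₀ y) = pY y.1) (h₁ : ∀ y, pX (g₁ y) = pY y.1)
    (h : FibHomotopic pX
      (⟨fun y => g₁ ⟨y.1, y.2.2⟩, by fun_prop⟩ : C({y // 1 / 3 ≤ v (pY y) ∧ v (pY y) ≤ 2 / 3}, X))
      ⟨fun y => g₀ ⟨y.1, y.2.1⟩, by fun_prop⟩) :
    ∃ g : C(Y, X), (∀ y, pX (g y) = pY y) ∧
      FibHomotopic pX (g.comp (⟨Subtype.val, continuous_subtype_val⟩ : C(_, Y))) g₀ ∧
      FibHomotopic pX (g.comp (⟨Subtype.val, continuous_subtype_val⟩ : C(_, Y))) g₁ := by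
  obtain ⟨Q, Q0, Q1, Qp⟩ := h
  simp only [ContinuousMap.coe_mk, Subtype.forall] at Q0 Q1 Qp
  have Qp' : ∀ z, pX (Q z) = pY z.1.1 := fun z => by
    rw [show z = (⟨z.1.1, z.1.2⟩, z.2) from rfl, Qp, h₁]
  -- Across the overlap the given homotopy is traversed from `g₁` to `g₀`, with `3 * v - 1` as its
  -- time.
  obtain ⟨g, e1, e2, e3⟩ := exists_glue (v.comp pY) (a := 1 / 3) (b := 2 / 3) (by norm_num)
    (⟨fun y => g₁ ⟨y.1, y.2.trans (by norm_num)⟩, by fun_prop⟩ :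
      C({y // (v.comp pY) y ≤ 1 / 3}, X))
    (⟨fun y => Q (⟨y.1, y.2⟩, clampI (3 * v (pY y.1) - 1)), by fun_prop⟩ :
      C({y // 1 / 3 ≤ (v.comp pY) y ∧ (v.comp pY) y ≤ 2 / 3}, X))
    (⟨fun y => g₀ ⟨y.1, le_trans (by norm_num) y.2⟩, by fun_prop⟩ :
      C({y // 2 / 3 ≤ (v.comp pY) y}, X))
    (fun y hy => by
      change v (pY y) = 1 / 3 at hy
      simp only [ContinuousMap.coe_mk]
      rw [clampI_of_le (by rw [hy]; norm_num), Q0])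
    (fun y hy => by
      change v (pY y) = 2 / 3 at hy
      simp only [ContinuousMap.coe_mk]
      rw [clampI_of_ge (by rw [hy]; norm_num), Q1])
  simp only [ContinuousMap.coe_mk, ContinuousMap.comp_apply] at e1 e2 e3
  refine ⟨g, fun y => ?_, ?_, ?_⟩
  · rcases le_total (v (pY y)) (1 / 3) with h | h
    · rw [e1 y h, h₁]
    · rcases le_total (v (pY y)) (2 / 3) with h' | h'
      · rw [e2 y ⟨h, h'⟩, Qp']
      · rw [e3 y h', h₀]
  -- Raising the traversal time to at least `t` pushes the map to `g₀`.
  · obtain ⟨F, f1, f2, f3⟩ := exists_glue (Z := {y // pY y ∈ {s | 1 / 3 ≤ v s}} × I) ⟨fun z => v (pY z.1.1), by fun_prop⟩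
      (a := 1 / 3) (b := 2 / 3) (by norm_num)
      (⟨fun z => Q (⟨z.1.1.1, z.1.1.2, z.2.trans (by norm_num)⟩, z.1.2), by fun_prop⟩ :
        C({z : {y // pY y ∈ {s | 1 / 3 ≤ v s}} × I // v (pY z.1.1) ≤ 1 / 3}, X))
      (⟨fun z => Q (⟨z.1.1.1, z.2⟩, clampI (max (3 * v (pY z.1.1.1) - 1) z.1.2)), by fun_prop⟩ :
        C({z : {y // pY y ∈ {s | 1 / 3 ≤ v s}} × I // 1 / 3 ≤ v (pY z.1.1) ∧ v (pY z.1.1) ≤ 2 / 3}, X))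
      (⟨fun z => g₀ z.1.1, by fun_prop⟩ : C({z : {y // pY y ∈ {s | 1 / 3 ≤ v s}} × I // 2 / 3 ≤ v (pY z.1.1)}, X))
      (by
        rintro ⟨y, t⟩ hy
        change v (pY y.1) = 1 / 3 at hy
        simp only [ContinuousMap.coe_mk]
        rw [max_eq_right (by rw [hy]; norm_num; exact t.2.1), clampI_coe])
      (by
        rintro ⟨y, t⟩ hy
        change v (pY y.1) = 2 / 3 at hy
        simp only [ContinuousMap.coe_mk]
        rw [clampI_of_ge (le_max_of_le_left (by rw [hy]; norm_num)), Q1])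
    simp only [ContinuousMap.coe_mk] at f1 f2 f3
    refine ⟨F, fun y => ?_, fun y => ?_, fun y t => ?_⟩
    · have hy : 1 / 3 ≤ v (pY y.1) := y.2
      rcases le_total (v (pY y.1)) (2 / 3) with h' | h'
      · rw [f2 (y, 0) ⟨hy, h'⟩]
        simp only [ContinuousMap.comp_apply, ContinuousMap.coe_mk]
        rw [e2 y.1 ⟨hy, h'⟩, max_eq_left (by simp only [Set.Icc.coe_zero]; linarith)]
      · rw [f3 (y, 0) h']
        simp only [ContinuousMap.comp_apply, ContinuousMap.coe_mk]
        rw [e3 y.1 h']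
    · have hy : 1 / 3 ≤ v (pY y.1) := y.2
      rcases le_total (v (pY y.1)) (2 / 3) with h' | h'
      · rw [f2 (y, 1) ⟨hy, h'⟩]
        simp only
        rw [clampI_of_ge (show (1 : ℝ) ≤ max _ ((1 : I) : ℝ) from le_max_right _ _), Q1]
      · rw [f3 (y, 1) h']
    · have hy : 1 / 3 ≤ v (pY y.1) := y.2
      have hg : pX (g y.1) = pY y.1 := by
        rcases le_total (v (pY y.1)) (2 / 3) with h' | h'
        · rw [e2 y.1 ⟨hy, h'⟩, Qp']
        · rw [e3 y.1 h', h₀]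
      refine Eq.trans ?_ hg.symm
      rcases le_total (v (pY y.1)) (2 / 3) with h' | h'
      · rw [f2 (y, t) ⟨hy, h'⟩, Qp']
      · rw [f3 (y, t) h', h₀]
  -- Here the traversal time is lowered to at most `1 - t`, which pushes the map to `g₁`.
  · obtain ⟨F, f1, f2, f3⟩ := exists_glue (Z := {y // pY y ∈ {s | v s ≤ 2 / 3}} × I) ⟨fun z => v (pY z.1.1), by fun_prop⟩
      (a := 1 / 3) (b := 2 / 3) (by norm_num)
      (⟨fun z => g₁ z.1.1, by fun_prop⟩ : C({z : {y // pY y ∈ {s | v s ≤ 2 / 3}} × I // v (pY z.1.1) ≤ 1 / 3}, X))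
      (⟨fun z => Q (⟨z.1.1.1, z.2⟩, clampI (min (3 * v (pY z.1.1.1) - 1) (1 - z.1.2))),
        by fun_prop⟩ : C({z : {y // pY y ∈ {s | v s ≤ 2 / 3}} × I // 1 / 3 ≤ v (pY z.1.1) ∧ v (pY z.1.1) ≤ 2 / 3}, X))
      (⟨fun z => Q (⟨z.1.1.1, le_trans (by norm_num) z.2, z.1.1.2⟩, clampI (1 - z.1.2)),
        by fun_prop⟩ : C({z : {y // pY y ∈ {s | v s ≤ 2 / 3}} × I // 2 / 3 ≤ v (pY z.1.1)}, X))
      (by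
        rintro ⟨y, t⟩ hy
        change v (pY y.1) = 1 / 3 at hy
        simp only [ContinuousMap.coe_mk]
        rw [clampI_of_le (min_le_of_left_le (by rw [hy]; norm_num)), Q0])
      (by
        rintro ⟨y, t⟩ hy
        change v (pY y.1) = 2 / 3 at hy
        simp only [ContinuousMap.coe_mk]
        rw [min_eq_right (by rw [hy]; norm_num; exact t.2.1)])
    simp only [ContinuousMap.coe_mk] at f1 f2 f3
    have hlow : ∀ y : {y // pY y ∈ {s | v s ≤ 2 / 3}}, ∀ t : I, pX (F (y, t)) = pY y.1 := by
      intro y t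
      rcases le_total (v (pY y.1)) (1 / 3) with h' | h'
      · rw [f1 (y, t) h', h₁]
      · rw [f2 (y, t) ⟨h', y.2⟩, Qp']
    have h0 : ∀ y : {y // pY y ∈ {s | v s ≤ 2 / 3}}, F (y, 0) = g y.1 := by
      intro y
      have hy : v (pY y.1) ≤ 2 / 3 := y.2
      rcases le_total (v (pY y.1)) (1 / 3) with h' | h'
      · rw [f1 (y, 0) h', e1 y.1 h']
      · rw [f2 (y, 0) ⟨h', hy⟩, e2 y.1 ⟨h', hy⟩,
          min_eq_left (by simp only [Set.Icc.coe_zero]; linarith)]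
    refine ⟨F, h0, fun y => ?_, fun y t => ?_⟩
    · have hy : v (pY y.1) ≤ 2 / 3 := y.2
      rcases le_total (v (pY y.1)) (1 / 3) with h' | h'
      · rw [f1 (y, 1) h']
      · rw [f2 (y, 1) ⟨h', hy⟩]
        simp only
        rw [clampI_of_le (min_le_of_right_le (by norm_num)), Q0]
    · refine (hlow y t).trans ?_
      rw [← hlow y 0, h0]; rfl

/-- The part of `Y` over the overlap of the closed cover of the base. -/
abbrev Overlap (v : C(S, ℝ)) (pY : C(Y, S)) := {y // 1 / 3 ≤ v (pY y) ∧ v (pY y) ≤ 2 / 3}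

/-- Insertion of a loop of vertical self-maps, based at the identity, over the overlap. -/
theorem exists_loopInsert {pY : C(Y, S)} (v : C(S, ℝ)) (T : C(Overlap v pY × I, Y))
    (h0 : ∀ y, T (y, 0) = y.1) (h1 : ∀ y, T (y, 1) = y.1) :
    ∃ a : C(Y, Y), (∀ y, v (pY y) ≤ 1 / 3 ∨ 2 / 3 ≤ v (pY y) → a y = y) ∧
      ∀ y h, a y = T (⟨y, h⟩, clampI (3 * v (pY y) - 1)) := by
  obtain ⟨a, e1, e2, e3⟩ := exists_glue (v.comp pY) (a := 1 / 3) (b := 2 / 3) (by norm_num)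
    (⟨Subtype.val, by fun_prop⟩ : C({y // (v.comp pY) y ≤ 1 / 3}, Y))
    (⟨fun y => T (⟨y.1, y.2⟩, clampI (3 * v (pY y.1) - 1)), by fun_prop⟩ :
      C({y // 1 / 3 ≤ (v.comp pY) y ∧ (v.comp pY) y ≤ 2 / 3}, Y))
    (⟨Subtype.val, by fun_prop⟩ : C({y // 2 / 3 ≤ (v.comp pY) y}, Y))
    (fun y hy => by
      change v (pY y) = 1 / 3 at hy
      simp only [ContinuousMap.coe_mk]
      rw [clampI_of_le (by rw [hy]; norm_num), h0])
    (fun y hy => by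
      change v (pY y) = 2 / 3 at hy
      simp only [ContinuousMap.coe_mk]
      rw [clampI_of_ge (by rw [hy]; norm_num), h1])
  exact ⟨a, fun y hy => hy.elim (e1 y) (e3 y), fun y h => e2 y h⟩

/-- Homotopic loops can be inserted with vertically homotopic results. -/
theorem fibHomotopic_of_loopInsert {pY : C(Y, S)} (v : C(S, ℝ)) (K : C(Overlap v pY × I × I, Y))
    (h0 : ∀ y t, K (y, 0, t) = y.1) (h1 : ∀ y t, K (y, 1, t) = y.1)
    (hp : ∀ z, pY (K z) = pY z.1.1) {a b : C(Y, Y)}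
    (ha : ∀ y, v (pY y) ≤ 1 / 3 ∨ 2 / 3 ≤ v (pY y) → a y = y)
    (ha' : ∀ y h, a y = K (⟨y, h⟩, clampI (3 * v (pY y) - 1), 0))
    (hb : ∀ y, v (pY y) ≤ 1 / 3 ∨ 2 / 3 ≤ v (pY y) → b y = y)
    (hb' : ∀ y h, b y = K (⟨y, h⟩, clampI (3 * v (pY y) - 1), 1)) : FibHomotopic pY a b := by
  obtain ⟨F, e1, e2, e3⟩ := exists_glue (Z := Y × I) ⟨fun z => v (pY z.1), by fun_prop⟩
    (a := 1 / 3) (b := 2 / 3) (by norm_num)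
    (⟨fun z => z.1.1, by fun_prop⟩ : C({z : Y × I // v (pY z.1) ≤ 1 / 3}, Y))
    (⟨fun z => K (⟨z.1.1, z.2⟩, clampI (3 * v (pY z.1.1) - 1), z.1.2), by fun_prop⟩ :
      C({z : Y × I // 1 / 3 ≤ v (pY z.1) ∧ v (pY z.1) ≤ 2 / 3}, Y))
    (⟨fun z => z.1.1, by fun_prop⟩ : C({z : Y × I // 2 / 3 ≤ v (pY z.1)}, Y))
    (fun z hy => by
      change v (pY z.1) = 1 / 3 at hy
      simp only [ContinuousMap.coe_mk]
      rw [clampI_of_le (by rw [hy]; norm_num), h0])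
    (fun z hy => by
      change v (pY z.1) = 2 / 3 at hy
      simp only [ContinuousMap.coe_mk]
      rw [clampI_of_ge (by rw [hy]; norm_num), h1])
  simp only [ContinuousMap.coe_mk] at e1 e2 e3
  have hF : ∀ y t, pY (F (y, t)) = pY y := by
    intro y t
    rcases le_total (v (pY y)) (1 / 3) with h | h
    · rw [e1 (y, t) h]
    · rcases le_total (v (pY y)) (2 / 3) with h' | h'
      · rw [e2 (y, t) ⟨h, h'⟩, hp]
      · rw [e3 (y, t) h']
  have hF0 : ∀ y, F (y, 0) = a y := by
    intro y
    rcases le_total (v (pY y)) (1 / 3) with h | h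
    · rw [e1 (y, 0) h, ha y (Or.inl h)]
    · rcases le_total (v (pY y)) (2 / 3) with h' | h'
      · rw [e2 (y, 0) ⟨h, h'⟩, ha' y ⟨h, h'⟩]
      · rw [e3 (y, 0) h', ha y (Or.inr h')]
  refine ⟨F, hF0, fun y => ?_, fun y t => ?_⟩
  · rcases le_total (v (pY y)) (1 / 3) with h | h
    · rw [e1 (y, 1) h, hb y (Or.inl h)]
    · rcases le_total (v (pY y)) (2 / 3) with h' | h'
      · rw [e2 (y, 1) ⟨h, h'⟩, hb' y ⟨h, h'⟩]
      · rw [e3 (y, 1) h', hb y (Or.inr h')]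
  · rw [← hF0, hF, hF]

/-- A vertical self-map which is vertically homotopic to the identity over each of the two parts
of the base has a right inverse up to vertical homotopy. -/
theorem exists_right_inverse_of_local {pY : C(Y, S)} (v : C(S, ℝ)) (f : C(Y, Y))
    (h₀ : FibHomotopic pY (f.comp ⟨Subtype.val, continuous_subtype_val⟩)
      (⟨Subtype.val, continuous_subtype_val⟩ : C({y // pY y ∈ {s | 1 / 3 ≤ v s}}, Y)))
    (h₁ : FibHomotopic pY (f.comp ⟨Subtype.val, continuous_subtype_val⟩)
      (⟨Subtype.val, continuous_subtype_val⟩ : C({y // pY y ∈ {s | v s ≤ 2 / 3}}, Y))) :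
    ∃ g : C(Y, Y), (∀ y, pY (g y) = pY y) ∧ FibHomotopic pY (f.comp g) (.id Y) := by
  have hpf : ∀ y, pY (f y) = pY y := by
    intro y
    rcases le_total (v (pY y)) (2 / 3) with h | h
    · exact (h₁.proj_eq ⟨y, h⟩).symm
    · exact (h₀.proj_eq ⟨y, le_trans (by norm_num) h⟩).symm
  obtain ⟨P, P0, P1, Pp⟩ := h₀
  obtain ⟨Q, Q0, Q1, Qp⟩ := h₁
  simp only [ContinuousMap.coe_mk, Subtype.forall, ContinuousMap.comp_apply] at P0 P1 Pp Q0 Q1 Qp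
  -- the homotopies from the inserted loops to `f`
  let T₂ : C(Overlap v pY × I × I, Y) := ⟨fun z => if (z.2.1 : ℝ) ≤ 1 / 2 then
      Q (⟨z.1.1, z.1.2.2⟩, clampI (z.2.2 * (1 - 2 * z.2.1))) else
      P (⟨z.1.1, z.1.2.1⟩, clampI (z.2.2 * (2 * z.2.1 - 1))), by
    refine Continuous.if_le (by fun_prop) (by fun_prop) (by fun_prop) continuous_const ?_
    rintro ⟨y, x, t⟩ hx
    simp only at hx ⊢
    rw [hx]
    norm_num
    rw [Q0, P0]⟩
  have T₂0 : ∀ y t, T₂ (y, 0, t) = Q (⟨y.1, y.2.2⟩, t) := by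
    intro y t
    simp [T₂]
  have T₂1 : ∀ y t, T₂ (y, 1, t) = P (⟨y.1, y.2.1⟩, t) := by
    intro y t
    simp only [T₂, ContinuousMap.coe_mk]
    norm_num
  have T₂f : ∀ y x, T₂ (y, x, 0) = f y.1 := by
    intro y x
    simp [T₂, P0, Q0]
  have T₂p : ∀ z, pY (T₂ z) = pY z.1.1 := by
    intro z
    simp only [T₂, ContinuousMap.coe_mk]
    split_ifs
    · rw [Qp, hpf]
    · rw [Pp, hpf]
  -- On the overlap the two homotopies from `f` to the identity form a loop of vertical maps at the
  -- identity: back along `Q` to `f`, then along `P`. The map `f` is vertically homotopic to the map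
  -- `a` inserting this loop, and `b`, inserting the reversed loop, will invert it.
  let T : C(Overlap v pY × I, Y) := ⟨fun z => T₂ (z.1, z.2, 1), by fun_prop⟩
  have T0 : ∀ y, T (y, 0) = y.1 := fun y => (T₂0 y 1).trans (Q1 _ _)
  have T1 : ∀ y, T (y, 1) = y.1 := fun y => (T₂1 y 1).trans (P1 _ _)
  have Tp : ∀ z, pY (T z) = pY z.1.1 := fun z => T₂p _
  obtain ⟨a, a1, a2⟩ := exists_loopInsert v T T0 T1
  obtain ⟨b, b1, b2⟩ := exists_loopInsert v
    (⟨fun z => T (z.1, unitInterval.symm z.2), by fun_prop⟩ : C(Overlap v pY × I, Y))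
    (fun y => by simp [T1]) (fun y => by simp [T0])
  simp only [ContinuousMap.coe_mk] at b2
  have hcase : ∀ y, (v (pY y) ≤ 1 / 3 ∨ 2 / 3 ≤ v (pY y)) ∨
      (1 / 3 ≤ v (pY y) ∧ v (pY y) ≤ 2 / 3) := by
    intro y
    rcases le_total (v (pY y)) (1 / 3) with h | h
    · exact Or.inl (Or.inl h)
    · rcases le_total (v (pY y)) (2 / 3) with h' | h'
      · exact Or.inr ⟨h, h'⟩
      · exact Or.inl (Or.inr h')
  have hbp : ∀ y, pY (b y) = pY y := by
    intro y
    rcases hcase y with h | h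
    · rw [b1 y h]
    · rw [b2 y h, Tp]
  have hfa : FibHomotopic pY f a := by
    obtain ⟨F, e1, e2, e3⟩ := exists_glue (Z := Y × I) ⟨fun z => v (pY z.1), by fun_prop⟩
      (a := 1 / 3) (b := 2 / 3) (by norm_num)
      (⟨fun z => Q (⟨z.1.1, z.2.trans (by norm_num)⟩, z.1.2), by fun_prop⟩ :
        C({z : Y × I // v (pY z.1) ≤ 1 / 3}, Y))
      (⟨fun z => T₂ (⟨z.1.1, z.2⟩, clampI (3 * v (pY z.1.1) - 1), z.1.2), by fun_prop⟩ :
        C({z : Y × I // 1 / 3 ≤ v (pY z.1) ∧ v (pY z.1) ≤ 2 / 3}, Y))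
      (⟨fun z => P (⟨z.1.1, le_trans (by norm_num) z.2⟩, z.1.2), by fun_prop⟩ :
        C({z : Y × I // 2 / 3 ≤ v (pY z.1)}, Y))
      (fun z hy => by
        change v (pY z.1) = 1 / 3 at hy
        simp only [ContinuousMap.coe_mk]
        rw [clampI_of_le (by rw [hy]; norm_num), T₂0])
      (fun z hy => by
        change v (pY z.1) = 2 / 3 at hy
        simp only [ContinuousMap.coe_mk]
        rw [clampI_of_ge (by rw [hy]; norm_num), T₂1])
    simp only [ContinuousMap.coe_mk] at e1 e2 e3
    refine ⟨F, fun y => ?_, fun y => ?_, fun y t => ?_⟩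
    · rcases hcase y with (h | h) | h
      · rw [e1 (y, 0) h, Q0]
      · rw [e3 (y, 0) h, P0]
      · rw [e2 (y, 0) h, T₂f]
    · rcases hcase y with (h | h) | h
      · rw [e1 (y, 1) h, Q1, a1 y (Or.inl h)]
      · rw [e3 (y, 1) h, P1, a1 y (Or.inr h)]
      · rw [e2 (y, 1) h, a2 y h]; rfl
    · rcases hcase y with (h | h) | h
      · rw [e1 (y, t) h, Qp]
      · rw [e3 (y, t) h, Pp]
      · rw [e2 (y, t) h, T₂p, hpf]
  -- the inserted loops cancel
  let T' : C(Overlap v pY × I, Overlap v pY) := ⟨fun z => ⟨T z, by rw [Tp]; exact z.1.2⟩,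
    by fun_prop⟩
  -- The composite of `a` and `b` runs both loops simultaneously. `K₁` deforms this into the
  -- reversed loop followed by the loop itself, and `K₂` then cancels the two by cutting off the
  -- excursion.
  let K₁ : C(Overlap v pY × I × I, Y) := ⟨fun z => T (T' (z.1,
      clampI ((1 - z.2.2) * (1 - z.2.1) + z.2.2 * max 0 (1 - 2 * (z.2.1 : ℝ)))),
      clampI ((1 - z.2.2) * z.2.1 + z.2.2 * max 0 (2 * (z.2.1 : ℝ) - 1))), by fun_prop⟩
  let K₂ : C(Overlap v pY × I × I, Y) := ⟨fun z => T (z.1,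
      clampI (max |2 * (z.2.1 : ℝ) - 1| z.2.2)), by fun_prop⟩
  have T'0 : ∀ y, T' (y, 0) = y := fun y => Subtype.ext (T0 y)
  have T'1 : ∀ y, T' (y, 1) = y := fun y => Subtype.ext (T1 y)
  have K12 : ∀ y x, K₁ (y, x, 1) = K₂ (y, x, 0) := by
    intro y x
    simp only [K₁, K₂, ContinuousMap.coe_mk, Set.Icc.coe_one, Set.Icc.coe_zero, sub_self, zero_mul,
      one_mul, zero_add]
    rw [max_eq_left (abs_nonneg (2 * (x : ℝ) - 1))]
    rcases le_total (x : ℝ) (1 / 2) with h | h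
    · rw [max_eq_right (by linarith), max_eq_left (by linarith), clampI_zero, T0,
        abs_of_nonpos (by linarith), neg_sub]
      rfl
    · rw [max_eq_left (by linarith), max_eq_right (by linarith), clampI_zero, T'0,
        abs_of_nonneg (by linarith)]
  obtain ⟨d, d1, d2⟩ := exists_loopInsert v
    (⟨fun z => K₂ (z.1, z.2, 0), by fun_prop⟩ : C(Overlap v pY × I, Y))
    (fun y => by simp [K₂, T1]) (fun y => by norm_num [K₂, T1])
  have hab : FibHomotopic pY (a.comp b) d := by
    refine fibHomotopic_of_loopInsert v K₁ ?_ ?_ ?_ ?_ ?_ d1 ?_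
    · intro y t
      have e : (1 - (t : ℝ)) * (1 - ((0 : I) : ℝ)) + t * max 0 (1 - 2 * ((0 : I) : ℝ)) = 1 := by
        norm_num
      have e' : (1 - (t : ℝ)) * ((0 : I) : ℝ) + t * max 0 (2 * ((0 : I) : ℝ) - 1) = 0 := by
        norm_num
      simp only [K₁, ContinuousMap.coe_mk, e, e', clampI_zero, clampI_one, T0]
      exact T1 y
    · intro y t
      have e : (1 - (t : ℝ)) * (1 - ((1 : I) : ℝ)) + t * max 0 (1 - 2 * ((1 : I) : ℝ)) = 0 := by
        norm_num
      have e' : (1 - (t : ℝ)) * ((1 : I) : ℝ) + t * max 0 (2 * ((1 : I) : ℝ) - 1) = 1 := by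
        norm_num
      simp only [K₁, ContinuousMap.coe_mk, e, e', clampI_zero, clampI_one, T1]
      exact T0 y
    · intro z
      exact (Tp _).trans (Tp _)
    · intro y hy
      simp only [ContinuousMap.comp_apply]
      rw [b1 y hy, a1 y hy]
    · intro y hy
      simp only [ContinuousMap.comp_apply]
      rw [a2 (b y) (by rw [hbp]; exact hy)]
      simp only [hbp, K₁, ContinuousMap.coe_mk, Set.Icc.coe_zero, sub_zero, one_mul, zero_mul, add_zero,
        clampI_coe]
      congr 2
      refine Subtype.ext ((b2 y hy).trans ?_)
      change T _ = T _
      congr 2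
      exact (clampI_coe (unitInterval.symm (clampI (3 * v (pY y) - 1)))).symm
    · intro y hy
      rw [K12, d2 y hy]; rfl
  have hd : FibHomotopic pY d (.id Y) := by
    refine fibHomotopic_of_loopInsert v K₂ ?_ ?_ ?_ d1 d2 (fun _ _ => rfl) ?_
    · intro y t
      simp only [K₂, ContinuousMap.coe_mk]
      rw [clampI_of_ge (by norm_num), T1]
    · intro y t
      simp only [K₂, ContinuousMap.coe_mk]
      rw [clampI_of_ge (by norm_num), T1]
    · intro z
      exact Tp _
    · intro y hy
      simp only [K₂, ContinuousMap.coe_mk]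
      rw [clampI_of_ge (by norm_num), T1]; rfl
  exact ⟨b, hbp, ((hfa.comp_right b).trans hab).trans hd⟩

/-- A fibrewise map between fibrations over a base of category one, which is a homotopy equivalence
on the fibres over `b`, has a right inverse up to vertical homotopy. -/
theorem exists_fibre_right_inverse {pX : C(X, S)} {pY : C(Y, S)} (hX : IsFibration pX)
    (hY : IsFibration pY) (f : C(X, Y)) (hf : ∀ x, pY (f x) = pX x) {b : S}
    (k : C({y // pY y = b}, {x // pX x = b}))
    (hkf : (k.comp (fibreMap f hf b)).Homotopic (.id _))
    (hfk : ((fibreMap f hf b).comp k).Homotopic (.id _)) (v : C(S, ℝ))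
    (c₀ : C(S × I, S)) (hc₀ : ∀ s, c₀ (s, 0) = s) (hc₀' : ∀ s, 1 / 3 ≤ v s → c₀ (s, 1) = b)
    (c₁ : C(S × I, S)) (hc₁ : ∀ s, c₁ (s, 0) = s) (hc₁' : ∀ s, v s ≤ 2 / 3 → c₁ (s, 1) = b) :
    ∃ g : C(Y, X), (∀ y, pX (g y) = pY y) ∧ FibHomotopic pY (f.comp g) (.id Y) := by
  obtain ⟨g₀, p₀, r₀, l₀⟩ := exists_local_inverse hX hY f hf k hkf hfk c₀ hc₀ {s | 1 / 3 ≤ v s} hc₀'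
  obtain ⟨g₁, p₁, r₁, l₁⟩ := exists_local_inverse hX hY f hf k hkf hfk c₁ hc₁ {s | v s ≤ 2 / 3} hc₁'
  let i₀ : C(Overlap v pY, {y // pY y ∈ {s | 1 / 3 ≤ v s}}) := ⟨fun y => ⟨y.1, y.2.1⟩, by fun_prop⟩
  -- On the overlap g₁ ≃ g₁ f g₀ ≃ g₀.
  have ov : FibHomotopic pX (⟨fun y => g₁ ⟨y.1, y.2.2⟩, by fun_prop⟩ : C(Overlap v pY, X))
      ⟨fun y => g₀ ⟨y.1, y.2.1⟩, by fun_prop⟩ := by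
    have e1 := (r₀.comp_right i₀).comp_local (p' := pX) g₁ p₁
      (fun y => by
        change pY (f (g₀ (i₀ y))) ∈ _
        rw [hf, p₀]; exact y.2.2) (fun y => y.2.2)
    have e2 := l₁.comp_right (⟨fun y => ⟨g₀ (i₀ y), by rw [p₀]; exact y.2.2⟩, by fun_prop⟩ :
      C(Overlap v pY, {x // pX x ∈ {s | v s ≤ 2 / 3}}))
    exact e1.symm.trans e2
  obtain ⟨g, hg, hg₀, hg₁⟩ := exists_glue_fibHomotopic v g₀ g₁ p₀ p₁ ov
  -- The composite of `f` with the glued `g` is vertically homotopic to the identity over each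
  -- piece, but the homotopies need not match on the overlap; `k'` corrects this.
  obtain ⟨k', hk', hfk'⟩ := exists_right_inverse_of_local (pY := pY) v (f.comp g)
    ((hg₀.comp_left f hf).trans r₀) ((hg₁.comp_left f hf).trans r₁)
  exact ⟨g.comp k', fun y => (hg _).trans (hk' y), hfk'⟩

/-- **Dold's theorem** over a base of category one: a fibrewise map between fibrations which is a
homotopy equivalence on one fibre is a homotopy equivalence. -/
theorem exists_homotopy_inverse_of_fibre {pX : C(X, S)} {pY : C(Y, S)} (hX : IsFibration pX)
    (hY : IsFibration pY) (f : C(X, Y)) (hf : ∀ x, pY (f x) = pX x) {b : S}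
    (k : C({y // pY y = b}, {x // pX x = b}))
    (hkf : (k.comp (fibreMap f hf b)).Homotopic (.id _))
    (hfk : ((fibreMap f hf b).comp k).Homotopic (.id _)) (v : C(S, ℝ))
    (c₀ : C(S × I, S)) (hc₀ : ∀ s, c₀ (s, 0) = s) (hc₀' : ∀ s, 1 / 3 ≤ v s → c₀ (s, 1) = b)
    (c₁ : C(S × I, S)) (hc₁ : ∀ s, c₁ (s, 0) = s) (hc₁' : ∀ s, v s ≤ 2 / 3 → c₁ (s, 1) = b) :
    ∃ g : C(Y, X), (g.comp f).Homotopic (.id X) ∧ (f.comp g).Homotopic (.id Y) := by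
  obtain ⟨g, hg, hfg⟩ := exists_fibre_right_inverse hX hY f hf k hkf hfk v c₀ hc₀ hc₀' c₁ hc₁ hc₁'
  have e1 : ((fibreMap f hf b).comp (fibreMap g hg b)).Homotopic (.id _) := by
    obtain ⟨H, H0, H1, Hp⟩ := hfg
    have hH : ∀ z : {y // pY y = b} × I, pY (H (z.1.1, z.2)) = b := fun z =>
      (Hp _ _).trans (((hf _).trans (hg _)).trans z.1.2)
    refine homotopic_iff_exists.2 ⟨⟨fun z => ⟨H (z.1.1, z.2), hH z⟩, by fun_prop⟩, fun y => ?_,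
      fun y => ?_⟩
    · exact Subtype.ext (H0 _)
    · exact Subtype.ext (H1 _)
  -- A right inverse of a homotopy equivalence is homotopic to its inverse. Thus `g` is an
  -- equivalence on the fibre and has a right inverse `h` itself.
  have e2 : (fibreMap g hg b).Homotopic k :=
    ((hkf.comp (.refl (fibreMap g hg b))).symm :
      ContinuousMap.Homotopic (fibreMap g hg b)
        (k.comp ((fibreMap f hf b).comp (fibreMap g hg b)))).trans
      ((ContinuousMap.Homotopic.refl k).comp e1)
  have e3 : ((fibreMap g hg b).comp (fibreMap f hf b)).Homotopic (.id _) :=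
    (e2.comp (.refl (fibreMap f hf b))).trans hkf
  obtain ⟨h, -, hgh⟩ := exists_fibre_right_inverse hY hX g hg (fibreMap f hf b) e1 e3 v c₀ hc₀ hc₀'
    c₁ hc₁ hc₁'
  -- f ≃ f g h ≃ h.
  have e4 : f.Homotopic h :=
    (((ContinuousMap.Homotopic.refl f).comp hgh.homotopic).symm :
      f.Homotopic ((f.comp g).comp h)).trans (hfg.homotopic.comp (.refl h))
  exact ⟨g, ((ContinuousMap.Homotopic.refl g).comp e4).trans hgh.homotopic, hfg.homotopic⟩

end DoldGluing

/-! ### Strict sections -/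

/-- A homotopy section of a fibration over a well-pointed base is homotopic to a section. -/
theorem IsFibration.exists_section {E S : Type u} [TopologicalSpace E] [TopologicalSpace S]
    [Based E] [Based S] {p : PMap E S} (hp : IsFibration p.toMap) (h : Halo S) {s : PMap S E}
    (hs : IsHomotopySection p s) :
    ∃ s' : PMap S E, (∀ x, p.toMap (s'.toMap x) = x) ∧ s.Homotopic s' := by
  obtain ⟨J, J0, J1, Jpt⟩ := PMap.homotopic_iff.1 hs
  -- The homotopy is accelerated so as to be complete at time `1 - h.v x`. Evaluating the lift at
  -- that time gives a strict section, and since the time is 0 at the base point the section is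
  -- based.
  let ω : S × I → S := fun z => J (z.1, clampI (z.2 / (1 - h.v z.1)))
  have hv1 : ∀ x, x ≠ pt → 1 - h.v x ≠ 0 := fun x hx e =>
    hx ((h.v_eq_one x).1 (by linarith))
  -- The quotient has no limit at the base point, but `J` is constant there at all times, so
  -- compactness of `I` gives continuity.
  have hω : Continuous ω := by
    rw [continuous_iff_continuousAt]
    rintro ⟨x, t⟩
    by_cases hx : x = pt
    · subst hx
      intro O hO
      have e : ω (pt, t) = pt := Jpt _
      rw [e] at hO
      obtain ⟨O', hO', hO'o, hpt⟩ := mem_nhds_iff.1 hO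
      have hJ : IsOpen (J ⁻¹' O') := hO'o.preimage J.continuous
      obtain ⟨U, V, hU, -, hxU, hV, hUV⟩ := generalized_tube_lemma (s := {(pt : S)}) (t := Set.univ)
        isCompact_singleton isCompact_univ hJ (by
          rintro ⟨x, r⟩ ⟨hx, -⟩
          obtain rfl : x = pt := hx
          change J (pt, r) ∈ O'
          rw [Jpt]; exact hpt)
      have : U ×ˢ (Set.univ : Set I) ∈ nhds ((pt : S), t) :=
        prod_mem_nhds (hU.mem_nhds (hxU rfl)) Filter.univ_mem
      refine Filter.mem_map.2 (Filter.mem_of_superset this ?_)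
      rintro ⟨y, r⟩ ⟨hy, -⟩
      exact hO' (hUV ⟨hy, hV (Set.mem_univ _)⟩)
    · have h1 : ContinuousAt (fun z : S × I => (z.2 : ℝ) / (1 - h.v z.1)) (x, t) :=
        ContinuousAt.div (by fun_prop) (by fun_prop) (hv1 x hx)
      exact J.continuous.continuousAt.comp
        (continuousAt_fst.prodMk (continuous_clampI.continuousAt.comp h1))
  obtain ⟨Λ, Λ0, Λp⟩ := hp S s.toMap ⟨ω, hω⟩ (fun x => by simp [ω, J0]; rfl)
  have hw : ∀ x : S, ((clampI (1 - h.v x) : I) : ℝ) = 1 - h.v x := fun x =>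
    coe_clampI_of_mem (by linarith [h.v_le_one x]) (by linarith [h.v_nonneg x])
  refine ⟨⟨⟨fun x => Λ (x, clampI (1 - h.v x)), by fun_prop⟩, ?_⟩, fun x => ?_,
    PMap.homotopic_iff.2 ⟨⟨fun z => Λ (z.1, z.2 * clampI (1 - h.v z.1)), by fun_prop⟩,
      fun x => ?_, fun x => ?_, fun t => ?_⟩⟩
  · simp only [ContinuousMap.coe_mk, h.v_pt, sub_self, clampI_zero, Λ0, s.map_pt]
  · refine (Λp _).trans ?_
    simp only [ω, ContinuousMap.coe_mk, hw]
    by_cases hx : x = pt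
    · rw [hx, Jpt]
    · rw [div_self (hv1 x hx), clampI_one, J1]; rfl
  · simp [Λ0]
  · simp
  · simp [h.v_pt, Λ0, s.map_pt]

/-! ### Adjunction and homotopies -/

section Adjoint

variable {X : Type u} {Y : Type v} {X' : Type*} {Y' : Type*}
  [TopologicalSpace X] [TopologicalSpace Y] [TopologicalSpace X'] [TopologicalSpace Y']
  [Based X] [Based Y] [Based X'] [Based Y']

/-- The product `f × g` of two based maps. -/
def PMap.prodMap (f : PMap X X') (g : PMap Y Y') : PMap (X × Y) (X' × Y') :=
  ⟨f.toMap.prodMap g.toMap, Prod.ext f.map_pt g.map_pt⟩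

theorem PMap.Homotopic.prodMap {f f' : PMap X X'} {g g' : PMap Y Y'} (hf : f.Homotopic f')
    (hg : g.Homotopic g') : (f.prodMap g).Homotopic (f'.prodMap g') := by
  obtain ⟨F, F0, F1, Fpt⟩ := PMap.homotopic_iff.1 hf
  obtain ⟨G, G0, G1, Gpt⟩ := PMap.homotopic_iff.1 hg
  exact PMap.homotopic_iff.2 ⟨⟨fun z => (F (z.1.1, z.2), G (z.1.2, z.2)), by fun_prop⟩,
    fun z => Prod.ext (F0 _) (G0 _), fun z => Prod.ext (F1 _) (G1 _),
    fun t => Prod.ext (Fpt t) (Gpt t)⟩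

theorem PMap.Homotopic.ad {f f' : PMap (Susp X) Y} (hf : f.Homotopic f') :
    (ad f).Homotopic (PtdHtpy.ad f') := by
  obtain ⟨F, F0, F1, Fpt⟩ := PMap.homotopic_iff.1 hf
  let G : X × I → LoopSp Y := fun z =>
    { toFun := fun t => F (suspMk X (z.1, t), z.2)
      continuous_toFun := by fun_prop
      source' := by rw [suspMk_zero, Fpt]
      target' := by rw [suspMk_one, Fpt] }
  have hG : Continuous G := by
    rw [← Path.continuous_uncurry_iff]
    change Continuous fun z : (X × I) × I => F (suspMk X (z.1.1, z.2), z.1.2)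
    fun_prop
  refine PMap.homotopic_iff.2 ⟨⟨G, hG⟩, fun x => ?_, fun x => ?_, fun t => ?_⟩
  · ext t; exact F0 _
  · ext t; exact F1 _
  · ext r
    change F (suspMk X (pt, r), t) = pt
    rw [suspMk_pt, Fpt]

/-- If the generalized Whitehead product of `α` and `β` is trivial, then the commutator of their
adjoints is trivial. -/
theorem IsWhiteheadProduct.commutator_homotopic_const {α : PMap (Susp X) X'} {β : PMap (Susp Y) X'}
    {h : PMap (Susp (Smash X Y)) X'} (hh : IsWhiteheadProduct α β h)
    (h0 : h.Homotopic (PMap.const _ _)) :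
    ((commutatorMap X').comp ((ad α).prodMap (ad β))).Homotopic (PMap.const _ _) := by
  obtain ⟨S, hS, hw⟩ := hh
  have h1 : (PMap.const (Smash X Y) (LoopSp X')).Homotopic
      (S.comp (smashMap (ad α) (ad β))) := (h0.symm.trans hw).ad
  -- Restriction along the quotient map to the smash product; the square formed by `smashMk` and
  -- `smashMap` commutes definitionally.
  have h2 : ((S.comp (smashMk _ _)).comp ((ad α).prodMap (ad β))).Homotopic (PMap.const _ _) :=
    (h1.comp_right (smashMk X Y)).symm
  exact (hS.comp_right ((ad α).prodMap (ad β))).symm.trans h2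

end Adjoint

/-! ### The torus extension -/

section Torus

theorem trans_clampI_left {X : Type u} [TopologicalSpace X] {x y z : X} (a : Path x y)
    (b : Path y z) {r : ℝ} (h0 : 0 ≤ r) (h1 : r ≤ 1) :
    a.trans b (clampI (r / 2)) = a (clampI r) := by
  have e : (clampI (r / 2) : ℝ) = r / 2 := coe_clampI_of_mem (by linarith) (by linarith)
  rw [Path.trans_apply, dif_pos (by rw [e]; linarith)]
  congr 1
  ext
  rw [coe_clampI_of_mem h0 h1]
  simp only [e]
  ring

theorem trans_clampI_right {X : Type u} [TopologicalSpace X] {x y z : X} (a : Path x y)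
    (b : Path y z) {r : ℝ} (h0 : 0 ≤ r) (h1 : r ≤ 1) :
    a.trans b (clampI ((1 + r) / 2)) = b (clampI r) := by
  have e : (clampI ((1 + r) / 2) : ℝ) = (1 + r) / 2 :=
    coe_clampI_of_mem (by linarith) (by linarith)
  rcases h0.eq_or_lt with rfl | h
  · rw [Path.trans_apply, dif_pos (by rw [e]; norm_num), clampI_zero, b.source]
    convert a.target using 2
    ext
    simp only [e]
    norm_num
  · rw [Path.trans_apply, dif_neg (by rw [e]; linarith)]
    congr 1
    ext
    rw [coe_clampI_of_mem h0 h1]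
    simp only [e]
    ring

/-- The commutator of two loops, read along the boundary of a square, gives a map on the square
whose opposite sides agree. -/
theorem exists_square {W X : Type*} [TopologicalSpace W] [TopologicalSpace X] (K : C(W × I × I, X))
    (x₀ : X) (α β : W → I → X) (hα0 : ∀ w, α w 0 = x₀) (hβ0 : ∀ w, β w 0 = x₀)
    (K1 : ∀ w r, K (w, 1, r) = x₀) (Ks : ∀ w r, K (w, r, 0) = x₀) (Kt : ∀ w r, K (w, r, 1) = x₀)
    (k1 : ∀ w (r : I), K (w, 0, clampI (r / 4)) = α w r)
    (k2 : ∀ w (r : I), K (w, 0, clampI ((1 + r) / 4)) = β w r)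
    (k3 : ∀ w (r : I), K (w, 0, clampI ((3 - r) / 4)) = α w r)
    (k4 : ∀ w (r : I), K (w, 0, clampI ((4 - r) / 4)) = β w r) :
    ∃ R : C(W × I × I, X),
      (∀ w (t : I), R (w, t, 0) = α w (clampI (3 * t - 1))) ∧
      (∀ w (t : I), R (w, t, 1) = α w (clampI (3 * t - 1))) ∧
      (∀ w (t : I), R (w, 0, t) = β w (clampI (3 * t - 1))) ∧
      ∀ w (t : I), R (w, 1, t) = β w (clampI (3 * t - 1)) := by
  let c : ℝ → ℝ := fun r => clampI r
  have hc : Continuous c := continuous_subtype_val.comp continuous_clampI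
  have c0 : ∀ r, r ≤ 0 → c r = 0 := fun r h => by simp [c, clampI_of_le h]
  have c1 : ∀ r, 1 ≤ r → c r = 1 := fun r h => by simp [c, clampI_of_ge h]
  have cm : ∀ r, 0 ≤ r → r ≤ 1 → c r = r := fun r h h' => coe_clampI_of_mem h h'
  -- `V` is the homotopy time and `T` the loop parameter. The value of `a` rises from 0 at the
  -- corner (0, 0) to 1 at (1, 1), while `y` separates the two routes between them. For `a = 0` the
  -- pair `(V, T)` runs around the three sides on which `K` is constant. The two boundary routes
  -- read the first half of the commutator forwards and the second half backwards, meeting at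
  -- parameter 1/2.
  let a : ℝ → ℝ → ℝ := fun t u => (c (3 * t - 1) + c (3 * u - 1)) / 2
  let y : ℝ → ℝ → ℝ := fun t u => c (1 / 2 + 3 / 2 * (u - t))
  let V : ℝ → ℝ → ℝ := fun t u => (1 - a t u) * min 1 (min (3 * y t u) (3 - 3 * y t u))
  let T : ℝ → ℝ → ℝ := fun t u => a t u / 2 + (1 - a t u) * c (3 * y t u - 1)
  have hV : Continuous fun z : ℝ × ℝ => V z.1 z.2 := by fun_prop
  have hT : Continuous fun z : ℝ × ℝ => T z.1 z.2 := by fun_prop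
  have hVT : ∀ w t u v τ, V t u = v → T t u = τ →
      K (w, clampI (V t u), clampI (T t u)) = K (w, clampI v, clampI τ) := by
    rintro w t u v τ rfl rfl; rfl
  refine ⟨⟨fun z => K (z.1, clampI (V z.2.1 z.2.2), clampI (T z.2.1 z.2.2)), ?_⟩, fun w t => ?_,
    fun w t => ?_, fun w t => ?_, fun w t => ?_⟩
  · have := hV.comp (by fun_prop : Continuous fun z : W × I × I => ((z.2.1 : ℝ), (z.2.2 : ℝ)))
    have := hT.comp (by fun_prop : Continuous fun z : W × I × I => ((z.2.1 : ℝ), (z.2.2 : ℝ)))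
    exact K.continuous.comp (continuous_fst.prodMk
      ((continuous_clampI.comp ‹_›).prodMk (continuous_clampI.comp this)))
  · have h0 := t.2.1
    have h1 := t.2.2
    simp only [ContinuousMap.coe_mk, Set.Icc.coe_zero]
    rcases le_total (t : ℝ) (1 / 3) with h | h
    · have ha : a t 0 = 0 := by
        simp only [a]; rw [c0 _ (by linarith), c0 _ (by norm_num)]; norm_num
      have hy : y t 0 = 1 / 2 - 3 / 2 * t := by
        simp only [y]; rw [cm _ (by linarith) (by linarith)]; ring
      rw [clampI_of_le (x := 3 * (t : ℝ) - 1) (by linarith), hα0]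
      rcases le_total (y t 0) (1 / 3) with h' | h'
      · have : T t 0 = 0 := by simp only [T, ha]; rw [c0 _ (by linarith)]; norm_num
        rw [this, clampI_zero, Ks]
      · have : V t 0 = 1 := by
          simp only [V, ha]
          rw [min_eq_left (le_min (by linarith) (by linarith))]; norm_num
        rw [this, clampI_one, K1]
    · have hy : y t 0 = 0 := c0 _ (by linarith)
      have ha : a t 0 = c (3 * t - 1) / 2 := by
        simp only [a]; rw [c0 (3 * 0 - 1) (by norm_num)]; ring
      rw [hVT w t 0 0 (c (3 * t - 1) / 4) (by norm_num [V, hy])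
        (by simp only [T, hy, ha]; rw [c0 (3 * 0 - 1) (by norm_num)]; ring), clampI_zero]
      exact k1 w _
  · have h0 := t.2.1
    have h1 := t.2.2
    simp only [ContinuousMap.coe_mk, Set.Icc.coe_one]
    have ha : a t 1 = (c (3 * t - 1) + 1) / 2 := by
      simp only [a]; rw [c1 (3 * 1 - 1) (by norm_num)]
    rcases le_total (t : ℝ) (2 / 3) with h | h
    · have hy : y t 1 = 1 := c1 _ (by linarith)
      rw [hVT w t 1 0 ((3 - c (3 * t - 1)) / 4) (by norm_num [V, hy])
        (by simp only [T, hy, ha]; rw [c1 (3 * 1 - 1) (by norm_num)]; ring), clampI_zero]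
      exact k3 w _
    · have e : c (3 * t - 1) = 1 := c1 _ (by linarith)
      rw [hVT w t 1 0 ((3 - c (3 * t - 1)) / 4) (by simp [V, ha, e])
        (by simp only [T, ha, e]; norm_num), clampI_zero]
      exact k3 w _
  · have h0 := t.2.1
    have h1 := t.2.2
    simp only [ContinuousMap.coe_mk, Set.Icc.coe_zero]
    rcases le_total (t : ℝ) (1 / 3) with h | h
    · have ha : a 0 t = 0 := by
        simp only [a]; rw [c0 _ (by norm_num), c0 _ (by linarith)]; norm_num
      have hy : y 0 t = 1 / 2 + 3 / 2 * t := by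
        simp only [y]; rw [cm _ (by linarith) (by linarith)]; ring
      rw [clampI_of_le (x := 3 * (t : ℝ) - 1) (by linarith), hβ0]
      rcases le_total (y 0 t) (2 / 3) with h' | h'
      · have : V 0 t = 1 := by
          simp only [V, ha]
          rw [min_eq_left (le_min (by linarith) (by linarith))]; norm_num
        rw [this, clampI_one, K1]
      · have : T 0 t = 1 := by simp only [T, ha]; rw [c1 _ (by linarith)]; norm_num
        rw [this, clampI_one, Kt]
    · have hy : y 0 t = 1 := c1 _ (by linarith)
      have ha : a 0 t = c (3 * t - 1) / 2 := by
        simp only [a]; rw [c0 (3 * 0 - 1) (by norm_num)]; ring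
      rw [hVT w 0 t 0 ((4 - c (3 * t - 1)) / 4) (by norm_num [V, hy])
        (by simp only [T, hy, ha]; rw [c1 (3 * 1 - 1) (by norm_num)]; ring), clampI_zero]
      exact k4 w _
  · have h0 := t.2.1
    have h1 := t.2.2
    simp only [ContinuousMap.coe_mk, Set.Icc.coe_one]
    have ha : a 1 t = (1 + c (3 * t - 1)) / 2 := by
      simp only [a]; rw [c1 (3 * 1 - 1) (by norm_num)]
    rcases le_total (t : ℝ) (2 / 3) with h | h
    · have hy : y 1 t = 0 := c0 _ (by linarith)
      rw [hVT w 1 t 0 ((1 + c (3 * t - 1)) / 4) (by norm_num [V, hy])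
        (by simp only [T, hy, ha]; rw [c0 (3 * 0 - 1) (by norm_num)]; ring), clampI_zero]
      exact k2 w _
    · have e : c (3 * t - 1) = 1 := c1 _ (by linarith)
      rw [hVT w 1 t 0 ((1 + c (3 * t - 1)) / 4) (by simp [V, ha, e])
        (by simp only [T, ha, e]; norm_num), clampI_zero]
      exact k2 w _

/-- Collapsing a neighbourhood of the base point of a suspension is homotopic to the identity. -/
theorem Halo.exists_pinch {A : Type u} [TopologicalSpace A] [Based A] (h : Halo A) :
    ∃ ψ : PMap (Susp A) (Susp A), ψ.Homotopic (PMap.id _) ∧ ∀ (a : A) (t : I),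
      ψ.toMap (suspMk A (a, t)) = suspMk A (h.H (a, 1), clampI (3 * clampI (4 * t - 1) - 1)) := by
  -- The composite of `3 * t - 1` and `4 * t - 1` is the reparametrisation that `exists_square` and
  -- `Halo.exists_susp_descent` leave behind; it is joined linearly to the identity.
  obtain ⟨G, hG⟩ := exists_susp_lift_prod (P := I) (⟨fun z => suspMk A (h.H (z.1.1, z.2),
    clampI ((1 - z.2) * z.1.2 + z.2 * clampI (3 * clampI (4 * (z.1.2 : ℝ) - 1) - 1))),
      by fun_prop⟩ : C((A × I) × I, Susp A)) (fun _ => pt) (by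
    rintro ⟨a, t⟩ (hz | hz | hz) r
    · simp only at hz
      subst hz
      simp only [ContinuousMap.coe_mk, h.H_pt, suspMk_pt]
    · simp only at hz
      subst hz
      simp only [ContinuousMap.coe_mk, Set.Icc.coe_zero, mul_zero, zero_add]
      rw [clampI_of_le (x := 0 - 1) (by norm_num), Set.Icc.coe_zero,
        clampI_of_le (x := 3 * 0 - 1) (by norm_num), Set.Icc.coe_zero, mul_zero, clampI_zero,
        suspMk_zero]
    · simp only at hz
      subst hz
      simp only [ContinuousMap.coe_mk, Set.Icc.coe_one]
      rw [clampI_of_ge (x := 4 * 1 - 1) (by norm_num), Set.Icc.coe_one,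
        clampI_of_ge (x := 3 * 1 - 1) (by norm_num), Set.Icc.coe_one, mul_one, mul_one,
        sub_add_cancel, clampI_one, suspMk_one])
  simp only [ContinuousMap.coe_mk] at hG
  have hpt : ∀ r, G (pt, r) = pt := by
    intro r
    rw [← suspMk_pt (A := A) 0, hG, h.H_pt, suspMk_pt, suspMk_pt]
  refine ⟨⟨⟨fun x => G (x, 1), by fun_prop⟩, hpt 1⟩, PMap.Homotopic.symm (PMap.homotopic_iff.2
    ⟨G, fun x => ?_, fun x => rfl, hpt⟩), fun a t => ?_⟩
  · obtain ⟨⟨a, t⟩, rfl⟩ := suspMk_surjective x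
    rw [hG, h.H_zero]
    simp [PMap.id]
  · simp only [ContinuousMap.coe_mk]
    rw [hG]
    simp

/-- If the commutator of the adjoints of `α : ΣA → X` and `β : ΣB → X` is trivial, then `α ∨ β`
extends, up to homotopy, over `ΣA × ΣB`. -/
theorem exists_torus_extension {A : Type u} {B : Type v} {X : Type w} [TopologicalSpace A]
    [TopologicalSpace B] [TopologicalSpace X] [Based A] [Based B] [Based X] [T1Space A] [T1Space B]
    (h : Halo A) (k : Halo B) (α : PMap (Susp A) X) (β : PMap (Susp B) X)
    (hc : ((commutatorMap X).comp ((ad α).prodMap (ad β))).Homotopic (PMap.const _ _)) :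
    ∃ (m : C(Susp A × Susp B, X)) (ψ : PMap (Susp A) (Susp A)) (χ : PMap (Susp B) (Susp B)),
      ψ.Homotopic (PMap.id _) ∧ χ.Homotopic (PMap.id _) ∧
      (∀ x, m (x, pt) = α.toMap (ψ.toMap x)) ∧ ∀ y, m (pt, y) = β.toMap (χ.toMap y) := by
  obtain ⟨ψ, hψ, ψ'⟩ := h.exists_pinch
  obtain ⟨χ, hχ, χ'⟩ := k.exists_pinch
  obtain ⟨C, C0, C1, -⟩ := PMap.homotopic_iff.1 hc
  have cval : ∀ (w : A × B) (r : I), C (w, 0) r = (((ad α).toMap w.1).trans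
      ((ad β).toMap w.2)).trans (((ad α).toMap w.1).symm.trans ((ad β).toMap w.2).symm) r := by
    intro w r
    rw [C0]; rfl
  obtain ⟨R, R0, R1, R2, R3⟩ := exists_square (W := A × B)
    (⟨fun z => C (z.1, z.2.1) z.2.2, by fun_prop⟩ : C((A × B) × I × I, X)) pt
    (fun w t => α.toMap (suspMk A (w.1, t))) (fun w t => β.toMap (suspMk B (w.2, t)))
    (fun w => by rw [suspMk_zero, α.map_pt]) (fun w => by rw [suspMk_zero, β.map_pt])
    (fun w r => by simp only [ContinuousMap.coe_mk]; rw [C1]; rfl)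
    (fun w r => (C (w, r)).source) (fun w r => (C (w, r)).target)
    (fun w r => by
      have h0 := r.2.1
      have h1 := r.2.2
      simp only [ContinuousMap.coe_mk]
      rw [cval, show (r : ℝ) / 4 = r / 2 / 2 by ring,
        trans_clampI_left _ _ (by linarith) (by linarith), trans_clampI_left _ _ h0 h1, clampI_coe]
      rfl)
    (fun w r => by
      have h0 := r.2.1
      have h1 := r.2.2
      simp only [ContinuousMap.coe_mk]
      rw [cval, show (1 + (r : ℝ)) / 4 = (1 + r) / 2 / 2 by ring,
        trans_clampI_left _ _ (by linarith) (by linarith), trans_clampI_right _ _ h0 h1, clampI_coe]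
      rfl)
    (fun w r => by
      have h0 := (unitInterval.symm r).2.1
      have h1 := (unitInterval.symm r).2.2
      simp only [ContinuousMap.coe_mk]
      rw [cval, show (3 - (r : ℝ)) / 4 = (1 + (unitInterval.symm r : ℝ) / 2) / 2 by
          rw [unitInterval.coe_symm_eq]; ring,
        trans_clampI_right _ _ (by linarith) (by linarith), trans_clampI_left _ _ h0 h1, clampI_coe,
        Path.symm_apply, Function.comp_apply, unitInterval.symm_symm]
      rfl)
    (fun w r => by
      have h0 := (unitInterval.symm r).2.1
      have h1 := (unitInterval.symm r).2.2
      simp only [ContinuousMap.coe_mk]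
      rw [cval, show (4 - (r : ℝ)) / 4 = (1 + (1 + (unitInterval.symm r : ℝ)) / 2) / 2 by
          rw [unitInterval.coe_symm_eq]; ring,
        trans_clampI_right _ _ (by linarith) (by linarith), trans_clampI_right _ _ h0 h1,
        clampI_coe, Path.symm_apply, Function.comp_apply, unitInterval.symm_symm]
      rfl)
  -- The square is closed up to ΣB first, with the point of `A` and its suspension coordinate as
  -- parameters; the result is then closed up to ΣA with ΣB as the parameter space.
  obtain ⟨M, M0, M1⟩ := k.exists_susp_descent (W := A × I)
    (⟨fun z => R ((z.1.1, z.2.1), z.1.2, z.2.2), by fun_prop⟩ : C((A × I) × B × I, X))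
    (fun z => α.toMap (suspMk A (z.1, clampI (3 * z.2 - 1)))) (fun z b => R0 _ _)
    (fun z b => R1 _ _)
  -- At the two ends of the coordinate of ΣA the family no longer depends on `a`, as the second
  -- descent requires. The correction path of the first descent is constant there.
  have hM : ∀ a t, (∀ b (r : I), R ((a, b), t, r) = β.toMap (suspMk B (b, clampI (3 * r - 1)))) →
      clampI (3 * (t : ℝ) - 1) ∈ ({0, 1} : Set I) → ∀ y, M ((a, t), y) = β.toMap (χ.toMap y) := by
    intro a t hR ht y
    obtain ⟨⟨b, r⟩, rfl⟩ := suspMk_surjective y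
    rw [M1, χ']
    · exact hR _ _
    intro r
    refine (hR _ _).trans ?_
    rw [ suspMk_pt, β.map_pt]
    rcases ht with ht | ht <;> rw [ht]
    · rw [suspMk_zero, α.map_pt]
    · rw [suspMk_one, α.map_pt]
  obtain ⟨N, N0, N1⟩ := h.exists_susp_descent (W := Susp B)
    (⟨fun z => M (z.2, z.1), by fun_prop⟩ : C(Susp B × A × I, X))
    (fun y => β.toMap (χ.toMap y))
    (fun y a => hM a 0 (fun b r => R2 _ _) (Or.inl (clampI_of_le (by norm_num))) y)
    (fun y a => hM a 1 (fun b r => R3 _ _) (Or.inr (clampI_of_ge (by norm_num))) y)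
  refine ⟨⟨fun z => N (z.2, z.1), by fun_prop⟩, ψ, χ, hψ, hχ, fun x => ?_, fun y => N0 y⟩
  obtain ⟨⟨a, t⟩, rfl⟩ := suspMk_surjective x
  simp only [ContinuousMap.coe_mk] at N1 ⊢
  rw [N1 pt, M0, ψ']
  intro t
  rw [M0, suspMk_pt, χ.map_pt, α.map_pt, β.map_pt]

end Torus

/-! ### The comparison map `ΣB × ΣF → E` -/

/-- A map defined on a product with a suspension is modified to a map whose composite with the
retraction `r` is folded along the suspension coordinate. -/
theorem exists_fold {A : Type u} {S : Type v} {E : Type w} [TopologicalSpace A] [Based A]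
    [T1Space A] [TopologicalSpace S] [TopologicalSpace E] (m : C(S × Susp A, E)) (r : C(E, E))
    (hr : ∀ x, r (m (x, pt)) = m (x, pt)) :
    ∃ (D₀ : C(Susp A × I, Susp A)) (D : PMap (Susp A) (Susp A)) (m' : C(S × Susp A, E)),
      D.Homotopic (PMap.id _) ∧ (∀ y, D₀ (y, 1) = pt) ∧
      (∀ z, m' z = m (z.1, D₀ (z.2, 0)) ∨ m' z = r (m (z.1, D₀ (z.2, 0)))) ∧
      (∀ x, m' (x, pt) = m (x, pt)) ∧
      ∀ x, (∀ y, r (m (x, y)) = m (x, pt)) → ∀ y, m' (x, y) = m (x, D.toMap y) := by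
  -- At time 0 the suspension coordinate runs up to 1 and back down; time shrinks this excursion to
  -- the base point. The map `G` below doubles the speed instead and is homotopic to the identity.
  obtain ⟨D₀, hD₀⟩ := exists_susp_lift_prod (P := I) (⟨fun z => suspMk A (z.1.1,
    clampI ((1 - z.2) * min (2 * (z.1.2 : ℝ)) (2 - 2 * (z.1.2 : ℝ)))), by fun_prop⟩ :
      C((A × I) × I, Susp A)) (fun _ => pt) (by
    rintro ⟨a, t⟩ (hz | hz | hz) r
    · simp only at hz
      subst hz
      exact suspMk_pt _
    · simp only at hz
      subst hz
      simp [suspMk_zero]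
    · simp only at hz
      subst hz
      simp [suspMk_zero])
  obtain ⟨G, hG⟩ := exists_susp_lift_prod (P := I) (⟨fun z => suspMk A (z.1.1,
    clampI ((1 + z.2) * z.1.2)), by fun_prop⟩ :
      C((A × I) × I, Susp A)) (fun _ => pt) (by
    rintro ⟨a, t⟩ (hz | hz | hz) r
    · simp only at hz
      subst hz
      exact suspMk_pt _
    · simp only at hz
      subst hz
      simp [suspMk_zero]
    · simp only at hz
      subst hz
      simp only [ContinuousMap.coe_mk]
      rw [clampI_of_ge (by simpa using r.2.1), suspMk_one])
  simp only [ContinuousMap.coe_mk] at hD₀ hG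
  have hGpt : ∀ t, G (pt, t) = pt := by
    intro t
    rw [← suspMk_pt (A := A) 0, hG, suspMk_pt, suspMk_pt]
  have hDpt : ∀ t, D₀ (pt, t) = pt := by
    intro t
    rw [← suspMk_pt (A := A) 0, hD₀, suspMk_pt, suspMk_pt]
  -- Continuity is checked on two closed halves of ΣA, because `S` is arbitrary and its product with
  -- ΣA need not be a quotient. The halves meet where `D₀ (y, 0)` is the base point, and there `r`
  -- changes nothing.
  let C₁ : Set (Susp A) := {y | ∃ z : A × I, suspMk A z = y ∧ (z.2 : ℝ) ≤ 1 / 2}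
  let C₂ : Set (Susp A) := {y | ∃ z : A × I, suspMk A z = y ∧ 1 / 2 ≤ (z.2 : ℝ)}
  have mem₁ : ∀ z : A × I, suspMk A z ∈ C₁ ↔ (z.2 : ℝ) ≤ 1 / 2 ∨ z ∈ suspBase A := by
    intro z
    constructor
    · rintro ⟨z', h, h'⟩
      rcases suspMk_eq_iff.1 h with rfl | ⟨-, h⟩
      exacts [Or.inl h', Or.inr h]
    · rintro (h | h)
      · exact ⟨z, rfl, h⟩
      · exact ⟨(z.1, 0), by rw [suspMk_eq_pt h, suspMk_zero], by norm_num⟩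
  have mem₂ : ∀ z : A × I, suspMk A z ∈ C₂ ↔ 1 / 2 ≤ (z.2 : ℝ) ∨ z ∈ suspBase A := by
    intro z
    constructor
    · rintro ⟨z', h, h'⟩
      rcases suspMk_eq_iff.1 h with rfl | ⟨-, h⟩
      exacts [Or.inl h', Or.inr h]
    · rintro (h | h)
      · exact ⟨z, rfl, h⟩
      · exact ⟨(z.1, 1), by rw [suspMk_eq_pt h, suspMk_one], by norm_num⟩
  have cl₁ : IsClosed C₁ := by
    rw [← isQuotientMap_suspMk.isClosed_preimage]
    have : suspMk A ⁻¹' C₁ = {z | (z.2 : ℝ) ≤ 1 / 2} ∪ suspBase A := by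
      ext z; exact mem₁ z
    rw [this]
    exact (isClosed_le (by fun_prop) (by fun_prop)).union isClosed_suspBase
  have cl₂ : IsClosed C₂ := by
    rw [← isQuotientMap_suspMk.isClosed_preimage]
    have : suspMk A ⁻¹' C₂ = {z | 1 / 2 ≤ (z.2 : ℝ)} ∪ suspBase A := by
      ext z; exact mem₂ z
    rw [this]
    exact (isClosed_le (by fun_prop) (by fun_prop)).union isClosed_suspBase
  have hcover : ∀ y, y ∈ C₁ ∨ y ∈ C₂ := by
    intro y
    obtain ⟨z, rfl⟩ := suspMk_surjective y
    rcases le_total (z.2 : ℝ) (1 / 2) with h | h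
    exacts [Or.inl ⟨z, rfl, h⟩, Or.inr ⟨z, rfl, h⟩]
  have hover : ∀ y, y ∈ C₁ → y ∈ C₂ → D₀ (y, 0) = pt := by
    intro y h h'
    obtain ⟨z, rfl⟩ := suspMk_surjective y
    by_cases hz : z ∈ suspBase A
    · rw [suspMk_eq_pt hz, hDpt]
    · have e : (z.2 : ℝ) = 1 / 2 :=
        le_antisymm (((mem₁ z).1 h).resolve_right hz) (((mem₂ z).1 h').resolve_right hz)
      rw [hD₀, e, clampI_of_ge (by norm_num), suspMk_one]
  classical
  let M : S × Susp A → E := fun z =>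
    if z.2 ∈ C₁ then m (z.1, D₀ (z.2, 0)) else r (m (z.1, D₀ (z.2, 0)))
  have M₁ : ∀ z : S × Susp A, z.2 ∈ C₁ → M z = m (z.1, D₀ (z.2, 0)) := fun z hz => if_pos hz
  have M₂ : ∀ z : S × Susp A, z.2 ∈ C₂ → M z = r (m (z.1, D₀ (z.2, 0))) := by
    intro z hz
    by_cases h : z.2 ∈ C₁
    · rw [M₁ z h, hover z.2 h hz, hr]
    · exact if_neg h
  have hM : Continuous M := by
    rw [← continuousOn_univ]
    have hu : (Set.univ : Set (S × Susp A)) = {z | z.2 ∈ C₁} ∪ {z | z.2 ∈ C₂} := by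
      ext z
      simpa using hcover z.2
    rw [hu]
    refine ContinuousOn.union_of_isClosed ?_ ?_ (cl₁.preimage continuous_snd)
      (cl₂.preimage continuous_snd)
    · exact (by fun_prop : Continuous fun z : S × Susp A =>
        m (z.1, D₀ (z.2, 0))).continuousOn.congr fun z hz => M₁ z hz
    · exact (by fun_prop : Continuous fun z : S × Susp A =>
        r (m (z.1, D₀ (z.2, 0)))).continuousOn.congr fun z hz => M₂ z hz
  refine ⟨D₀, ⟨⟨fun y => G (y, 1), by fun_prop⟩, hGpt 1⟩, ⟨M, hM⟩,
    PMap.Homotopic.symm (PMap.homotopic_iff.2 ⟨G, fun y => ?_, fun y => rfl, hGpt⟩),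
    fun y => ?_, fun z => ?_, fun x => ?_, fun x hx y => ?_⟩
  · obtain ⟨⟨a, t⟩, rfl⟩ := suspMk_surjective y
    rw [hG]
    simp [PMap.id]
  · obtain ⟨⟨a, t⟩, rfl⟩ := suspMk_surjective y
    rw [hD₀]
    simp [suspMk_zero]
  · rcases hcover z.2 with h | h
    exacts [Or.inl (M₁ z h), Or.inr (M₂ z h)]
  · refine (M₁ (x, pt) ⟨(pt, 0), rfl, by norm_num⟩).trans ?_
    simp only [hDpt]
  · obtain ⟨⟨a, t⟩, rfl⟩ := suspMk_surjective y
    have h0 := t.2.1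
    simp only [ContinuousMap.coe_mk, hG]
    rcases le_total (t : ℝ) (1 / 2) with h | h
    · rw [M₁ _ ⟨(a, t), rfl, h⟩, hD₀, min_eq_left (by linarith)]
      norm_num
    · rw [M₂ _ ⟨(a, t), rfl, h⟩, hx, clampI_of_ge (by norm_num; linarith), suspMk_one]

/-- The complement of the base point of a suspension is contracted to the base point. -/
theorem Halo.exists_susp_contraction {A : Type u} [TopologicalSpace A] [Based A]
    (k : Halo (Susp A)) : ∃ c : C(Susp A × I, Susp A), (∀ x, c (x, 0) = x) ∧
      ∀ x, k.v x ≤ 2 / 3 → c (x, 1) = pt := by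
  -- The suspension coordinate shrinks to 0 with a factor that is cut off near the base point.
  -- Without the cutoff the end `t = 1` would move and the map would not be well defined.
  obtain ⟨G, hG⟩ := exists_susp_lift_prod (P := I) (⟨fun z => suspMk A (z.1.1,
    clampI (z.1.2 * (1 - z.2 * clampI (3 - 3 * k.v (suspMk A z.1))))), by fun_prop⟩ :
      C((A × I) × I, Susp A)) (fun _ => pt) (by
    rintro ⟨a, t⟩ (hz | hz | hz) r
    · simp only at hz
      subst hz
      exact suspMk_pt _
    · simp only at hz
      subst hz
      simp [suspMk_zero]
    · simp only at hz
      subst hz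
      simp [suspMk_one, k.v_pt])
  simp only [ContinuousMap.coe_mk] at hG
  refine ⟨G, fun x => ?_, fun x hx => ?_⟩
  · obtain ⟨⟨a, t⟩, rfl⟩ := suspMk_surjective x
    rw [hG]
    simp
  · obtain ⟨⟨a, t⟩, rfl⟩ := suspMk_surjective x
    rw [hG, clampI_of_ge (x := 3 - _) (by linarith)]
    simp [suspMk_zero]

theorem isFibration_fst (S F : Type u) [TopologicalSpace S] [TopologicalSpace F] :
    IsFibration (ContinuousMap.fst : C(S × F, S)) := by
  intro Y _ f h hh
  exact ⟨⟨fun z => (h z, (f z.1).2), by fun_prop⟩, fun y => Prod.ext (hh y) rfl, fun z => rfl⟩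

section Axes

variable (X : Type u) (Y : Type v) [TopologicalSpace X] [TopologicalSpace Y] [Based X] [Based Y]

/-- The inclusion of the first axis. -/
def PMap.inl : PMap X (X × Y) := ⟨⟨fun x => (x, pt), by fun_prop⟩, rfl⟩

/-- The inclusion of the second axis. -/
def PMap.inr : PMap Y (X × Y) := ⟨⟨fun y => (pt, y), by fun_prop⟩, rfl⟩

end Axes

/-- A map `ΣB × F' → E` which over `ΣB` is homotopic to the projection, by a homotopy fixed over
the base point, and which restricts to a homotopy equivalence of `F'` with the fibre, is a homotopy
equivalence. -/
theorem IsFibration.exists_homotopy_inverse_of_fst {B F' E : Type u} [TopologicalSpace B]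
    [TopologicalSpace F'] [TopologicalSpace E] [Based B] {p : C(E, Susp B)} (hp : IsFibration p)
    (k : Halo (Susp B)) (m : C(Susp B × F', E))
    (hm : (p.comp m).HomotopicRel ContinuousMap.fst {z | z.1 = pt})
    (e : ContinuousMap.HomotopyEquiv F' (p ⁻¹' {pt})) (f : C(F', F')) (hf : f.Homotopic (.id F'))
    (he : ∀ y, m (pt, y) = e (f y)) :
    ∃ n : C(E, Susp B × F'), (n.comp m).Homotopic (.id _) ∧ (m.comp n).Homotopic (.id E) := by
  obtain ⟨Θ⟩ := hm
  have hpe : ∀ y, p (e y) = pt := fun y => (e y).2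
  -- Lifting the homotopy to the projection replaces `m` by the map `m₁` over ΣB.
  obtain ⟨Λ, Λ0, Λp⟩ := hp _ m ⟨fun z => Θ (z.2, z.1), by fun_prop⟩ (fun z => Θ.apply_zero z)
  simp only [ContinuousMap.coe_mk] at Λp
  have Θ1 : ∀ z, Θ (1, z) = z.1 := fun z => Θ.apply_one z
  have Θpt : ∀ t y, Θ (t, (pt, y)) = pt := by
    intro t y
    refine (Θ.eq_fst t (x := (pt, y)) rfl).trans ?_
    simp only [ContinuousMap.comp_apply]
    rw [he, hpe]
  let m₁ : C(Susp B × F', E) := ⟨fun z => Λ (z, 1), by fun_prop⟩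
  have hm₁ : ∀ z, p (m₁ z) = ContinuousMap.fst z := fun z => (Λp _).trans (Θ1 z)
  have hmm₁ : m.Homotopic m₁ := homotopic_iff_exists.2 ⟨Λ, Λ0, fun z => rfl⟩
  let ι : C(F', {x : Susp B × F' // ContinuousMap.fst x = pt}) :=
    ⟨fun y => ⟨(pt, y), rfl⟩, by fun_prop⟩
  let ρ : C({x : Susp B × F' // ContinuousMap.fst x = pt}, F') := ⟨fun x => x.1.2, by fun_prop⟩
  have hιρ : ι.comp ρ = .id _ := by
    refine ContinuousMap.ext fun x => Subtype.ext (Prod.ext x.2.symm rfl)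
  let a : C(F', {y : E // p y = pt}) := ⟨fun y => ⟨e y, hpe y⟩, by fun_prop⟩
  let b : C({y : E // p y = pt}, F') := ⟨fun y => e.invFun ⟨y.1, y.2⟩, by fun_prop⟩
  have hba : (b.comp a).Homotopic (.id _) := e.left_inv
  have hab : (a.comp b).Homotopic (.id _) := e.right_inv
  -- The homotopy is fixed over the base point, so its lift stays in that fibre, and there `m₁` is
  -- homotopic to `e ∘ f`, hence to `e`.
  have hfib : ((fibreMap m₁ hm₁ pt).comp ι).Homotopic a := by
    have e1 : ((fibreMap m₁ hm₁ pt).comp ι).Homotopic (a.comp f) := by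
      have hΛ : ∀ z : F' × I, p (Λ ((pt, z.1), z.2)) = pt := fun z => by rw [Λp, Θpt]
      refine (homotopic_iff_exists.2 ⟨⟨fun z => ⟨Λ ((pt, z.1), z.2), hΛ z⟩, by fun_prop⟩,
        fun y => ?_, fun y => ?_⟩ : (a.comp f).Homotopic _).symm
      · exact Subtype.ext ((Λ0 _).trans (he y))
      · rfl
    exact e1.trans ((ContinuousMap.Homotopic.refl a).comp hf)
  obtain ⟨c, hc0, hc1⟩ := k.exists_susp_contraction
  -- The two pieces of ΣB are `v ≥ 1 / 3`, contracted by the halo, and `v ≤ 2 / 3`, contracted along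
  -- the suspension coordinate.
  obtain ⟨n, hn, hn'⟩ := exists_homotopy_inverse_of_fibre (isFibration_fst (Susp B) F') hp m₁ hm₁
    (b := pt) (ι.comp b) (by
      have e1 : (((ι.comp b).comp (fibreMap m₁ hm₁ pt)).comp (ι.comp ρ)).Homotopic
          ((ι.comp b).comp (a.comp ρ)) :=
        (ContinuousMap.Homotopic.refl (ι.comp b)).comp (hfib.comp (.refl ρ))
      have e2 : ((ι.comp b).comp (a.comp ρ)).Homotopic (ι.comp ρ) :=
        (ContinuousMap.Homotopic.refl ι).comp (hba.comp (.refl ρ))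
      rw [hιρ] at e1 e2
      exact e1.trans e2) (by
      exact (hfib.comp (.refl b)).trans hab)
    k.v k.H k.H_zero (fun s hs => k.H_one s (lt_of_lt_of_le (by norm_num) hs)) c hc0 hc1
  exact ⟨n, ((ContinuousMap.Homotopic.refl n).comp hmm₁).trans hn,
    (hmm₁.comp (.refl n)).trans hn'⟩

/-- For a fibration `ΣF → E → ΣB` with a homotopy section and vanishing brace product there is a
homotopy equivalence `ΣB × ΣF → E` restricting to the section and to the inclusion of the fibre. -/
theorem exists_equiv_prod {B F E : Type u} [TopologicalSpace B] [TopologicalSpace F]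
    [TopologicalSpace E] [Based B] [Based F] [Based E] [T1Space B] [T1Space F] (hB : Halo B)
    (hF : Halo F) (hE : Halo E) (i : PMap (Susp F) E) (p : PMap E (Susp B)) (s : PMap (Susp B) E)
    (hfib : IsFibrationSequence i p) (hs : IsHomotopySection p s)
    (hbrace : IsBraceProduct i s (PMap.id (Susp B)) (PMap.id (Susp F))
      (PMap.const (Susp (Smash B F)) (Susp F))) :
    ∃ m : PMap (Susp B × Susp F) E, m.IsHomotopyEquiv ∧ (m.comp (PMap.inl _ _)).Homotopic s ∧
      (m.comp (PMap.inr _ _)).Homotopic i := by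
  obtain ⟨k⟩ := hB.nonempty_susp
  obtain ⟨k'⟩ := hF.nonempty_susp
  -- Strictness matters for the fold: s' ∘ p must fix the first axis pointwise and commute strictly
  -- with projection.
  obtain ⟨s', ps', hss'⟩ := hfib.isFibration.exists_section k hs
  obtain ⟨e, he⟩ := hfib.fibre
  have hpi : ∀ y, p.toMap (i.toMap y) = pt := fun y => by rw [← he]; exact (e y).2
  have hcomm : ((commutatorMap E).comp ((ad s').prodMap (ad i))).Homotopic (PMap.const _ _) := by
    have h1 := IsWhiteheadProduct.commutator_homotopic_const hbrace (by
      have : i.comp (PMap.const (Susp (Smash B F)) (Susp F)) = PMap.const _ _ :=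
        PMap.ext_toMap fun x => i.map_pt
      rw [this]
      exact .refl _)
    exact ((hss'.symm.ad.prodMap (.refl (ad i))).comp_left (commutatorMap E)).trans h1
  obtain ⟨m, ψ, χ, hψ, hχ, m1, m2⟩ := exists_torus_extension hB hF s' i hcomm
  obtain ⟨D₀, D, m', hD, hD₀, m3, m4, m5⟩ := exists_fold m (s'.toMap.comp p.toMap) (fun x => by
    simp only [ContinuousMap.comp_apply]
    rw [m1, ps'])
  have m6 : ∀ y, m' (pt, y) = i.toMap (χ.toMap (D.toMap y)) := by
    intro y
    rw [m5 pt, m2]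
    intro y
    simp only [ContinuousMap.comp_apply]
    rw [m2, hpi, s'.map_pt, m1, ψ.map_pt, s'.map_pt]
  have m7 : ∀ x, m' (x, pt) = s'.toMap (ψ.toMap x) := fun x => by rw [m4, m1]
  have hpm : ∀ z, p.toMap (m' z) = p.toMap (m (z.1, D₀ (z.2, 0))) := by
    intro z
    rcases m3 z with h | h
    · rw [h]
    · rw [h]
      simp only [ContinuousMap.comp_apply]
      rw [ps']
  -- Both halves of the fold have the same projection, so shrinking `D₀` contracts p ∘ m' to its
  -- values on the first axis. Over the base point the projection is constant throughout.
  have h1 : (p.toMap.comp m').HomotopicRel (ψ.toMap.comp ContinuousMap.fst) {z | z.1 = pt} := by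
    refine ⟨⟨⟨⟨fun z => p.toMap (m (z.2.1, D₀ (z.2.2, z.1))), by fun_prop⟩, fun z => ?_,
      fun z => ?_⟩, ?_⟩⟩
    · exact (hpm z).symm
    · change p.toMap (m (z.1, D₀ (z.2, 1))) = _
      rw [hD₀, m1, ps']; rfl
    · rintro t ⟨x, y⟩ hx
      obtain rfl : x = pt := hx
      simp only [ContinuousMap.coe_mk, ContinuousMap.comp_apply]
      rw [m2, hpi, m6, hpi]
  have h2 : (ψ.toMap.comp (ContinuousMap.fst : C(Susp B × Susp F, Susp B))).HomotopicRel
      ContinuousMap.fst {z | z.1 = pt} := by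
    obtain ⟨G, G0, G1, Gpt⟩ := PMap.homotopic_iff.1 hψ
    refine ⟨⟨⟨⟨fun z => G (z.2.1, z.1), by fun_prop⟩, fun z => ?_, fun z => ?_⟩, ?_⟩⟩
    · exact G0 _
    · exact G1 _
    · rintro t ⟨x, y⟩ hx
      obtain rfl : x = pt := hx
      simp only [ContinuousMap.coe_mk, ContinuousMap.comp_apply]
      rw [Gpt]
      exact ψ.map_pt.symm
  have hχD : (χ.comp D).Homotopic (PMap.id _) := (hD.comp_left χ).trans hχ
  obtain ⟨n, hn, hn'⟩ := IsFibration.exists_homotopy_inverse_of_fst hfib.isFibration k m'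
    (h1.trans h2) e (χ.comp D).toMap (by
      obtain ⟨G, G0, G1, -⟩ := PMap.homotopic_iff.1 hχD
      exact homotopic_iff_exists.2 ⟨G, G0, G1⟩) (fun y => by rw [m6, he]; rfl)
  let μ : PMap (Susp B × Susp F) E := ⟨m', by
    refine (m7 pt).trans ?_
    rw [ψ.map_pt, s'.map_pt]⟩
  refine ⟨μ, Halo.isHomotopyEquiv (k.prod k') hE μ n hn hn', ?_, ?_⟩
  · have : μ.comp (PMap.inl _ _) = s'.comp ψ := PMap.ext_toMap m7
    rw [this]
    exact (hψ.comp_left s').trans hss'.symm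
  · have : μ.comp (PMap.inr _ _) = i.comp (χ.comp D) := PMap.ext_toMap m6
    rw [this]
    exact hχD.comp_left i

/-! ### Loop maps -/

section LoopMaps

variable {X : Type u} {Y : Type v} {Z : Type w} [TopologicalSpace X] [TopologicalSpace Y]
  [TopologicalSpace Z] [Based X] [Based Y] [Based Z]

theorem PMap.IsHomotopyEquiv.comp {g : PMap Y Z} {f : PMap X Y} (hg : g.IsHomotopyEquiv)
    (hf : f.IsHomotopyEquiv) : (g.comp f).IsHomotopyEquiv := by
  obtain ⟨f', h1, h2⟩ := hf
  obtain ⟨g', h3, h4⟩ := hg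
  exact ⟨f'.comp g', ((h3.comp_right f).comp_left f').trans h1,
    ((h2.comp_right g').comp_left g).trans h4⟩

theorem PMap.IsHomotopyEquiv.of_homotopic {f g : PMap X Y} (hf : f.IsHomotopyEquiv)
    (h : f.Homotopic g) : g.IsHomotopyEquiv := by
  obtain ⟨f', h1, h2⟩ := hf
  exact ⟨f', (h.symm.comp_left f').trans h1, (h.symm.comp_right f').trans h2⟩

theorem PMap.IsHomotopyEquiv.homotopyEquivalent_symm {f : PMap X Y} (hf : f.IsHomotopyEquiv) :
    HomotopyEquivalent Y X := by
  obtain ⟨f', h1, h2⟩ := hf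
  exact ⟨f', f, h2, h1⟩

theorem PMap.Homotopic.loopMap {f g : PMap X Y} (h : f.Homotopic g) :
    (loopMap f).Homotopic (PtdHtpy.loopMap g) := by
  obtain ⟨F, F0, F1, Fpt⟩ := PMap.homotopic_iff.1 h
  let G : LoopSp X × I → LoopSp Y := fun z =>
    { toFun := fun t => F (z.1 t, z.2)
      continuous_toFun := by fun_prop
      source' := by rw [z.1.source, Fpt]
      target' := by rw [z.1.target, Fpt] }
  have hG : Continuous G := by
    rw [← Path.continuous_uncurry_iff]
    change Continuous fun z : (LoopSp X × I) × I => F (z.1.1 z.2, z.1.2)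
    fun_prop
  refine PMap.homotopic_iff.2 ⟨⟨G, hG⟩, fun x => ?_, fun x => ?_, fun t => ?_⟩
  · ext t; exact F0 _
  · ext t; exact F1 _
  · ext r; exact Fpt t

theorem PMap.IsHomotopyEquiv.loopMap {f : PMap X Y} (hf : f.IsHomotopyEquiv) :
    (loopMap f).IsHomotopyEquiv := by
  obtain ⟨g, h1, h2⟩ := hf
  exact ⟨PtdHtpy.loopMap g, h1.loopMap, h2.loopMap⟩

variable (X Y) in
/-- A pair of loops is a loop in the product. -/
def loopProd : PMap (LoopSp X × LoopSp Y) (LoopSp (X × Y)) where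
  toMap :=
    { toFun := fun z => z.1.prod z.2
      continuous_toFun := by
        rw [← Path.continuous_uncurry_iff]
        change Continuous fun z : (LoopSp X × LoopSp Y) × I => (z.1.1 z.2, z.1.2 z.2)
        fun_prop }
  map_pt := rfl

theorem isHomotopyEquiv_loopProd : (loopProd X Y).IsHomotopyEquiv := by
  have h : Continuous fun γ : LoopSp (X × Y) =>
      (((loopMap ⟨ContinuousMap.fst, rfl⟩ : PMap (LoopSp (X × Y)) (LoopSp X)).toMap γ,
        (loopMap ⟨ContinuousMap.snd, rfl⟩ : PMap (LoopSp (X × Y)) (LoopSp Y)).toMap γ)) := by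
    fun_prop
  let g : PMap (LoopSp (X × Y)) (LoopSp X × LoopSp Y) := ⟨⟨_, h⟩, rfl⟩
  have e1 : g.comp (loopProd X Y) = PMap.id _ := PMap.ext_toMap fun z => rfl
  have e2 : (loopProd X Y).comp g = PMap.id _ := PMap.ext_toMap fun z => rfl
  exact ⟨g, e1 ▸ .refl _, e2 ▸ .refl _⟩

variable (X) in
/-- Concatenation of loops. -/
def loopMul : PMap (LoopSp X × LoopSp X) (LoopSp X) :=
  ⟨⟨fun z => z.1.trans z.2, Path.continuous_trans⟩, Path.refl_trans_refl⟩

/-- The loop map of a map out of a product, on pairs of loops, is the product of the loop maps of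
its restrictions to the axes. -/
theorem homotopic_loopMul_axes (m : PMap (X × Y) Z) :
    ((loopMul Z).comp ((loopMap (m.comp (PMap.inl X Y))).prodMap
      (loopMap (m.comp (PMap.inr X Y))))).Homotopic ((loopMap m).comp (loopProd X Y)) := by
  -- The second loop is delayed by the reversed homotopy time: with delay 1 the loops run in
  -- succession, with delay 0 simultaneously.
  let G : (LoopSp X × LoopSp Y) × I → LoopSp Z := fun z =>
    { toFun := fun t => m.toMap (z.1.1 (clampI ((1 + unitInterval.symm z.2) * t)),
        z.1.2 (clampI ((1 + unitInterval.symm z.2) * t - unitInterval.symm z.2)))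
      continuous_toFun := by fun_prop
      source' := by
        have := (unitInterval.symm z.2).2.1
        rw [Set.Icc.coe_zero, mul_zero, clampI_zero, clampI_of_le (by linarith), z.1.1.source,
          z.1.2.source]
        exact m.map_pt
      target' := by
        have := (unitInterval.symm z.2).2.1
        rw [Set.Icc.coe_one, mul_one, clampI_of_ge (by linarith), clampI_of_ge (by linarith),
          z.1.1.target, z.1.2.target]
        exact m.map_pt }
  have hG : Continuous G := by
    rw [← Path.continuous_uncurry_iff]
    change Continuous fun z : ((LoopSp X × LoopSp Y) × I) × I =>
      m.toMap (z.1.1.1 (clampI ((1 + unitInterval.symm z.1.2) * z.2)),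
        z.1.1.2 (clampI ((1 + unitInterval.symm z.1.2) * z.2 - unitInterval.symm z.1.2)))
    fun_prop
  refine PMap.homotopic_iff.2 ⟨⟨G, hG⟩, ?_, ?_, fun t => ?_⟩
  · rintro ⟨a, b⟩
    ext t
    change m.toMap (a (clampI ((1 + unitInterval.symm 0) * t)),
      b (clampI ((1 + unitInterval.symm 0) * t - unitInterval.symm 0))) =
      Path.trans ((loopMap (m.comp (PMap.inl X Y))).toMap a)
        ((loopMap (m.comp (PMap.inr X Y))).toMap b) t
    rw [Path.trans_apply, unitInterval.symm_zero, Set.Icc.coe_one]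
    split_ifs with h
    · change _ = m.toMap (a _, pt)
      rw [clampI_of_le (x := (1 + 1) * (t : ℝ) - 1) (by linarith), b.source]
      congr 3
      ext
      rw [coe_clampI_of_mem (by linarith [t.2.1]) (by linarith)]
      norm_num
    · change _ = m.toMap (pt, b _)
      rw [clampI_of_ge (x := (1 + 1) * (t : ℝ)) (by linarith), a.target]
      congr 3
      ext
      rw [coe_clampI_of_mem (by linarith) (by linarith [t.2.2])]
      norm_num
  · rintro ⟨a, b⟩
    ext t
    change m.toMap (a (clampI ((1 + unitInterval.symm 1) * t)),
      b (clampI ((1 + unitInterval.symm 1) * t - unitInterval.symm 1))) = m.toMap (a t, b t)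
    simp
  · ext r; exact m.map_pt

/-- Concatenation in a product is coordinatewise and a map acts pointwise on loops, so the equality
is strict. In the proof that φ_s is an `H`-map, homotopies enter only through the comparison with
this map. -/
theorem loopMap_loopProd_mul (m : PMap (X × Y) Z) (a a' : LoopSp X) (b b' : LoopSp Y) :
    ((loopMap m).comp (loopProd X Y)).toMap (a.trans a', b.trans b') =
      Path.trans (((loopMap m).comp (loopProd X Y)).toMap (a, b))
        (((loopMap m).comp (loopProd X Y)).toMap (a', b')) := by
  ext t
  change m.toMap (Path.trans a a' t, Path.trans b b' t) = _
  simp only [Path.trans_apply]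
  split_ifs <;> rfl

end LoopMaps

/-- If a based map `ΣB × ΣF → E` restricting to `s` and `i` on the axes is a homotopy equivalence,
then `φ_s` is an `H`-splitting. -/
theorem isHSplitting_of_isHomotopyEquiv {F E B : Type u} [TopologicalSpace F] [TopologicalSpace E]
    [TopologicalSpace B] [Based F] [Based E] [Based B] (s : PMap B E) (i : PMap F E)
    (m : PMap (B × F) E) (hm : m.IsHomotopyEquiv) (h1 : (m.comp (PMap.inl _ _)).Homotopic s)
    (h2 : (m.comp (PMap.inr _ _)).Homotopic i) : IsHSplitting s i := by
  have h : (phi s i).Homotopic ((loopMap m).comp (loopProd B F)) :=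
    ((h1.loopMap.prodMap h2.loopMap).symm.comp_left (loopMul E)).trans (homotopic_loopMul_axes m)
  refine ⟨(hm.loopMap.comp isHomotopyEquiv_loopProd).of_homotopic h.symm, (phi s i).map_pt, ?_⟩
  let μ : PMap ((LoopSp B × LoopSp F) × (LoopSp B × LoopSp F)) (LoopSp B × LoopSp F) :=
    ⟨HSpace.hmul, HSpace.hmul_e_e⟩
  have e : ((loopMap m).comp (loopProd B F)).comp μ = (loopMul E).comp
      (((loopMap m).comp (loopProd B F)).prodMap ((loopMap m).comp (loopProd B F))) :=
    PMap.ext_toMap fun z => loopMap_loopProd_mul m _ _ _ _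
  -- The strict multiplicativity `e` is transported along `h` on both sides.
  have key : ((phi s i).comp μ).Homotopic ((loopMul E).comp ((phi s i).prodMap (phi s i))) :=
    (e ▸ h.comp_right μ).trans ((h.prodMap h).symm.comp_left (loopMul E))
  exact key

end PtdHtpy

end

/-- The cell structures enter only through halos: those of `B` and `F` serve the descent to the
suspensions and make these well-pointed, and that of `E` turns the free homotopy equivalence into a
based one. -/
theorem mainTheorem7 {B F E : Type u}
    [TopologicalSpace B] [T2Space B] [Topology.CWComplex (Set.univ : Set B)] [Based B]
    [TopologicalSpace F] [T2Space F] [Topology.CWComplex (Set.univ : Set F)] [Based F]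
    [TopologicalSpace E] [T2Space E] [Topology.CWComplex (Set.univ : Set E)] [Based E]
    (i : PMap (Susp F) E) (p : PMap E (Susp B)) (s : PMap (Susp B) E)
    (hfib : IsFibrationSequence i p) (hs : IsHomotopySection p s)
    (hbrace : IsBraceProduct i s (PMap.id (Susp B)) (PMap.id (Susp F))
      (PMap.const (Susp (Smash B F)) (Susp F))) :
    HomotopyEquivalent E (Susp B × Susp F) ∧ IsHSplitting s i := by
  obtain ⟨hB⟩ := nonempty_halo_of_cwComplex B
  obtain ⟨hF⟩ := nonempty_halo_of_cwComplex F
  obtain ⟨hE⟩ := nonempty_halo_of_cwComplex E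
  obtain ⟨m, hm, h1, h2⟩ := exists_equiv_prod hB hF hE i p s hfib hs hbrace
  exact ⟨hm.homotopyEquivalent_symm, isHSplitting_of_isHomotopyEquiv s i m hm h1 h2⟩
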